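/- Let $\kappa>0$, $0<\alpha<\theta<\beta<\infty$, $I=(\alpha,\beta)$, $\lambda\in\mathbb R$ and $\langle x\rangle=\sqrt{1+x^2}$. Let $L^2_\lambda(\mathbb R)=e^{\lambda\langle x\rangle}L^2(\mathbb R)$ and $L^2_\lambda(I\times\mathbb R)=e^{\lambda\langle x\rangle}L^2(I\times\mathbb R)$ (complex-valued functions, with the norm $\|f\|=\|e^{-\lambda\langle x\rangle}f\|_{L^2}$), and let $H^2_\lambda$ denote the space of functions whose weak derivatives of order at most $2$ all lie in $L^2_\lambda$. Put $$B=\partial_x^2-\partial_x,\qquad L_0=\kappa(\theta-\sigma)\,\partial_\sigma+\tfrac{\sigma^2}{2}\,B,$$ with domains $H^2_\lambda(\mathbb R)$ in $L^2_\lambda(\mathbb R)$ and $H^2_\lambda(I\times\mathbb R)$ in $L^2_\lambda(I\times\mathbb R)$, respectively, and $$\delta_t(\sigma)=\theta(1-e^{-\kappa t})+\sigma e^{-\kappa t},$$ $$\mathfrak D(t,\sigma)=\frac{(\theta-\sigma)^2}{4\kappa}(1-e^{-2\kappa t})-\frac{\theta(\theta-\sigma)}{\kappa}(1-e^{-\kappa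 t})+\frac12\theta^2t .$$ Say that an operator generates a $c_0$ semigroup if its closure is the generator of that semigroup. Then $B$ generates a $c_0$ semigroup $e^{tB}$ on $L^2_\lambda(\mathbb R)$, the operators $$(S(t)h)(\sigma,\cdot)=e^{\mathfrak D(t,\sigma)B}\,h(\delta_t(\sigma),\cdot),\qquad t\ge 0,\ \sigma\in I,$$ are well defined and bounded on $L^2_\lambda(I\times\mathbb R)$, and they form the $c_0$ semigroup $S(t)=e^{tL_0}$ generated by $L_0$. For every $h\in L^2_\lambda(I\times\mathbb R)$ the function $u(t)=S(t)h=e^{tL_0}h$ has the following properties. 1. For all $t>0$ and almost every $\sigma\in I$ one has $\mathfrak D=\mathfrak D(t,\sigma)>0$ and, for almost every $x\in\mathbb R$, $$u(t,\sigma,x)=\frac{1}{\sqrt{4\pi\mathfrak D}}\int_{\mathbb R}e^{-\frac{|x-y-\mathfrak D|^2}{4\mathfrak D}}\,h(\delta_t(\sigma),y)\,dy,$$ the integral being absolutely convergent for every $x$. 2. $u$ is a mild solution on $[0,T]$, for every $T>0$, of the initial value problem $\partial_tv-L_0v=0$, $v(0)=h$. 3. If $h\in H^2_\lambda(I\times\mathbb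 R)$, then $u$ is a strong solution on $[0,T]$ for every $T>0$: it is continuous on $[0,T]$ with values in $L^2_\lambda(I\times\mathbb R)$, $u(0)=h$, and on $(0,T]$ it is continuously differentiable with $u(t)\in H^2_\lambda(I\times\mathbb R)$ and $u'(t)=L_0u(t)$. 4. Suppose that $h\in C^{1,2}(I\times\mathbb R)\cap L^2_\lambda(I\times\mathbb R)$, i.e. $h,\partial_\sigma h,\partial_xh,\partial_x^2h$ exist and are continuous on $I\times\mathbb R$, and that for some $m\in\mathbb R$ the maps $\sigma\mapsto h(\sigma,\cdot)$ and $\sigma\mapsto\partial_\sigma h(\sigma,\cdot)$ are locally bounded from $I$ to $L^2_m(\mathbb R)$ (for instance, $h$ and $\partial_\sigma h$ are bounded). Then $u$ has a representative that is a classical solution on $[0,T]$ for every $T>0$: it is continuous on $[0,T]\times I\times\mathbb R$ and equals $h$ at $t=0$, its derivatives $\partial_tu,\partial_\sigma u,\partial_xu,\partial_x^2u$ exist and are continuous on $(0,T]\times I\times\mathbb R$, and $\partial_tu=L_0u$ holds at every point there. -/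

import Mathlib

open Set Filter Topology MeasureTheory
open scoped ContDiff NNReal ENNReal

/-! ### Operators, semigroups and solutions on a Banach space

A possibly unbounded operator `P` on `X` is represented by its graph, a set of pairs
`(ξ, P ξ)` with `ξ` in the domain of `P`. -/

/-- A strongly continuous semigroup of bounded operators (only times `t ≥ 0` matter). -/
structure IsC0Semigroup {X : Type*} [NormedAddCommGroup X] [NormedSpace ℂ X]
    (S : ℝ → X →L[ℂ] X) : Prop where
  add : ∀ t₁ t₂ : ℝ, 0 ≤ t₁ → 0 ≤ t₂ → S (t₁ + t₂) = (S t₁).comp (S t₂)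
  zero : S 0 = ContinuousLinearMap.id ℂ X
  tendsto : ∀ ξ : X, Tendsto (fun t : ℝ => S t ξ) (𝓝[>] 0) (𝓝 ξ)

/-- `P` generates `S`: `S` is a strongly continuous semigroup whose generator
`ξ ↦ lim_{t ↘ 0} t⁻¹ (S t ξ - ξ)` (defined where the limit exists) is the closure of `P`
(hence `P` itself when `P` is closed). -/
def Generates {X : Type*} [NormedAddCommGroup X] [NormedSpace ℂ X]
    (P : Set (X × X)) (S : ℝ → X →L[ℂ] X) : Prop :=
  IsC0Semigroup S ∧ ∀ ξ η : X,
    Tendsto (fun t : ℝ => ((t : ℂ)⁻¹) • (S t ξ - ξ)) (𝓝[>] 0) (𝓝 η) ↔ (ξ, η) ∈ closure P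

open Classical in
/-- The semigroup `t ↦ e^{tP}` generated by `P` (it is unique for `t ≥ 0`);
the value `0` is only used when `P` generates no semigroup. -/
noncomputable def expSemigroup {X : Type*} [NormedAddCommGroup X] [NormedSpace ℂ X]
    (P : Set (X × X)) : ℝ → X →L[ℂ] X :=
  if H : ∃ S : ℝ → X →L[ℂ] X, Generates P S then H.choose else 0

/-- Mild solutions on `[0, T]` of `u' - P u = F`, `u(0) = h`, where `P` generates a strongly
continuous semigroup: `u(t) = e^{tP} h + ∫₀ᵗ e^{(t-τ)P} F(τ) dτ`. -/
def IsMildSolution {X : Type*} [NormedAddCommGroup X] [NormedSpace ℂ X]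
    (P : Set (X × X)) (T : ℝ) (F : ℝ → X) (h : X) (u : ℝ → X) : Prop :=
  (∃ S : ℝ → X →L[ℂ] X, Generates P S) ∧ IntegrableOn F (Icc 0 T) ∧
    ∀ t ∈ Icc 0 T,
      u t = expSemigroup P t h + ∫ τ in (0 : ℝ)..t, expSemigroup P (t - τ) (F τ)

/-- Strong solutions on `[0, T]` of `u' - P u = F`, `u(0) = h`. Membership in the graph `P`
says at once that `u(t)` is in the domain of `P` and that `P u(t) = u'(t) - F(t)`. -/
def IsStrongSolution {X : Type*} [NormedAddCommGroup X] [NormedSpace ℂ X]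
    (P : Set (X × X)) (T : ℝ) (F : ℝ → X) (h : X) (u : ℝ → X) : Prop :=
  ContinuousOn F (Icc 0 T) ∧ ContinuousOn u (Icc 0 T) ∧ u 0 = h ∧
    ∃ u' : ℝ → X, ContinuousOn u' (Ioc 0 T) ∧
      ∀ t ∈ Ioc 0 T, HasDerivWithinAt u (u' t) (Icc 0 T) t ∧ (u t, u' t - F t) ∈ P

/-! ### Exponentially weighted spaces and weak derivatives -/

/-- The measure `e^{-2 lam ⟨x⟩} dx` on the line, `⟨x⟩ = √(1 + x²)`. -/
noncomputable def weightMeasure (lam : ℝ) : Measure ℝ :=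
  (volume : Measure ℝ).withDensity
    (fun x => ENNReal.ofReal (Real.exp (-2 * lam * Real.sqrt (1 + x ^ 2))))

/-- The measure `e^{-2 lam ⟨x⟩} dσ dx` on the strip `(α, β) × ℝ`. -/
noncomputable def stripMeasure (α β lam : ℝ) : Measure (ℝ × ℝ) :=
  ((volume : Measure ℝ).restrict (Ioo α β)).prod (weightMeasure lam)

/-- The open strip `(α, β) × ℝ`. -/
def strip (α β : ℝ) : Set (ℝ × ℝ) := Ioo α β ×ˢ univ

/-- `L²_lam(ℝ) = e^{lam ⟨x⟩} L²(ℝ)`, with norm `‖f‖ = ‖e^{-lam ⟨x⟩} f‖_{L²}`. -/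
abbrev L2Line (lam : ℝ) : Type := Lp ℂ 2 (weightMeasure lam)

/-- `L²_lam(I × ℝ) = e^{lam ⟨x⟩} L²(I × ℝ)`, `I = (α, β)`. -/
abbrev L2Strip (α β lam : ℝ) : Type := Lp ℂ 2 (stripMeasure α β lam)

/-- `g` is the weak derivative of `f` in the direction `v` on the open set `Ω`. -/
def HasWeakDeriv {E : Type*} [NormedAddCommGroup E] [NormedSpace ℝ E] [MeasureSpace E]
    (Ω : Set E) (v : E) (f g : E → ℂ) : Prop :=
  LocallyIntegrableOn f Ω ∧ LocallyIntegrableOn g Ω ∧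
    ∀ φ : E → ℝ, ContDiff ℝ ∞ φ → HasCompactSupport φ → tsupport φ ⊆ Ω →
      ∫ p in Ω, (fderiv ℝ φ p v) • f p = - ∫ p in Ω, (φ p) • g p

/-- The Sobolev space of order `k` on `Ω` over `L²(μ)`: all weak derivatives of order
at most `k` are in `L²(μ)`. -/
def MemSobolev {E : Type*} [NormedAddCommGroup E] [NormedSpace ℝ E] [MeasureSpace E]
    (Ω : Set E) (μ : Measure E) : ℕ → Lp ℂ 2 μ → Prop
  | 0, _ => True
  | k + 1, f => ∀ v : E, ∃ g : Lp ℂ 2 μ, HasWeakDeriv Ω v f g ∧ MemSobolev Ω μ k g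

/-- `B = ∂ₓ² - ∂ₓ` on `L²_lam(ℝ)` with domain `H²_lam(ℝ)`, as a graph. -/
def opB (lam : ℝ) : Set (L2Line lam × L2Line lam) :=
  {p | MemSobolev univ (weightMeasure lam) 2 p.1 ∧
    ∃ fx fxx : L2Line lam, HasWeakDeriv univ (1 : ℝ) p.1 fx ∧ HasWeakDeriv univ (1 : ℝ) fx fxx ∧
      p.2 = fxx - fx}

/-- `L₀ = κ(θ - σ) ∂_σ + (σ²/2)(∂ₓ² - ∂ₓ)` on `L²_lam(I × ℝ)` with domain `H²_lam(I × ℝ)`,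
as a graph. -/
def opL0 (κ θ α β lam : ℝ) : Set (L2Strip α β lam × L2Strip α β lam) :=
  {p | MemSobolev (strip α β) (stripMeasure α β lam) 2 p.1 ∧
    ∃ fs fx fxx : L2Strip α β lam,
      HasWeakDeriv (strip α β) ((1, 0) : ℝ × ℝ) p.1 fs ∧
      HasWeakDeriv (strip α β) ((0, 1) : ℝ × ℝ) p.1 fx ∧
      HasWeakDeriv (strip α β) ((0, 1) : ℝ × ℝ) fx fxx ∧
      ∀ᵐ q ∂(stripMeasure α β lam),
        p.2 q = ((κ * (θ - q.1) : ℝ) : ℂ) * fs q + ((q.1 ^ 2 / 2 : ℝ) : ℂ) * (fxx q - fx q)}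

/-! ### The explicit data of the formula -/

/-- `δ_t(σ) = θ(1 - e^{-κt}) + σ e^{-κt}`. -/
noncomputable def deltaFlow (κ θ t σ : ℝ) : ℝ :=
  θ * (1 - Real.exp (-κ * t)) + σ * Real.exp (-κ * t)

/-- The variance parameter `𝔇(t, σ)`. -/
noncomputable def frakD (κ θ t σ : ℝ) : ℝ :=
  (θ - σ) ^ 2 / (4 * κ) * (1 - Real.exp (-2 * κ * t))
    - θ * (θ - σ) / κ * (1 - Real.exp (-κ * t)) + 1 / 2 * θ ^ 2 * t

open Classical in
/-- The slice `f(σ, ·)` as an element of `L²_lam(ℝ)`. For `f ∈ L²_lam(I × ℝ)` this is the genuine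
slice for almost every `σ ∈ I`. -/
noncomputable def slice (lam : ℝ) (f : ℝ × ℝ → ℂ) (σ : ℝ) : L2Line lam :=
  if hf : MemLp (fun x => f (σ, x)) 2 (weightMeasure lam) then hf.toLp _ else 0

/-- The integrand `e^{-(x-y-D)²/(4D)} g(y)`. -/
noncomputable def kernelIntegrand (D : ℝ) (g : ℝ → ℂ) (x y : ℝ) : ℂ :=
  (Real.exp (-(x - y - D) ^ 2 / (4 * D)) : ℂ) * g y

/-! ### Classical solutions -/

/-- The pointwise partial derivative in `σ`. -/
noncomputable def dS (f : ℝ × ℝ → ℂ) (p : ℝ × ℝ) : ℂ := deriv (fun s => f (s, p.2)) p.1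

/-- The pointwise partial derivative in `x`. -/
noncomputable def dX (f : ℝ × ℝ → ℂ) (p : ℝ × ℝ) : ℂ := deriv (fun y => f (p.1, y)) p.2

/-- `f`, `∂_σ f`, `∂ₓ f`, `∂ₓ² f` exist at every point of `Ω`. -/
def HasC12Derivs (Ω : Set (ℝ × ℝ)) (f : ℝ × ℝ → ℂ) : Prop :=
  ∀ p ∈ Ω, DifferentiableAt ℝ (fun s => f (s, p.2)) p.1 ∧
    DifferentiableAt ℝ (fun y => f (p.1, y)) p.2 ∧
    DifferentiableAt ℝ (fun y => dX f (p.1, y)) p.2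

/-- `f ∈ C^{1,2}(Ω)`: once continuously differentiable in `σ`, twice in `x`. -/
def IsC12On (Ω : Set (ℝ × ℝ)) (f : ℝ × ℝ → ℂ) : Prop :=
  HasC12Derivs Ω f ∧ ContinuousOn f Ω ∧ ContinuousOn (dS f) Ω ∧ ContinuousOn (dX f) Ω ∧
    ContinuousOn (dX (dX f)) Ω

/-- Classical solutions on `[0, T] × Ω` of `∂ₜ U - L₀ U = F`, `U(0) = f`: `U` is continuous up to
`t = 0`, and the derivatives occurring in the equation (`∂ₜ`, `∂_σ`, `∂ₓ`, `∂ₓ²`) exist, are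
continuous on `(0, T] × Ω` and satisfy the equation at every point. -/
def IsClassicalSolution (κ θ : ℝ) (Ω : Set (ℝ × ℝ)) (T : ℝ) (F : ℝ → ℝ × ℝ → ℂ)
    (f : ℝ × ℝ → ℂ) (U : ℝ → ℝ × ℝ → ℂ) : Prop :=
  ContinuousOn (fun q : ℝ × (ℝ × ℝ) => U q.1 q.2) (Icc 0 T ×ˢ Ω) ∧
  (∀ p ∈ Ω, U 0 p = f p) ∧
  (∀ t ∈ Ioc 0 T, HasC12Derivs Ω (U t) ∧
    ∀ p ∈ Ω, DifferentiableWithinAt ℝ (fun s => U s p) (Icc 0 T) t) ∧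
  ContinuousOn (fun q : ℝ × (ℝ × ℝ) => derivWithin (fun s => U s q.2) (Icc 0 T) q.1)
    (Ioc 0 T ×ˢ Ω) ∧
  ContinuousOn (fun q : ℝ × (ℝ × ℝ) => dS (U q.1) q.2) (Ioc 0 T ×ˢ Ω) ∧
  ContinuousOn (fun q : ℝ × (ℝ × ℝ) => dX (U q.1) q.2) (Ioc 0 T ×ˢ Ω) ∧
  ContinuousOn (fun q : ℝ × (ℝ × ℝ) => dX (dX (U q.1)) q.2) (Ioc 0 T ×ˢ Ω) ∧
  ∀ t ∈ Ioc 0 T, ∀ p ∈ Ω,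
    derivWithin (fun s => U s p) (Icc 0 T) t
      - (((κ * (θ - p.1) : ℝ) : ℂ) * dS (U t) p
        + ((p.1 ^ 2 / 2 : ℝ) : ℂ) * (dX (dX (U t)) p - dX (U t) p)) = F t p

/-- For some `m ∈ ℝ` the maps `σ ↦ f(σ, ·)` and `σ ↦ ∂_σ f(σ, ·)` are locally bounded from
`(α, β)` to `L²_m(ℝ)`. -/
def HasLocallyBoundedSlices (α β : ℝ) (f : ℝ × ℝ → ℂ) : Prop :=
  ∃ m : ℝ, ∀ a b : ℝ, α < a → b < β → ∃ C : ℝ≥0, ∀ σ ∈ Icc a b,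
    eLpNorm (fun x => f (σ, x)) 2 (weightMeasure m) ≤ C ∧
    eLpNorm (fun x => dS f (σ, x)) 2 (weightMeasure m) ≤ C

/-!
Everything is built on one explicit object: for a standard Gaussian measure `γ` and
`𝔇 = 𝔇(t, σ)`,

  `S(t) h (σ, x) = ∫ h(δ_t(σ), x - 𝔇 - √(2𝔇) ζ) dγ(ζ)`,

a superposition over `ζ` of substitution operators. For fixed `ζ` the substitution is a
homeomorphism of the plane which multiplies Lebesgue measure by a constant and moves `x` by at most
`C(1 + |ζ|)` over the strip, so it is bounded on the weighted space with a bound that is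
exponential in `|ζ|`, and the Gaussian average is bounded (`IsSuperposition`). The semigroup law is
the cocycle property of `𝔇` along the flow `δ` (`frakD_add`) together with the stability of
Gaussian laws under addition. The variance parameter satisfies `∂ₜ 𝔇 = δ_t² / 2`, hence it is
positive for `t > 0` (`frakD_pos`). On the line, `e^{tB}` is the same construction with `𝔇 = t`.

For generation, no resolvent is computed. A strongly continuous semigroup is generated by the
closure of `P` as soon as `P` is densely defined, is preserved by the semigroup, and satisfies
`S(t) ξ - ξ = ∫₀ᵗ S(s) P ξ ds` (`generates_of_invariant_dense`). Invariance of `H²` follows from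
the chain rule for a fixed `ζ`, integrated against `γ`; the derivative in `σ` produces the weight
`∂_σ(𝔇 + √(2𝔇) ζ)`, whose factor `ζ` is turned into `∂ₓ` by Stein's identity
`∫ ζ F(ζ) dγ = ∫ F'(ζ) dγ`. With the transport equation `∂ₜ 𝔇 = κ(θ - σ) ∂_σ 𝔇 + σ²/2`
(`frakD_transport`) this shows `L₀ S(t) = S(t) L₀` (`opL0_invariant`). The integral identity is
tested against smooth functions, whose images under the dual semigroup solve an explicit ordinary
differential equation in `t` at each point (`gaussian_evolution`, `weak_evolution`). The same
invariance makes the orbits of `H²` data strong solutions.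

The change of variables `y = x - 𝔇 - √(2𝔇) ζ` gives the kernel formula. For classical solutions
the kernel is differentiated under the integral sign. The data are controlled only through
`∫ e^{-A|y|} |h(σ, y)| dy`, bounded locally uniformly in `σ`, so there is no pointwise majorant;
a uniform exponential tail bound takes its place (`continuous_integral_of_tail`,
`hasDerivAt_integral_of_tail`). Continuity at `t = 0` is obtained from the Gaussian average itself,
whose tails are uniform as `𝔇 → 0` (`lintegral_exp_gauss_le`).
-/

set_option linter.unusedSectionVars false

/-! ### Strongly continuous semigroups and their generators -/

section Semigroups

variable {X : Type*} [NormedAddCommGroup X] [NormedSpace ℂ X]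

/-- The Banach–Steinhaus argument: strong continuity at `0` bounds the norms near `0`. -/
theorem IsC0Semigroup.exists_norm_le_near_zero [CompleteSpace X] {S : ℝ → X →L[ℂ] X}
    (hS : IsC0Semigroup S) :
    ∃ d > 0, ∃ M : ℝ, ∀ t ∈ Icc 0 d, ‖S t‖ ≤ M := by
  by_contra! H
  have H' : ∀ n : ℕ, ∃ t ∈ Icc (0 : ℝ) (1 / ((n : ℝ) + 1)), (n : ℝ) + 1 < ‖S t‖ := fun n =>
    H _ (by positivity) _
  choose t ht hn using H'
  have hlim : Tendsto t atTop (𝓝 0) :=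
    squeeze_zero (fun n => (ht n).1) (fun n => (ht n).2) tendsto_one_div_add_atTop_nhds_zero_nat
  have hz : ‖S 0‖ ≤ 1 := by rw [hS.zero]; exact ContinuousLinearMap.norm_id_le
  have hpos : ∀ n, 0 < t n := by
    intro n
    rcases (ht n).1.eq_or_lt with h | h
    · have := hn n
      rw [← h] at this
      have h0 : (0 : ℝ) ≤ n := n.cast_nonneg
      linarith
    · exact h
  have hlim' : Tendsto t atTop (𝓝[>] 0) :=
    tendsto_nhdsWithin_iff.2 ⟨hlim, Eventually.of_forall hpos⟩
  obtain ⟨C, hC⟩ := banach_steinhaus (g := fun n => S (t n)) (fun ξ => by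
    have h1 := ((hS.tendsto ξ).comp hlim').norm.bddAbove_range
    obtain ⟨C, hC⟩ := h1
    exact ⟨C, fun n => hC ⟨n, rfl⟩⟩)
  obtain ⟨n, hnC⟩ := exists_nat_gt C
  have h1 := hn n
  have h2 := hC n
  have : (n : ℝ) ≤ n + 1 := by linarith
  linarith

theorem IsC0Semigroup.exists_norm_le [CompleteSpace X] {S : ℝ → X →L[ℂ] X}
    (hS : IsC0Semigroup S) (T : ℝ) : ∃ M : ℝ, 0 ≤ M ∧ ∀ t ∈ Icc 0 T, ‖S t‖ ≤ M := by
  obtain ⟨d, hd, M, hM⟩ := hS.exists_norm_le_near_zero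
  have hM0 : 0 ≤ M := (norm_nonneg _).trans (hM 0 ⟨le_rfl, hd.le⟩)
  have key : ∀ n : ℕ, ∃ M' : ℝ, 0 ≤ M' ∧ ∀ t ∈ Icc 0 (d * (n + 1)), ‖S t‖ ≤ M' := by
    intro n
    induction n with
    | zero => exact ⟨M, hM0, by simpa using hM⟩
    | succ n ih =>
      obtain ⟨M', hM'0, hM'⟩ := ih
      refine ⟨max M' (M * M'), le_max_of_le_left hM'0, fun t ht => ?_⟩
      push_cast at ht
      by_cases h : t ≤ d * (n + 1)
      · exact (hM' t ⟨ht.1, h⟩).trans (le_max_left _ _)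
      · push Not at h
        have hdn : (0 : ℝ) ≤ d * n := by positivity
        have e : t = d + (t - d) := by ring
        rw [e, hS.add d (t - d) hd.le (by nlinarith)]
        refine (ContinuousLinearMap.opNorm_comp_le _ _).trans (le_max_of_le_right ?_)
        gcongr
        · exact hM d ⟨hd.le, le_rfl⟩
        · exact hM' _ ⟨by nlinarith, by nlinarith [ht.2]⟩
  obtain ⟨n, hn⟩ := exists_nat_gt (T / d)
  obtain ⟨M', h0, h⟩ := key n
  refine ⟨M', h0, fun t ht => h t ⟨ht.1, ht.2.trans ?_⟩⟩
  rw [div_lt_iff₀ hd] at hn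
  nlinarith

theorem IsC0Semigroup.apply_add {S : ℝ → X →L[ℂ] X} (hS : IsC0Semigroup S) {s t : ℝ}
    (hs : 0 ≤ s) (ht : 0 ≤ t) (ξ : X) : S (s + t) ξ = S s (S t ξ) := by
  rw [hS.add s t hs ht]; rfl

theorem IsC0Semigroup.tendsto_nhdsGE {S : ℝ → X →L[ℂ] X} (hS : IsC0Semigroup S) (ξ : X) :
    Tendsto (fun t : ℝ => S t ξ) (𝓝[≥] 0) (𝓝 ξ) := by
  have h := hS.tendsto ξ
  rw [← Ioi_insert, nhdsWithin_insert, tendsto_sup]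
  refine ⟨?_, h⟩
  rw [tendsto_pure_left]
  intro s hs
  have : S 0 ξ = ξ := by rw [hS.zero]; rfl
  rw [this]
  exact mem_of_mem_nhds hs

theorem IsC0Semigroup.continuousOn_orbit [CompleteSpace X] {S : ℝ → X →L[ℂ] X}
    (hS : IsC0Semigroup S) (ξ : X) : ContinuousOn (fun t => S t ξ) (Ici 0) := by
  have key : ∀ T : ℝ, ∃ M : ℝ, 0 ≤ M ∧ ∀ a b : ℝ, 0 ≤ a → a ≤ b → b ≤ T →
      ‖S b ξ - S a ξ‖ ≤ M * ‖S (b - a) ξ - ξ‖ := by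
    intro T
    obtain ⟨M, hM0, hM⟩ := hS.exists_norm_le T
    refine ⟨M, hM0, fun a b ha hab hb => ?_⟩
    have e : S b ξ = S a (S (b - a) ξ) := by
      rw [← hS.apply_add ha (by linarith)]; congr 2; ring
    rw [e, ← map_sub]
    exact ((S a).le_opNorm _).trans (by gcongr; exact hM a ⟨ha, hab.trans hb⟩)
  intro t ht
  have ht : 0 ≤ t := ht
  obtain ⟨M, hM0, hM⟩ := key (t + 1)
  have h1 : Tendsto (fun s : ℝ => |s - t|) (𝓝[Ici 0] t) (𝓝[≥] 0) := by
    refine tendsto_nhdsWithin_iff.2 ⟨?_, Eventually.of_forall fun s => mem_Ici.2 (abs_nonneg _)⟩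
    have : Tendsto (fun s : ℝ => |s - t|) (𝓝 t) (𝓝 |t - t|) :=
      (continuous_abs.comp (continuous_id.sub continuous_const)).tendsto t
    simpa using this.mono_left nhdsWithin_le_nhds
  have h2 : Tendsto (fun s : ℝ => M * ‖S |s - t| ξ - ξ‖) (𝓝[Ici 0] t) (𝓝 0) := by
    have := (((hS.tendsto_nhdsGE ξ).comp h1).sub_const ξ).norm.const_mul M
    simpa using this
  rw [ContinuousWithinAt, tendsto_iff_norm_sub_tendsto_zero]
  refine squeeze_zero' (Eventually.of_forall fun s => norm_nonneg _) ?_ h2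
  have h3 : ∀ᶠ s in 𝓝[Ici 0] t, s ≤ t + 1 :=
    mem_nhdsWithin_of_mem_nhds (Iic_mem_nhds (by linarith))
  filter_upwards [h3, self_mem_nhdsWithin] with s hs1 hs0
  have hs0 : 0 ≤ s := hs0
  rcases le_total s t with h | h
  · rw [norm_sub_rev, abs_of_nonpos (by linarith), neg_sub]
    exact hM s t hs0 h (by linarith)
  · rw [abs_of_nonneg (by linarith)]
    exact hM t s ht h hs1

/-- Composition of a locally bounded, strongly convergent family with a convergent family. -/
theorem tendsto_apply_of_norm_le {ι : Type*} {l : Filter ι} {A : ι → X →L[ℂ] X} {B : X →L[ℂ] X}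
    {M : ℝ} (hM : ∀ᶠ i in l, ‖A i‖ ≤ M) {ξ : ι → X} {η : X} (hξ : Tendsto ξ l (𝓝 η))
    (hA : Tendsto (fun i => A i η) l (𝓝 (B η))) :
    Tendsto (fun i => A i (ξ i)) l (𝓝 (B η)) := by
  have h : Tendsto (fun i => A i (ξ i - η)) l (𝓝 0) := by
    rw [tendsto_zero_iff_norm_tendsto_zero]
    have h2 : Tendsto (fun i => M * ‖ξ i - η‖) l (𝓝 0) := by
      simpa using ((hξ.sub_const η).norm.const_mul M)
    refine squeeze_zero' (Eventually.of_forall fun s => norm_nonneg _) ?_ h2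
    filter_upwards [hM] with i hi
    exact ((A i).le_opNorm _).trans (by gcongr)
  have := h.add hA
  simpa using this

/-- The generator commutes with the semigroup on its domain. -/
theorem IsC0Semigroup.tendsto_quotient_apply [CompleteSpace X] {S : ℝ → X →L[ℂ] X}
    (hS : IsC0Semigroup S) {ξ η : X}
    (h : Tendsto (fun t : ℝ => ((t : ℂ)⁻¹) • (S t ξ - ξ)) (𝓝[>] 0) (𝓝 η)) {s : ℝ} (hs : 0 ≤ s) :
    Tendsto (fun t : ℝ => ((t : ℂ)⁻¹) • (S t (S s ξ) - S s ξ)) (𝓝[>] 0) (𝓝 (S s η)) := by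
  have := ((S s).continuous.tendsto η).comp h
  refine this.congr' ?_
  filter_upwards [self_mem_nhdsWithin] with t ht
  have ht : 0 < t := ht
  simp only [Function.comp, map_smul, map_sub]
  rw [← hS.apply_add hs ht.le, ← hS.apply_add ht.le hs, add_comm]

/-- An operator generates at most one semigroup: if `S` and `S'` have the same generator, then
`s ↦ S (t - s) (S' s ξ)` has vanishing right derivative for `ξ` in the domain. -/
theorem Generates.unique_of_mem [CompleteSpace X] {P : Set (X × X)} {S S' : ℝ → X →L[ℂ] X}
    (h : Generates P S) (h' : Generates P S') {ξ η : X} (hξ : (ξ, η) ∈ closure P) {t : ℝ}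
    (ht : 0 ≤ t) : S t ξ = S' t ξ := by
  obtain ⟨M, hM0, hM⟩ := h.1.exists_norm_le t
  have hcont : ContinuousOn (fun s => S (t - s) (S' s ξ)) (Icc 0 t) := by
    intro s hs
    refine tendsto_apply_of_norm_le (A := fun r => S (t - r)) (B := S (t - s)) (M := M) ?_
      ((h'.1.continuousOn_orbit ξ s hs.1).mono fun r hr => hr.1) ?_
    · filter_upwards [self_mem_nhdsWithin] with r hr
      exact hM _ ⟨by linarith [hr.2], by linarith [hr.1]⟩
    · have := h.1.continuousOn_orbit (S' s ξ) (t - s) (by simpa using hs.2)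
      refine this.tendsto.comp (tendsto_nhdsWithin_iff.2 ⟨?_, ?_⟩)
      · exact (tendsto_const_nhds.sub tendsto_id).mono_left nhdsWithin_le_nhds
      · filter_upwards [self_mem_nhdsWithin] with r hr
        simpa using hr.2
  have hder : ∀ s ∈ Ico 0 t, HasDerivWithinAt (fun s => S (t - s) (S' s ξ)) 0 (Ici s) s := by
    intro s hs
    have hmem := h'.1.tendsto_quotient_apply ((h'.2 ξ η).2 hξ) hs.1
    have hmem2 := (h.2 _ _).2 ((h'.2 _ _).1 hmem)
    have hdiff : Tendsto (fun r : ℝ => ((r : ℂ)⁻¹) • (S' r (S' s ξ) - S r (S' s ξ))) (𝓝[>] 0)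
        (𝓝 0) := by
      have := hmem.sub hmem2
      rw [sub_self] at this
      refine this.congr fun r => ?_
      rw [← smul_sub]; congr 1; abel
    have hshift : Tendsto (fun r : ℝ => r - s) (𝓝[>] s) (𝓝[>] 0) := by
      refine tendsto_nhdsWithin_iff.2 ⟨?_, ?_⟩
      · have : Tendsto (fun r : ℝ => r - s) (𝓝 s) (𝓝 (s - s)) :=
          (continuous_id.sub continuous_const).tendsto s
        rw [sub_self] at this
        exact this.mono_left nhdsWithin_le_nhds
      · filter_upwards [self_mem_nhdsWithin] with r hr
        have : s < r := hr
        simpa using this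
    have hev : ∀ᶠ r in 𝓝[>] s, r ∈ Ioc s t := Ioc_mem_nhdsGT hs.2
    rw [← hasDerivWithinAt_Ioi_iff_Ici, hasDerivWithinAt_iff_tendsto_slope]
    have hs' : Ioi s \ {s} = Ioi s := by simp
    rw [hs']
    have := tendsto_apply_of_norm_le (l := 𝓝[>] s) (A := fun r => S (t - r)) (B := 0) (M := M) ?_
      (hdiff.comp hshift) (by simp)
    · refine Tendsto.congr' ?_ this
      filter_upwards [hev] with r hr
      have h1 : S' r ξ = S' (r - s) (S' s ξ) := by
        rw [← h'.1.apply_add (by linarith [hr.1]) hs.1]; congr 2; ring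
      have h2 : S (t - s) (S' s ξ) = S (t - r) (S (r - s) (S' s ξ)) := by
        rw [← h.1.apply_add (by linarith [hr.2]) (by linarith [hr.1])]; congr 2; ring
      rw [slope_def_module, h1, h2]
      simp only [Function.comp, map_smul, map_sub]
      rw [← Complex.ofReal_inv, Complex.coe_smul]
    · filter_upwards [hev] with r hr
      exact hM _ ⟨by linarith [hr.2], by linarith [hr.1, hs.1]⟩
  have := constant_of_has_deriv_right_zero hcont hder t ⟨ht, le_rfl⟩
  simp only [sub_self, sub_zero] at this
  rw [h.1.zero, h'.1.zero] at this
  simpa using this.symm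

theorem IsC0Semigroup.intervalIntegrable [CompleteSpace X] {S : ℝ → X →L[ℂ] X}
    (hS : IsC0Semigroup S) (ξ : X) {t : ℝ} (ht : 0 ≤ t) :
    IntervalIntegrable (fun s => S s ξ) volume 0 t :=
  ((hS.continuousOn_orbit ξ).mono (by rw [uIcc_of_le ht]; exact Icc_subset_Ici_self))
    |>.intervalIntegrable

/-- The means of an orbit converge to its starting point. -/
theorem IsC0Semigroup.tendsto_mean [CompleteSpace X] {S : ℝ → X →L[ℂ] X}
    (hS : IsC0Semigroup S) (ξ : X) :
    Tendsto (fun t : ℝ => t⁻¹ • ∫ s in (0 : ℝ)..t, S s ξ) (𝓝[>] 0) (𝓝 ξ) := by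
  have h0 : S 0 ξ = ξ := by rw [hS.zero]; rfl
  have hc := hS.continuousOn_orbit ξ
  have h := intervalIntegral.integral_hasDerivWithinAt_right (a := 0) (b := 0)
    (f := fun s => S s ξ) (s := Ici 0) (t := Ioi 0) (by simp)
    ((hc.mono Ioi_subset_Ici_self).stronglyMeasurableAtFilter_nhdsWithin measurableSet_Ioi 0)
    ((hc 0 self_mem_Ici).mono Ioi_subset_Ici_self)
  rw [← hasDerivWithinAt_Ioi_iff_Ici, hasDerivWithinAt_iff_tendsto_slope] at h
  have hs' : Ioi (0 : ℝ) \ {0} = Ioi 0 := by simp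
  rw [hs', h0] at h
  refine h.congr fun t => ?_
  rw [slope_def_module]
  simp

theorem norm_integral_apply_le {S : ℝ → X →L[ℂ] X} {t M : ℝ} (ht : 0 ≤ t) (hM : ∀ s ∈ Icc 0 t, ‖S
    s‖ ≤ M) (ξ : X) :
    ‖∫ s in (0 : ℝ)..t, S s ξ‖ ≤ M * t * ‖ξ‖ := by
  have := intervalIntegral.norm_integral_le_of_norm_le_const (a := 0) (b := t)
    (f := fun s => S s ξ) (C := M * ‖ξ‖) (fun s hs => by
      rw [uIoc_of_le ht] at hs
      exact ((S s).le_opNorm ξ).trans (by gcongr; exact hM s ⟨hs.1.le, hs.2⟩))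
  rw [sub_zero, abs_of_nonneg ht] at this
  linarith

/-- `∫₀ᵗ S s ds` is a bounded operator. -/
theorem IsC0Semigroup.continuous_integral [CompleteSpace X] {S : ℝ → X →L[ℂ] X}
    (hS : IsC0Semigroup S) {t : ℝ} (ht : 0 ≤ t) :
    Continuous (fun ξ => ∫ s in (0 : ℝ)..t, S s ξ) := by
  obtain ⟨M, hM0, hM⟩ := hS.exists_norm_le t
  let L : X →ₗ[ℂ] X :=
    { toFun := fun ξ => ∫ s in (0 : ℝ)..t, S s ξ
      map_add' := fun ξ η => by
        simp only [map_add]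
        exact intervalIntegral.integral_add (hS.intervalIntegrable ξ ht)
          (hS.intervalIntegrable η ht)
      map_smul' := fun c ξ => by
        simp only [map_smul, RingHom.id_apply]
        exact intervalIntegral.integral_smul c _ }
  exact (L.mkContinuous (M * t) (fun ξ => norm_integral_apply_le ht hM ξ)).continuous

/-- If `S t ξ - ξ = ∫₀ᵗ S s η ds`, then `η` is the value of the generator at `ξ`. -/
theorem IsC0Semigroup.tendsto_quotient_of_integral [CompleteSpace X] {S : ℝ → X →L[ℂ] X}
    (hS : IsC0Semigroup S) {ξ η : X}
    (h : ∀ t : ℝ, 0 ≤ t → S t ξ - ξ = ∫ s in (0 : ℝ)..t, S s η) :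
    Tendsto (fun t : ℝ => ((t : ℂ)⁻¹) • (S t ξ - ξ)) (𝓝[>] 0) (𝓝 η) := by
  refine (hS.tendsto_mean η).congr' ?_
  filter_upwards [self_mem_nhdsWithin] with t ht
  have ht : 0 < t := ht
  rw [h t ht.le, ← Complex.ofReal_inv, Complex.coe_smul]

/-- A criterion for generation: the domain of `P` is dense, `P` is invariant under the semigroup,
and orbits starting in the domain are integrals of the orbits of their images. Then the domain is
a core, since the means `t⁻¹ ∫₀ᵗ (S s ξ, S s η) ds` lie in the closed convex set `closure P`. -/
theorem generates_of_invariant_dense [CompleteSpace X] {S : ℝ → X →L[ℂ] X}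
    (hS : IsC0Semigroup S) {P : Set (X × X)} (hconv : Convex ℝ P)
    (hdense : Dense {ξ : X | ∃ η, (ξ, η) ∈ P})
    (hinv : ∀ ξ η : X, (ξ, η) ∈ P → ∀ t : ℝ, 0 ≤ t → (S t ξ, S t η) ∈ P)
    (hint : ∀ ξ η : X, (ξ, η) ∈ P → ∀ t : ℝ, 0 ≤ t → S t ξ - ξ = ∫ s in (0 : ℝ)..t, S s η) :
    Generates P S := by
  refine ⟨hS, fun ξ η => ⟨fun h => ?_, fun h => ?_⟩⟩
  · have key : ∀ t : ℝ, 0 < t → ∀ ξ : X,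
        (t⁻¹ • ∫ s in (0 : ℝ)..t, S s ξ, t⁻¹ • (S t ξ - ξ)) ∈ closure P := by
      intro t ht ξ
      have hcl : IsClosed {ξ : X |
          (t⁻¹ • ∫ s in (0 : ℝ)..t, S s ξ, t⁻¹ • (S t ξ - ξ)) ∈ closure P} := by
        refine isClosed_closure.preimage ?_
        exact ((hS.continuous_integral ht.le).const_smul _).prodMk
          (((S t).continuous.sub continuous_id).const_smul _)
      have hsub : {ξ : X | ∃ η, (ξ, η) ∈ P} ⊆ {ξ : X |
          (t⁻¹ • ∫ s in (0 : ℝ)..t, S s ξ, t⁻¹ • (S t ξ - ξ)) ∈ closure P} := by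
        rintro ξ ⟨η, hξ⟩
        rw [mem_ofPred_eq, hint ξ η hξ t ht.le]
        have h1 := hS.intervalIntegrable ξ ht.le
        have h2 := hS.intervalIntegrable η ht.le
        rw [intervalIntegrable_iff_integrableOn_Ioc_of_le ht.le] at h1 h2
        have := hconv.set_average_mem_closure (μ := volume) (t := Ioc 0 t)
          (f := fun s => (S s ξ, S s η)) (by simp [ht]) (by simp)
          (by
            filter_upwards [ae_restrict_mem measurableSet_Ioc] with s hs
            exact hinv ξ η hξ s hs.1.le) (h1.prodMk h2)
        rw [setAverage_eq, integral_pair h1 h2] at this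
        simpa [ht.le, intervalIntegral.integral_of_le, measureReal_def] using this
      exact hcl.closure_subset_iff.2 hsub (hdense ξ)
    refine isClosed_closure.mem_of_tendsto
      ((hS.tendsto_mean ξ).prodMk_nhds h) ?_
    filter_upwards [self_mem_nhdsWithin] with t ht
    have := key t ht ξ
    rwa [← Complex.ofReal_inv, Complex.coe_smul]
  · refine hS.tendsto_quotient_of_integral fun t ht => ?_
    have hcl : IsClosed {p : X × X | S t p.1 - p.1 = ∫ s in (0 : ℝ)..t, S s p.2} :=
      isClosed_eq (((S t).continuous.comp continuous_fst).sub continuous_fst)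
        ((hS.continuous_integral ht).comp continuous_snd)
    exact hcl.closure_subset_iff.2 (fun p hp => hint p.1 p.2 hp t ht) h

/-- Generators are densely defined: the means `r⁻¹ ∫₀ʳ S s ξ ds` lie in the domain. -/
theorem Generates.dense_closure [CompleteSpace X] {P : Set (X × X)} {S : ℝ → X →L[ℂ] X}
    (h : Generates P S) : Dense {ξ : X | ∃ η, (ξ, η) ∈ closure P} := by
  intro ξ
  refine mem_closure_of_tendsto (h.1.tendsto_mean ξ) ?_
  filter_upwards [self_mem_nhdsWithin] with t ht
  have ht : 0 < t := ht
  refine ⟨t⁻¹ • (S t ξ - ξ), (h.2 _ _).1 ?_⟩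
  -- the quotients of `∫₀ᵗ S s ξ ds` are differences of two means of the orbit
  have h1 : Tendsto (fun r : ℝ => t⁻¹ • (S t (r⁻¹ • ∫ s in (0 : ℝ)..r, S s ξ)
      - r⁻¹ • ∫ s in (0 : ℝ)..r, S s ξ)) (𝓝[>] 0) (𝓝 (t⁻¹ • (S t ξ - ξ))) :=
    ((((S t).continuous.tendsto ξ).comp (h.1.tendsto_mean ξ)).sub
      (h.1.tendsto_mean ξ)).const_smul _
  refine h1.congr' ?_
  filter_upwards [self_mem_nhdsWithin] with r hr
  have hr : 0 < r := hr
  have hI : ∀ a b : ℝ, 0 ≤ a → 0 ≤ b → IntervalIntegrable (fun s => S s ξ) volume a b :=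
    fun a b ha hb => (h.1.intervalIntegrable ξ ha).symm.trans (h.1.intervalIntegrable ξ hb)
  have hshift : ∀ a b : ℝ, 0 ≤ a → 0 ≤ b →
      S a (∫ s in (0 : ℝ)..b, S s ξ) = ∫ s in a..(a + b), S s ξ := by
    intro a b ha hb
    rw [← ContinuousLinearMap.intervalIntegral_comp_comm _ (hI 0 b le_rfl hb)]
    have : ∫ s in (0 : ℝ)..b, S a (S s ξ) = ∫ s in (0 : ℝ)..b, S (a + s) ξ := by
      refine intervalIntegral.integral_congr fun s hs => ?_
      rw [uIcc_of_le hb] at hs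
      exact (h.1.apply_add ha hs.1 ξ).symm
    rw [this, intervalIntegral.integral_comp_add_left (fun s => S s ξ) a, add_zero]
  have e : S t (∫ s in (0 : ℝ)..r, S s ξ) - ∫ s in (0 : ℝ)..r, S s ξ
      = S r (∫ s in (0 : ℝ)..t, S s ξ) - ∫ s in (0 : ℝ)..t, S s ξ := by
    rw [hshift t r ht.le hr.le, hshift r t hr.le ht.le, add_comm r t]
    have h1 := intervalIntegral.integral_add_adjacent_intervals (hI 0 t le_rfl ht.le)
      (hI t (t + r) ht.le (by linarith))
    have h2 := intervalIntegral.integral_add_adjacent_intervals (hI 0 r le_rfl hr.le)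
      (hI r (t + r) hr.le (by linarith))
    rw [← h2] at h1
    rw [sub_eq_sub_iff_add_eq_add, add_comm, h1, add_comm]
  rw [← Complex.ofReal_inv, Complex.coe_smul]
  have hlin : ∀ (a : ℝ) (v : X) (c : ℝ), S a (c • v) = c • S a v := fun a v c => by
    rw [← Complex.coe_smul, map_smul, Complex.coe_smul]
  rw [hlin, hlin, ← smul_sub, ← smul_sub, e, smul_comm]

theorem Generates.unique [CompleteSpace X] {P : Set (X × X)} {S S' : ℝ → X →L[ℂ] X}
    (h : Generates P S) (h' : Generates P S') {t : ℝ} (ht : 0 ≤ t) : S t = S' t :=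
  ContinuousLinearMap.ext fun ξ => (isClosed_eq (S t).continuous (S'
      t).continuous).closure_subset_iff.2
    (fun ξ (hξ : ∃ η, (ξ, η) ∈ closure P) => h.unique_of_mem h' hξ.choose_spec ht)
    (h.dense_closure ξ)

theorem Generates.expSemigroup_eq [CompleteSpace X] {P : Set (X × X)} {S : ℝ → X →L[ℂ] X}
    (h : Generates P S) {t : ℝ} (ht : 0 ≤ t) : expSemigroup P t = S t := by
  have H : ∃ S : ℝ → X →L[ℂ] X, Generates P S := ⟨S, h⟩
  rw [expSemigroup, dif_pos H]
  exact H.choose_spec.unique h ht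

theorem Generates.isMildSolution [CompleteSpace X] {P : Set (X × X)} {S : ℝ → X →L[ℂ] X}
    (h : Generates P S) (T : ℝ) (ξ : X) : IsMildSolution P T 0 ξ (fun t => S t ξ) :=
  ⟨⟨S, h⟩, integrableOn_zero, fun t ht => by simp [h.expSemigroup_eq ht.1]⟩

/-- Orbits starting in an invariant domain are strong solutions. -/
theorem Generates.isStrongSolution [CompleteSpace X] {P : Set (X × X)} {S : ℝ → X →L[ℂ] X}
    (h : Generates P S)
    (hinv : ∀ ξ η : X, (ξ, η) ∈ P → ∀ t : ℝ, 0 ≤ t → (S t ξ, S t η) ∈ P)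
    (hint : ∀ ξ η : X, (ξ, η) ∈ P → ∀ t : ℝ, 0 ≤ t → S t ξ - ξ = ∫ s in (0 : ℝ)..t, S s η)
    (T : ℝ) {ξ η : X} (hξ : (ξ, η) ∈ P) : IsStrongSolution P T 0 ξ (fun t => S t ξ) := by
  have hc := h.1.continuousOn_orbit η
  refine ⟨continuousOn_const, (h.1.continuousOn_orbit ξ).mono Icc_subset_Ici_self, ?_,
    fun t => S t η, hc.mono fun t ht => ht.1.le, fun t ht => ⟨?_, ?_⟩⟩
  · simp [h.1.zero]
  · have hd := intervalIntegral.integral_hasDerivAt_right (h.1.intervalIntegrable η ht.1.le)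
      (((hc.mono Ioi_subset_Ici_self).stronglyMeasurableAtFilter isOpen_Ioi) t ht.1)
      (hc.continuousAt (Ici_mem_nhds ht.1))
    refine ((hd.add_const ξ).hasDerivWithinAt (s := Icc 0 T)).congr (fun s hs => ?_) ?_
    · exact sub_eq_iff_eq_add.1 (hint ξ η hξ s hs.1)
    · exact sub_eq_iff_eq_add.1 (hint ξ η hξ t ht.1.le)
  · simpa using hinv ξ η hξ t ht.1.le

end Semigroups

/-! ### Weighted `L²` spaces on an open set and weak derivatives -/

section WeightedDomains

/-- Real test functions on `Ω`: smooth with compact support inside `Ω`. -/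
structure IsTestFun {E : Type*} [NormedAddCommGroup E] [NormedSpace ℝ E] (Ω : Set E)
    (φ : E → ℝ) : Prop where
  smooth : ContDiff ℝ ∞ φ
  compact : HasCompactSupport φ
  subset : tsupport φ ⊆ Ω

/-- `μ` is equivalent to Lebesgue measure on the open set `Ω`, with a density that is locally
bounded below. -/
structure IsWeightedDomain {E : Type*} [NormedAddCommGroup E] [NormedSpace ℝ E] [MeasureSpace E]
    (Ω : Set E) (μ : Measure E) : Prop where
  isOpen : IsOpen Ω
  ac : μ ≪ volume.restrict Ω
  ac' : volume.restrict Ω ≪ μ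
  le : ∀ K : Set E, IsCompact K → K ⊆ Ω → ∃ C : ℝ≥0∞, C ≠ ⊤ ∧ volume.restrict K ≤ C • μ

variable {E : Type*} [NormedAddCommGroup E] [NormedSpace ℝ E] {Ω : Set E} {φ ψ : E → ℝ}

namespace IsTestFun

theorem fderiv_apply (h : IsTestFun Ω φ) (v : E) : IsTestFun Ω (fun p => fderiv ℝ φ p v) where
  smooth := (h.smooth.fderiv_right (by simp)).clm_apply contDiff_const
  compact := (h.compact.fderiv_apply (𝕜 := ℝ) v)
  subset := (tsupport_fderiv_apply_subset ℝ v).trans h.subset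

/-- Products with smooth functions, which need not have compact support. -/
theorem mul_left (h : IsTestFun Ω φ) (hψ : ContDiff ℝ ∞ ψ) : IsTestFun Ω (fun p => ψ p * φ p) where
  smooth := hψ.mul h.smooth
  compact := h.compact.mul_left
  subset := (tsupport_mul_subset_right).trans h.subset

theorem eq_zero (h : IsTestFun Ω φ) {p : E} (hp : p ∉ Ω) : φ p = 0 :=
  image_eq_zero_of_notMem_tsupport fun hp' => hp (h.subset hp')

theorem fderiv_eq_zero (h : IsTestFun Ω φ) {p : E} (hp : p ∉ Ω) (v : E) : fderiv ℝ φ p v = 0 :=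
  (h.fderiv_apply v).eq_zero hp

end IsTestFun

variable [MeasureSpace E] [BorelSpace E]

theorem IsTestFun.integrable_smul {f : E → ℂ} (h : IsTestFun Ω φ)
    (hΩ : IsOpen Ω) [SecondCountableTopology E] [LocallyCompactSpace E]
    (hf : LocallyIntegrableOn f Ω) :
    Integrable (fun p => φ p • f p) (volume.restrict Ω) := by
  have hK : IntegrableOn f (tsupport φ) :=
    (locallyIntegrableOn_iff hΩ.isLocallyClosed).1 hf _ h.subset h.compact
  have h1 : IntegrableOn (fun p => φ p • f p) (tsupport φ) :=
    hK.continuousOn_smul h.smooth.continuous.continuousOn h.compact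
  rw [integrableOn_iff_integrable_of_support_subset] at h1
  · exact h1.integrableOn
  · intro p hp
    by_contra hp'
    exact hp (by simp [image_eq_zero_of_notMem_tsupport hp'])

namespace HasWeakDeriv

variable {v w : E} {f f' g g' : E → ℂ}

theorem congr (h : HasWeakDeriv Ω v f g) (hf : f =ᵐ[volume.restrict Ω] f')
    (hg : g =ᵐ[volume.restrict Ω] g') : HasWeakDeriv Ω v f' g' := by
  have hloc : ∀ {f f' : E → ℂ}, f =ᵐ[volume.restrict Ω] f' → LocallyIntegrableOn f Ω →
      LocallyIntegrableOn f' Ω := by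
    intro f f' hf h x hx
    obtain ⟨s, hs, hs'⟩ := h x hx
    refine ⟨s ∩ Ω, inter_mem hs self_mem_nhdsWithin, ?_⟩
    exact (hs'.mono_set inter_subset_left).congr_fun_ae
      (ae_restrict_of_ae_restrict_of_subset inter_subset_right hf)
  refine ⟨hloc hf h.1, hloc hg h.2.1, fun φ h1 h2 h3 => ?_⟩
  have e := h.2.2 φ h1 h2 h3
  have e1 : ∫ p in Ω, (fderiv ℝ φ p v) • f p = ∫ p in Ω, (fderiv ℝ φ p v) • f' p :=
    integral_congr_ae (hf.mono fun p hp => by simp only [hp])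
  have e2 : ∫ p in Ω, (φ p) • g p = ∫ p in Ω, (φ p) • g' p :=
    integral_congr_ae (hg.mono fun p hp => by simp only [hp])
  rw [← e1, ← e2, e]

variable [SecondCountableTopology E] [LocallyCompactSpace E]

theorem integral_eq (h : HasWeakDeriv Ω v f g) (hφ : IsTestFun Ω φ) :
    ∫ p in Ω, (fderiv ℝ φ p v) • f p = - ∫ p in Ω, (φ p) • g p :=
  h.2.2 φ hφ.smooth hφ.compact hφ.subset

theorem add (hΩ : IsOpen Ω) (h : HasWeakDeriv Ω v f g) (h' : HasWeakDeriv Ω v f' g') :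
    HasWeakDeriv Ω v (fun p => f p + f' p) (fun p => g p + g' p) := by
  refine ⟨h.1.add h'.1, h.2.1.add h'.2.1, fun φ h1 h2 h3 => ?_⟩
  have hφ : IsTestFun Ω φ := ⟨h1, h2, h3⟩
  simp only [smul_add]
  rw [integral_add ((hφ.fderiv_apply v).integrable_smul hΩ h.1)
    ((hφ.fderiv_apply v).integrable_smul hΩ h'.1),
    integral_add (hφ.integrable_smul hΩ h.2.1) (hφ.integrable_smul hΩ h'.2.1),
    h.integral_eq hφ, h'.integral_eq hφ, neg_add]

theorem const_smul (c : ℝ) (h : HasWeakDeriv Ω v f g) :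
    HasWeakDeriv Ω v (fun p => c • f p) (fun p => c • g p) := by
  refine ⟨h.1.smul c, h.2.1.smul c, fun φ h1 h2 h3 => ?_⟩
  simp only [smul_comm _ c]
  rw [integral_smul, integral_smul, h.2.2 φ h1 h2 h3, smul_neg]

/-- Weak derivatives are linear in the direction. -/
theorem comb (hΩ : IsOpen Ω) (h : HasWeakDeriv Ω v f g) (h' : HasWeakDeriv Ω w f g') (a b : ℝ) :
    HasWeakDeriv Ω (a • v + b • w) f (fun p => a • g p + b • g' p) := by
  refine ⟨h.1, (h.2.1.smul a).add (h'.2.1.smul b), fun φ h1 h2 h3 => ?_⟩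
  have hφ : IsTestFun Ω φ := ⟨h1, h2, h3⟩
  have e : ∀ p, (fderiv ℝ φ p (a • v + b • w)) • f p
      = a • ((fderiv ℝ φ p v) • f p) + b • ((fderiv ℝ φ p w) • f p) := fun p => by
    simp only [map_add, map_smul, add_smul, smul_eq_mul, mul_smul]
  simp only [e, smul_add, smul_comm _ a, smul_comm _ b]
  have e1 := integral_add (((hφ.fderiv_apply v).integrable_smul hΩ h.1).smul a)
    (((hφ.fderiv_apply w).integrable_smul hΩ h.1).smul b)
  have e2 := integral_add ((hφ.integrable_smul hΩ h.2.1).smul a)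
    ((hφ.integrable_smul hΩ h'.2.1).smul b)
  simp only [Pi.smul_apply, integral_smul] at e1 e2
  rw [e1, e2]
  rw [h.integral_eq hφ, h'.integral_eq hφ]
  simp only [smul_neg, neg_add]

end HasWeakDeriv

theorem HasWeakDeriv.of_contDiff [FiniteDimensional ℝ E]
    [(volume : Measure E).IsAddHaarMeasure] {g : E → ℂ} (hg : ContDiff ℝ ∞ g)
    (v : E) : HasWeakDeriv Ω v g (fun p => fderiv ℝ g p v) := by
  have hg' : Continuous (fun p => fderiv ℝ g p v) :=
    ((hg.fderiv_right (m := ∞) (by simp)).continuous).clm_apply continuous_const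
  refine ⟨hg.continuous.locallyIntegrable.locallyIntegrableOn _,
    hg'.locallyIntegrable.locallyIntegrableOn _, fun φ h1 h2 h3 => ?_⟩
  have hφ : IsTestFun Ω φ := ⟨h1, h2, h3⟩
  rw [setIntegral_eq_integral_of_forall_compl_eq_zero
      (fun p hp => by rw [hφ.fderiv_eq_zero hp, zero_smul]),
    setIntegral_eq_integral_of_forall_compl_eq_zero
      (fun p hp => by rw [hφ.eq_zero hp, zero_smul])]
  have hcont : ∀ {a : E → ℝ} {b : E → ℂ}, Continuous a → HasCompactSupport a → Continuous b →
      Integrable (fun p => a p • b p) volume := fun ha hc hb =>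
    (ha.smul hb).integrable_of_hasCompactSupport hc.smul_right
  have := integral_smul_fderiv_eq_neg_fderiv_smul_of_integrable (μ := volume) (f := φ) (g := g) (v
      := v)
    (hcont (hφ.fderiv_apply v).smooth.continuous (hφ.fderiv_apply v).compact hg.continuous)
    (hcont hφ.smooth.continuous hφ.compact hg')
    (hcont hφ.smooth.continuous hφ.compact hg.continuous)
    (fun p _ => h1.differentiable (by simp) p) (fun p _ => hg.differentiable (by simp) p)
  rw [this, neg_neg]

namespace IsWeightedDomain

variable {μ : Measure E} [SecondCountableTopology E] [LocallyCompactSpace E]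
  [IsLocallyFiniteMeasure (volume : Measure E)]

/-- The space `L²(μ)` embeds continuously into `L¹(K)` for compact `K ⊆ Ω`. -/
theorem integral_norm_le (hμ : IsWeightedDomain Ω μ) {K : Set E} (hK : IsCompact K) (hKΩ : K ⊆ Ω) :
    ∃ C : ℝ, 0 ≤ C ∧ ∀ f : Lp ℂ 2 μ, IntegrableOn f K ∧ ∫ p in K, ‖f p‖ ≤ C * ‖f‖ := by
  obtain ⟨C, hC, hle⟩ := hμ.le K hK hKΩ
  have : IsFiniteMeasure (volume.restrict K) := ⟨by simpa using hK.measure_lt_top⟩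
  set c : ℝ≥0∞ := C ^ (1 / (2 : ℝ≥0∞).toReal) *
    (volume.restrict K) univ ^ (1 / (1 : ℝ≥0∞).toReal - 1 / (2 : ℝ≥0∞).toReal) with hc
  have hcfin : c ≠ ⊤ := by
    refine ENNReal.mul_ne_top (ENNReal.rpow_ne_top_of_nonneg (by simp) hC)
      (ENNReal.rpow_ne_top_of_nonneg ?_ (measure_ne_top _ _))
    norm_num [ENNReal.toReal_ofNat]
  refine ⟨c.toReal, ENNReal.toReal_nonneg, fun f => ?_⟩
  have h2 : MemLp f 2 (volume.restrict K) := (Lp.memLp f).of_measure_le_smul hC hle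
  have h1 : Integrable f (volume.restrict K) := h2.integrable one_le_two
  refine ⟨h1, ?_⟩
  rw [integral_norm_eq_lintegral_enorm h1.1, ← eLpNorm_one_eq_lintegral_enorm, Lp.norm_def,
    ← ENNReal.toReal_mul]
  refine ENNReal.toReal_mono (ENNReal.mul_ne_top hcfin (Lp.eLpNorm_ne_top f)) ?_
  calc eLpNorm f 1 (volume.restrict K)
      ≤ eLpNorm f 2 (volume.restrict K) * (volume.restrict K) univ ^
        (1 / (1 : ℝ≥0∞).toReal - 1 / (2 : ℝ≥0∞).toReal) :=
        eLpNorm_le_eLpNorm_mul_rpow_measure_univ one_le_two h2.1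
    _ ≤ (C ^ (1 / (2 : ℝ≥0∞).toReal) * eLpNorm f 2 μ) * (volume.restrict K) univ ^
        (1 / (1 : ℝ≥0∞).toReal - 1 / (2 : ℝ≥0∞).toReal) := by
        gcongr
        refine (eLpNorm_mono_measure f hle).trans ?_
        rw [eLpNorm_smul_measure_of_ne_top (by simp), smul_eq_mul, ENNReal.toReal_div,
          ENNReal.toReal_one]
    _ = c * eLpNorm f 2 μ := by rw [hc]; ring

theorem locallyIntegrableOn (hμ : IsWeightedDomain Ω μ) (f : Lp ℂ 2 μ) :
    LocallyIntegrableOn f Ω :=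
  (locallyIntegrableOn_iff hμ.isOpen.isLocallyClosed).2 fun _ hKΩ hK =>
    ((hμ.integral_norm_le hK hKΩ).choose_spec.2 f).1

theorem integrable_smul (hμ : IsWeightedDomain Ω μ) (hφ : IsTestFun Ω φ) (f : Lp ℂ 2 μ) :
    Integrable (fun p => φ p • f p) (volume.restrict Ω) :=
  hφ.integrable_smul hμ.isOpen (hμ.locallyIntegrableOn f)

theorem congr_ae (hμ : IsWeightedDomain Ω μ) {f g : E → ℂ} (h : f =ᵐ[μ] g) :
    f =ᵐ[volume.restrict Ω] g := hμ.ac'.ae_eq h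

/-- Pairing with a test function is a bounded functional on `L²(μ)`. -/
theorem exists_pairing (hμ : IsWeightedDomain Ω μ) (hφ : IsTestFun Ω φ) :
    ∃ Λ : Lp ℂ 2 μ →L[ℂ] ℂ, ∀ f, Λ f = ∫ p in Ω, φ p • f p := by
  obtain ⟨C, hC0, hC⟩ := hμ.integral_norm_le hφ.compact hφ.subset
  obtain ⟨B, hB⟩ := hφ.smooth.continuous.bounded_above_of_compact_support hφ.compact
  have hB0 : 0 ≤ B := (norm_nonneg _).trans (hB 0)
  let L : Lp ℂ 2 μ →ₗ[ℂ] ℂ :=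
    { toFun := fun f => ∫ p in Ω, φ p • f p
      map_add' := fun f g => by
        rw [← integral_add (hμ.integrable_smul hφ f) (hμ.integrable_smul hφ g)]
        refine integral_congr_ae ((hμ.congr_ae (Lp.coeFn_add f g)).mono fun p hp => ?_)
        simp only [hp, Pi.add_apply, smul_add]
      map_smul' := fun c f => by
        rw [RingHom.id_apply, ← integral_smul]
        refine integral_congr_ae ((hμ.congr_ae (Lp.coeFn_smul c f)).mono fun p hp => ?_)
        simp only [hp, Pi.smul_apply]
        rw [smul_comm] }
  refine ⟨L.mkContinuous (B * C) fun f => ?_, fun f => rfl⟩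
  have e : ∫ p in Ω, φ p • f p = ∫ p in tsupport φ, φ p • f p := by
    refine setIntegral_eq_of_subset_of_forall_sdiff_eq_zero hμ.isOpen.measurableSet hφ.subset ?_
    intro p hp
    simp [image_eq_zero_of_notMem_tsupport hp.2]
  change ‖∫ p in Ω, φ p • f p‖ ≤ _
  rw [e]
  calc ‖∫ p in tsupport φ, φ p • f p‖ ≤ ∫ p in tsupport φ, B * ‖f p‖ := by
        refine norm_integral_le_of_norm_le ((hC f).1.norm.const_mul B)
          (Eventually.of_forall fun p => ?_)
        rw [norm_smul]
        gcongr
        exact hB p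
    _ = B * ∫ p in tsupport φ, ‖f p‖ := integral_const_mul _ _
    _ ≤ B * (C * ‖f‖) := by gcongr; exact (hC f).2
    _ = B * C * ‖f‖ := by ring

/-- Test functions separate the points of `L²(μ)`. -/
theorem eq_of_integral_eq [FiniteDimensional ℝ E] (hμ : IsWeightedDomain Ω μ) {f g : Lp ℂ 2 μ}
    (h : ∀ φ : E → ℝ, IsTestFun Ω φ → ∫ p in Ω, φ p • f p = ∫ p in Ω, φ p • g p) : f = g := by
  have key : ∀ᵐ p, p ∈ Ω → f p - g p = 0 := by
    refine hμ.isOpen.ae_eq_zero_of_integral_contDiff_smul_eq_zero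
      ((hμ.locallyIntegrableOn f).sub (hμ.locallyIntegrableOn g)) fun φ h1 h2 h3 => ?_
    have hφ : IsTestFun Ω φ := ⟨h1, h2, h3⟩
    have e : ∫ p, φ p • (f p - g p) = ∫ p in Ω, φ p • (f p - g p) := by
      refine (setIntegral_eq_integral_of_forall_compl_eq_zero fun p hp => ?_).symm
      rw [hφ.eq_zero hp, zero_smul]
    rw [e]
    simp only [smul_sub]
    rw [integral_sub (hμ.integrable_smul hφ f) (hμ.integrable_smul hφ g), h φ hφ, sub_self]
  refine Lp.ext (hμ.ac.ae_le ?_)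
  refine (ae_restrict_iff' hμ.isOpen.measurableSet).2 ?_
  filter_upwards [key] with p hp hpΩ using sub_eq_zero.1 (hp hpΩ)

theorem hasWeakDeriv_congr (hμ : IsWeightedDomain Ω μ) {v : E} {f f' g g' : E → ℂ}
    (h : HasWeakDeriv Ω v f g) (hf : f =ᵐ[μ] f') (hg : g =ᵐ[μ] g') : HasWeakDeriv Ω v f' g' :=
  h.congr (hμ.congr_ae hf) (hμ.congr_ae hg)

theorem hasWeakDeriv_of_forall (hμ : IsWeightedDomain Ω μ) {v : E} {f g : Lp ℂ 2 μ}
    (h : ∀ φ : E → ℝ, IsTestFun Ω φ →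
      ∫ p in Ω, (fderiv ℝ φ p v) • f p = - ∫ p in Ω, (φ p) • g p) : HasWeakDeriv Ω v f g :=
  ⟨hμ.locallyIntegrableOn f, hμ.locallyIntegrableOn g, fun φ h1 h2 h3 => h φ ⟨h1, h2, h3⟩⟩

theorem hasWeakDeriv_add (hμ : IsWeightedDomain Ω μ) {v : E} {f f' g g' : Lp ℂ 2 μ}
    (h : HasWeakDeriv Ω v f g) (h' : HasWeakDeriv Ω v f' g') :
    HasWeakDeriv Ω v (f + f' : Lp ℂ 2 μ) (g + g' : Lp ℂ 2 μ) :=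
  hμ.hasWeakDeriv_congr (h.add hμ.isOpen h') (Lp.coeFn_add f f').symm (Lp.coeFn_add g g').symm

theorem hasWeakDeriv_smul (hμ : IsWeightedDomain Ω μ) {v : E} {f g : Lp ℂ 2 μ} (c : ℝ)
    (h : HasWeakDeriv Ω v f g) : HasWeakDeriv Ω v (c • f : Lp ℂ 2 μ) (c • g : Lp ℂ 2 μ) :=
  hμ.hasWeakDeriv_congr (h.const_smul c) (Lp.coeFn_smul c f).symm (Lp.coeFn_smul c g).symm

theorem hasWeakDeriv_sub (hμ : IsWeightedDomain Ω μ) {v : E} {f f' g g' : Lp ℂ 2 μ}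
    (h : HasWeakDeriv Ω v f g) (h' : HasWeakDeriv Ω v f' g') :
    HasWeakDeriv Ω v (f - f' : Lp ℂ 2 μ) (g - g' : Lp ℂ 2 μ) := by
  have := hμ.hasWeakDeriv_add h (hμ.hasWeakDeriv_smul (-1) h')
  simpa [sub_eq_add_neg] using this

theorem hasWeakDeriv_comb (hμ : IsWeightedDomain Ω μ) {v w : E} {f g g' : Lp ℂ 2 μ}
    (h : HasWeakDeriv Ω v f g) (h' : HasWeakDeriv Ω w f g') (a b : ℝ) :
    HasWeakDeriv Ω (a • v + b • w) f (a • g + b • g' : Lp ℂ 2 μ) := by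
  refine hμ.hasWeakDeriv_congr (h.comb hμ.isOpen h' a b) EventuallyEq.rfl ?_
  filter_upwards [Lp.coeFn_add (a • g) (b • g'), Lp.coeFn_smul a g, Lp.coeFn_smul b g']
    with p h1 h2 h3
  rw [h1, Pi.add_apply, h2, h3, Pi.smul_apply, Pi.smul_apply]

theorem memSobolev_add (hμ : IsWeightedDomain Ω μ) {k : ℕ} {f g : Lp ℂ 2 μ}
    (hf : MemSobolev Ω μ k f) (hg : MemSobolev Ω μ k g) : MemSobolev Ω μ k (f + g) := by
  induction k generalizing f g with
  | zero => trivial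
  | succ k ih =>
    intro v
    obtain ⟨f', h1, h2⟩ := hf v
    obtain ⟨g', h3, h4⟩ := hg v
    exact ⟨f' + g', hμ.hasWeakDeriv_add h1 h3, ih h2 h4⟩

theorem memSobolev_smul (hμ : IsWeightedDomain Ω μ) {k : ℕ} {f : Lp ℂ 2 μ} (c : ℝ)
    (hf : MemSobolev Ω μ k f) : MemSobolev Ω μ k (c • f) := by
  induction k generalizing f with
  | zero => trivial
  | succ k ih =>
    intro v
    obtain ⟨f', h1, h2⟩ := hf v
    exact ⟨c • f', hμ.hasWeakDeriv_smul c h1, ih h2⟩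

variable [FiniteDimensional ℝ E] [(volume : Measure E).IsAddHaarMeasure]
  [IsFiniteMeasureOnCompacts μ]

theorem memSobolev_of_contDiff (hμ : IsWeightedDomain Ω μ) (k : ℕ) {f : Lp ℂ 2 μ} {g : E → ℂ}
    (hf : f =ᵐ[μ] g) (hg : ContDiff ℝ ∞ g) (hc : HasCompactSupport g) : MemSobolev Ω μ k f := by
  induction k generalizing f g with
  | zero => trivial
  | succ k ih =>
    intro v
    have hg1 : ContDiff ℝ ∞ (fun p => fderiv ℝ g p v) :=
      (hg.fderiv_right (by simp)).clm_apply contDiff_const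
    have hg2 : HasCompactSupport (fun p => fderiv ℝ g p v) := hc.fderiv_apply (𝕜 := ℝ) v
    have hm : MemLp (fun p => fderiv ℝ g p v) 2 μ :=
      hg1.continuous.memLp_of_hasCompactSupport hg2
    exact ⟨hm.toLp, hμ.hasWeakDeriv_congr (HasWeakDeriv.of_contDiff hg v) hf.symm
      hm.coeFn_toLp.symm, ih hm.coeFn_toLp hg1 hg2⟩

theorem dense_memSobolev (hμ : IsWeightedDomain Ω μ) (k : ℕ) :
    Dense {f : Lp ℂ 2 μ | MemSobolev Ω μ k f} := by
  refine (Lp.dense_hasCompactSupport_contDiff (μ := μ) (F := ℂ) (p := 2) (by simp)).mono ?_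
  rintro f ⟨g, hfg, hc, hg⟩
  exact hμ.memSobolev_of_contDiff k hfg hg hc

end IsWeightedDomain

end WeightedDomains

/-! ### Gaussian integrals -/

section Gaussian

/-- The standard Gaussian measure on the line. -/
noncomputable abbrev stdGauss : Measure ℝ := ProbabilityTheory.gaussianReal 0 1

theorem integrable_exp_abs_stdGauss (a : ℝ) : Integrable (fun ζ => Real.exp (a * |ζ|)) stdGauss :=
    by
  have h1 := ProbabilityTheory.integrable_exp_mul_gaussianReal (μ := 0) (v := 1) a
  have h2 := ProbabilityTheory.integrable_exp_mul_gaussianReal (μ := 0) (v := 1) (-a)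
  refine (h1.add h2).mono' (by fun_prop) (Eventually.of_forall fun ζ => ?_)
  rw [Real.norm_of_nonneg (Real.exp_nonneg _), Pi.add_apply]
  rcases le_total 0 ζ with h | h
  · rw [abs_of_nonneg h]; linarith [Real.exp_nonneg (-a * ζ)]
  · rw [abs_of_nonpos h]
    have : a * -ζ = -a * ζ := by ring
    rw [this]; linarith [Real.exp_nonneg (a * ζ)]

/-- The exponential moment `∫ e^{a|ζ|} dγ(ζ)`. -/
noncomputable def gaussMoment (a : ℝ) : ℝ := ∫ ζ, Real.exp (a * |ζ|) ∂stdGauss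

theorem gaussMoment_nonneg (a : ℝ) : 0 ≤ gaussMoment a :=
  integral_nonneg fun _ => Real.exp_nonneg _

theorem lintegral_exp_abs_stdGauss (a : ℝ) :
    ∫⁻ ζ, ENNReal.ofReal (Real.exp (a * |ζ|)) ∂stdGauss = ENNReal.ofReal (gaussMoment a) :=
  (ofReal_integral_eq_lintegral_ofReal (integrable_exp_abs_stdGauss a)
    (Eventually.of_forall fun _ => Real.exp_nonneg _)).symm

/-- The sum of two independent centred Gaussian variables is a centred Gaussian variable whose
variance is the sum of the variances. -/
theorem map_add_stdGauss {a b c : ℝ} (h : a ^ 2 + b ^ 2 = c ^ 2) :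
    (stdGauss.prod stdGauss).map (fun p : ℝ × ℝ => a * p.1 + b * p.2)
      = stdGauss.map (fun ζ => c * ζ) := by
  have e1 := ProbabilityTheory.gaussianReal_map_const_mul (μ := 0) (v := 1)
  have e : (fun p : ℝ × ℝ => a * p.1 + b * p.2)
      = (fun p : ℝ × ℝ => p.1 + p.2) ∘ (Prod.map (fun x => a * x) (fun x => b * x)) := rfl
  rw [e, ← Measure.map_map (by fun_prop) (by fun_prop),
    ← Measure.map_prod_map _ _ (by fun_prop) (by fun_prop)]
  change (Measure.map (fun x => a * x) stdGauss) ∗ (Measure.map (fun x => b * x) stdGauss) = _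
  rw [e1 a, e1 b, e1 c, ProbabilityTheory.gaussianReal_conv_gaussianReal]
  congr 1
  · simp
  · ext
    simpa using h

/-- Two successive Gaussian averages are one average, the variances being added. -/
theorem integral_integral_stdGauss {a b c : ℝ} (h : a ^ 2 + b ^ 2 = c ^ 2) {F : ℝ → ℂ}
    (hF : StronglyMeasurable F) (hint : Integrable (fun ζ => F (c * ζ)) stdGauss) :
    ∫ ζ, ∫ ζ', F (a * ζ + b * ζ') ∂stdGauss ∂stdGauss = ∫ ζ, F (c * ζ) ∂stdGauss := by
  have hm : Integrable F (stdGauss.map (fun ζ => c * ζ)) :=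
    (integrable_map_measure hF.aestronglyMeasurable (by fun_prop)).2 hint
  rw [← map_add_stdGauss h] at hm
  have hp : Integrable (fun p : ℝ × ℝ => F (a * p.1 + b * p.2)) (stdGauss.prod stdGauss) :=
    (integrable_map_measure hF.aestronglyMeasurable (by fun_prop)).1 hm
  rw [integral_integral hp, ← integral_map (φ := fun p : ℝ × ℝ => a * p.1 + b * p.2) (by fun_prop)
    hF.aestronglyMeasurable, map_add_stdGauss h, integral_map (by fun_prop) hF.aestronglyMeasurable]

/-- Stein's identity `E[ζ F(ζ)] = E[F'(ζ)]`. -/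
theorem integral_mul_stdGauss {F F' : ℝ → ℝ} {B : ℝ} (hF : ∀ x, HasDerivAt F (F' x) x)
    (hc : Continuous F') (hB : ∀ x, |F x| ≤ B) (hB' : ∀ x, |F' x| ≤ B) :
    ∫ ζ, ζ * F ζ ∂stdGauss = ∫ ζ, F' ζ ∂stdGauss := by
  rw [ProbabilityTheory.integral_gaussianReal_eq_integral_smul one_ne_zero,
    ProbabilityTheory.integral_gaussianReal_eq_integral_smul one_ne_zero]
  set g := ProbabilityTheory.gaussianPDFReal 0 1 with hg
  have hgd : ∀ x, HasDerivAt g (-(x * g x)) x := by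
    intro x
    have h1 : HasDerivAt (fun x : ℝ => -(x - 0) ^ 2 / (2 * ((1 : ℝ≥0) : ℝ)))
        (-(2 * (x - 0)) / (2 * ((1 : ℝ≥0) : ℝ))) x := by
      have := ((((hasDerivAt_id x).sub_const 0).pow 2).neg).div_const (2 * ((1 : ℝ≥0) : ℝ))
      simpa using this
    have h2 := (h1.exp).const_mul ((√(2 * Real.pi * ((1 : ℝ≥0) : ℝ)))⁻¹)
    refine h2.congr_deriv ?_
    rw [hg, ProbabilityTheory.gaussianPDFReal]
    simp only [NNReal.coe_one, sub_zero, mul_one]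
    ring
  have hgi : Integrable g := ProbabilityTheory.integrable_gaussianPDFReal 0 1
  have hFc : Continuous F := continuous_iff_continuousAt.2 fun x => (hF x).continuousAt
  have hxg : Integrable (fun x => x * g x) := by
    have := ProbabilityTheory.memLp_id_gaussianReal (μ := 0) (v := 1) 1
    have h1 : Integrable (fun x : ℝ => x) stdGauss := memLp_one_iff_integrable.1 this
    rw [stdGauss, ProbabilityTheory.gaussianReal_of_var_ne_zero _ one_ne_zero,
      integrable_withDensity_iff_integrable_smul' (by fun_prop)
        (Eventually.of_forall fun _ => ProbabilityTheory.gaussianPDF_lt_top)] at h1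
    refine h1.congr (Eventually.of_forall fun x => ?_)
    simp only [ProbabilityTheory.toReal_gaussianPDF, smul_eq_mul, hg]
    ring
  have i1 : Integrable (F * fun x => -(x * g x)) := by
    exact hxg.neg.bdd_mul (c := B) hFc.aestronglyMeasurable (Eventually.of_forall hB)
  have i2 : Integrable (F' * g) := hgi.bdd_mul (c := B) hc.aestronglyMeasurable
      (Eventually.of_forall hB')
  have i3 : Integrable (F * g) := hgi.bdd_mul (c := B) hFc.aestronglyMeasurable
      (Eventually.of_forall hB)
  have := integral_mul_deriv_eq_deriv_mul_of_integrable (fun x _ => hF x) (fun x _ => hgd x)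
    i1 i2 i3
  simp only [smul_eq_mul]
  have e1 : ∫ x, g x * (x * F x) = -∫ x, F x * -(x * g x) := by
    rw [← integral_neg]; congr 1; ext x; ring
  rw [e1, this, neg_neg]
  congr 1; ext x; ring

end Gaussian

/-! ### Gaussian superpositions of substitution operators -/

section Superposition

theorem eLpNorm_two_sq {M : Type*} [MeasurableSpace M] (μ : Measure M) (f : M → ℂ) :
    eLpNorm f 2 μ ^ 2 = ∫⁻ q, ‖f q‖ₑ ^ 2 ∂μ := by
  have := eLpNorm_nnreal_pow_eq_lintegral (μ := μ) (f := f) (p := 2) (by norm_num)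
  simpa using this

theorem memLp_two_iff {M : Type*} [MeasurableSpace M] {μ : Measure M} {f : M → ℂ}
    (hf : AEStronglyMeasurable f μ) : MemLp f 2 μ ↔ ∫⁻ q, ‖f q‖ₑ ^ 2 ∂μ < ⊤ := by
  rw [← eLpNorm_two_sq]
  refine ⟨fun h => ENNReal.pow_lt_top h.2, fun h => ⟨hf, ?_⟩⟩
  by_contra h'
  rw [not_lt, top_le_iff] at h'
  simp [h'] at h

variable {M : Type*} [MeasurableSpace M]

/-- The superposition `q ↦ ∫ P(q, ζ) k(ρ(q, ζ)) dγ(ζ)` of weighted substitution operators. -/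
noncomputable def superpose (ρ : M → ℝ → M) (P : M → ℝ → ℝ) (k : M → ℂ) (q : M) : ℂ :=
  ∫ ζ, P q ζ • k (ρ q ζ) ∂stdGauss

/-- The hypotheses under which a superposition is a bounded operator on `L²(μ)`: each of the
weighted substitutions is bounded, with a bound that grows at most exponentially in `ζ`. -/
structure IsSuperposition (μ : Measure M) (ρ : M → ℝ → M) (P : M → ℝ → ℝ) (A a : ℝ) : Prop where
  nonneg : 0 ≤ A
  meas_subst : Measurable (fun p : M × ℝ => ρ p.1 p.2)
  meas_weight : Measurable (fun p : M × ℝ => P p.1 p.2)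
  bound : ∀ ζ, ∀ F : M → ℝ≥0∞, Measurable F →
    ∫⁻ q, ‖P q ζ‖ₑ ^ 2 * F (ρ q ζ) ∂μ ≤ ENNReal.ofReal (A * Real.exp (a * |ζ|)) * ∫⁻ q, F q ∂μ

namespace IsSuperposition

variable {μ : Measure M} [SFinite μ] {ρ : M → ℝ → M} {P : M → ℝ → ℝ} {A a : ℝ}

/-- The change of variables, integrated over `ζ`; it bounds a superposition in `L²(μ)`. -/
theorem lintegral_le (h : IsSuperposition μ ρ P A a) {F : M → ℝ≥0∞} (hF : Measurable F) :
    ∫⁻ p : M × ℝ, ‖P p.1 p.2‖ₑ ^ 2 * F (ρ p.1 p.2) ∂(μ.prod stdGauss)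
      ≤ ENNReal.ofReal (A * gaussMoment a) * ∫⁻ q, F q ∂μ := by
  have h1 := h.meas_subst
  have h2 := h.meas_weight
  rw [lintegral_prod_symm _ (by fun_prop)]
  calc ∫⁻ ζ, ∫⁻ q, ‖P q ζ‖ₑ ^ 2 * F (ρ q ζ) ∂μ ∂stdGauss
      ≤ ∫⁻ ζ, ENNReal.ofReal A * ENNReal.ofReal (Real.exp (a * |ζ|)) * ∫⁻ q, F q ∂μ ∂stdGauss := by
        refine lintegral_mono fun ζ => (h.bound ζ F hF).trans_eq ?_
        rw [ENNReal.ofReal_mul h.nonneg]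
    _ = _ := by
        rw [lintegral_mul_const _ (by fun_prop), lintegral_const_mul _ (by fun_prop),
          lintegral_exp_abs_stdGauss, ENNReal.ofReal_mul h.nonneg]

/-- Where the weight does not vanish, the substitution pulls null sets back to null sets. -/
theorem ae_comp (h : IsSuperposition μ ρ P A a) {p : M → Prop} (hp : ∀ᵐ q ∂μ, p q) :
    ∀ᵐ r : M × ℝ ∂(μ.prod stdGauss), P r.1 r.2 = 0 ∨ p (ρ r.1 r.2) := by
  obtain ⟨s, hs, hsm, hs0⟩ := exists_measurable_superset_of_null (ae_iff.1 hp)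
  have h1 := h.lintegral_le (F := s.indicator 1) (measurable_one.indicator hsm)
  have hms := h.meas_subst
  have hmw := h.meas_weight
  rw [lintegral_indicator_one hsm, hs0, mul_zero, nonpos_iff_eq_zero,
    lintegral_eq_zero_iff (by
      exact (hmw.enorm.pow_const 2).mul ((measurable_one.indicator hsm).comp hms))] at h1
  filter_upwards [h1] with r hr
  by_contra hcon
  push Not at hcon
  have : ρ r.1 r.2 ∈ s := hs hcon.2
  simp [this] at hr
  exact hcon.1 hr

theorem stronglyMeasurable_integrand (h : IsSuperposition μ ρ P A a) {k : M → ℂ}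
    (hk : StronglyMeasurable k) :
    StronglyMeasurable (fun p : M × ℝ => P p.1 p.2 • k (ρ p.1 p.2)) :=
  h.meas_weight.stronglyMeasurable.smul (hk.comp_measurable h.meas_subst)

theorem lintegral_integrand_le (h : IsSuperposition μ ρ P A a) {k : M → ℂ}
    (hk : StronglyMeasurable k) :
    ∫⁻ p : M × ℝ, ‖P p.1 p.2 • k (ρ p.1 p.2)‖ₑ ^ 2 ∂(μ.prod stdGauss)
      ≤ ENNReal.ofReal (A * gaussMoment a) * ∫⁻ q, ‖k q‖ₑ ^ 2 ∂μ := by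
  simp only [enorm_smul, mul_pow]
  exact h.lintegral_le (hk.measurable.enorm.pow_const 2)

theorem memLp_integrand (h : IsSuperposition μ ρ P A a) {k : M → ℂ}
    (hk : StronglyMeasurable k) (hk2 : MemLp k 2 μ) :
    MemLp (fun p : M × ℝ => P p.1 p.2 • k (ρ p.1 p.2)) 2 (μ.prod stdGauss) := by
  rw [memLp_two_iff (h.stronglyMeasurable_integrand hk).aestronglyMeasurable]
  refine (h.lintegral_integrand_le hk).trans_lt (ENNReal.mul_lt_top (by simp) ?_)
  exact (memLp_two_iff hk.aestronglyMeasurable).1 hk2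

theorem ae_integrable (h : IsSuperposition μ ρ P A a) {k : M → ℂ}
    (hk : StronglyMeasurable k) (hk2 : MemLp k 2 μ) :
    ∀ᵐ q ∂μ, Integrable (fun ζ => P q ζ • k (ρ q ζ)) stdGauss := by
  have h1 := h.stronglyMeasurable_integrand hk
  have h2 := (memLp_two_iff h1.aestronglyMeasurable).1 (h.memLp_integrand hk hk2)
  rw [lintegral_prod _ (h1.measurable.enorm.pow_const 2).aemeasurable] at h2
  have h3 := ae_lt_top (h1.measurable.enorm.pow_const 2).lintegral_prod_right' h2.ne
  filter_upwards [h3] with q hq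
  have hm : StronglyMeasurable (fun ζ => P q ζ • k (ρ q ζ)) :=
    h1.comp_measurable (measurable_prodMk_left (x := q))
  exact ((memLp_two_iff hm.aestronglyMeasurable).2 hq).integrable one_le_two

theorem stronglyMeasurable_superpose (h : IsSuperposition μ ρ P A a) {k : M → ℂ}
    (hk : StronglyMeasurable k) : StronglyMeasurable (superpose ρ P k) :=
  (h.stronglyMeasurable_integrand hk).integral_prod_right'

theorem superpose_congr (h : IsSuperposition μ ρ P A a) {k k' : M → ℂ} (hkk : k =ᵐ[μ] k') :
    superpose ρ P k =ᵐ[μ] superpose ρ P k' := by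
  filter_upwards [Measure.ae_ae_of_ae_prod (h.ae_comp hkk)] with q hq
  refine integral_congr_ae ?_
  filter_upwards [hq] with ζ hζ
  rcases hζ with hζ | hζ
  · simp [hζ]
  · simp only [hζ]

/-- Jensen's inequality for the Gaussian average. -/
theorem eLpNorm_superpose_le (h : IsSuperposition μ ρ P A a) {k : M → ℂ}
    (hk : StronglyMeasurable k) :
    eLpNorm (superpose ρ P k) 2 μ ≤ ENNReal.ofReal (√(A * gaussMoment a)) * eLpNorm k 2 μ := by
  have hN := mul_nonneg h.nonneg (gaussMoment_nonneg a)
  have h1 := h.stronglyMeasurable_integrand hk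
  rw [← ENNReal.pow_le_pow_left_iff (n := 2) (by norm_num), mul_pow, eLpNorm_two_sq, eLpNorm_two_sq,
    ← ENNReal.ofReal_pow (Real.sqrt_nonneg _), Real.sq_sqrt hN]
  refine le_trans ?_ (h.lintegral_integrand_le hk)
  rw [lintegral_prod _ (h1.measurable.enorm.pow_const 2).aemeasurable]
  refine lintegral_mono fun q => ?_
  have hm : StronglyMeasurable (fun ζ => P q ζ • k (ρ q ζ)) :=
    h1.comp_measurable (measurable_prodMk_left (x := q))
  calc ‖superpose ρ P k q‖ₑ ^ 2 ≤ (∫⁻ ζ, ‖P q ζ • k (ρ q ζ)‖ₑ ∂stdGauss) ^ 2 := by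
        gcongr; exact enorm_integral_le_lintegral_enorm _
    _ ≤ (eLpNorm (fun ζ => P q ζ • k (ρ q ζ)) 2 stdGauss) ^ 2 := by
        gcongr
        rw [← eLpNorm_one_eq_lintegral_enorm]
        exact eLpNorm_le_eLpNorm_of_exponent_le one_le_two hm.aestronglyMeasurable
    _ = _ := eLpNorm_two_sq _ _

theorem memLp_superpose (h : IsSuperposition μ ρ P A a) {k : M → ℂ}
    (hk : StronglyMeasurable k) (hk2 : MemLp k 2 μ) : MemLp (superpose ρ P k) 2 μ :=
  ⟨(h.stronglyMeasurable_superpose hk).aestronglyMeasurable,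
    (h.eLpNorm_superpose_le hk).trans_lt (ENNReal.mul_lt_top (by simp) hk2.2)⟩

theorem superpose_add (h : IsSuperposition μ ρ P A a) {k k' : M → ℂ}
    (hk : StronglyMeasurable k) (hk2 : MemLp k 2 μ) (hk' : StronglyMeasurable k')
    (hk2' : MemLp k' 2 μ) :
    superpose ρ P (k + k') =ᵐ[μ] superpose ρ P k + superpose ρ P k' := by
  filter_upwards [h.ae_integrable hk hk2, h.ae_integrable hk' hk2'] with q h1 h2
  simp only [superpose, Pi.add_apply, smul_add]
  exact integral_add h1 h2

/-- The superposition as a bounded operator on `L²(μ)`. -/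
noncomputable def toCLM (h : IsSuperposition μ ρ P A a) : Lp ℂ 2 μ →L[ℂ] Lp ℂ 2 μ :=
  LinearMap.mkContinuous
    { toFun := fun k => (h.memLp_superpose (Lp.stronglyMeasurable k) (Lp.memLp k)).toLp
      map_add' := fun k k' => by
        refine Lp.ext ?_
        refine (MemLp.coeFn_toLp _).trans ?_
        refine (h.superpose_congr (Lp.coeFn_add k k')).trans ?_
        refine (h.superpose_add (Lp.stronglyMeasurable k) (Lp.memLp k)
          (Lp.stronglyMeasurable k') (Lp.memLp k')).trans ?_
        refine EventuallyEq.trans ?_ (Lp.coeFn_add _ _).symm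
        exact (MemLp.coeFn_toLp _).symm.add (MemLp.coeFn_toLp _).symm
      map_smul' := fun c k => by
        refine Lp.ext ?_
        refine (MemLp.coeFn_toLp _).trans ?_
        refine (h.superpose_congr (Lp.coeFn_smul c k)).trans ?_
        refine EventuallyEq.trans ?_ (Lp.coeFn_smul _ _).symm
        filter_upwards [MemLp.coeFn_toLp (h.memLp_superpose (Lp.stronglyMeasurable k) (Lp.memLp k))]
          with q hq
        rw [RingHom.id_apply, Pi.smul_apply, hq]
        simp only [superpose, Pi.smul_apply, smul_comm _ c]
        exact integral_smul c _ } (√(A * gaussMoment a)) fun k => by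
    have h1 := h.eLpNorm_superpose_le (Lp.stronglyMeasurable k)
    change ‖(h.memLp_superpose (Lp.stronglyMeasurable k) (Lp.memLp k)).toLp‖ ≤ _
    rw [Lp.norm_toLp, Lp.norm_def]
    refine (ENNReal.toReal_mono (ENNReal.mul_ne_top (by simp) (Lp.eLpNorm_ne_top k)) h1).trans_eq ?_
    rw [ENNReal.toReal_mul, ENNReal.toReal_ofReal (Real.sqrt_nonneg _)]

theorem coeFn_toCLM (h : IsSuperposition μ ρ P A a) (k : Lp ℂ 2 μ) :
    h.toCLM k =ᵐ[μ] superpose ρ P k :=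
  MemLp.coeFn_toLp (h.memLp_superpose (Lp.stronglyMeasurable k) (Lp.memLp k))

theorem norm_toCLM_le (h : IsSuperposition μ ρ P A a) : ‖h.toCLM‖ ≤ √(A * gaussMoment a) :=
  LinearMap.mkContinuous_norm_le _ (Real.sqrt_nonneg _) _

end IsSuperposition

variable {E : Type*} [NormedAddCommGroup E] [NormedSpace ℝ E] [MeasureSpace E] [BorelSpace E]
  [SecondCountableTopology E] [LocallyCompactSpace E] [IsLocallyFiniteMeasure (volume : Measure E)]
  {Ω : Set E} {μ : Measure E} [SFinite μ] {ρ : E → ℝ → E} {P : E → ℝ → ℝ} {A a : ℝ}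

theorem IsWeightedDomain.integrable_test_superposition (hμ : IsWeightedDomain Ω μ)
    (h : IsSuperposition μ ρ P A a) {φ : E → ℝ} (hφ : IsTestFun Ω φ) (k : Lp ℂ 2 μ) :
    Integrable (fun p : E × ℝ => φ p.1 • (P p.1 p.2 • k (ρ p.1 p.2)))
      ((volume.restrict Ω).prod stdGauss) := by
  obtain ⟨C, hC, hle⟩ := hμ.le _ hφ.compact hφ.subset
  have : IsFiniteMeasure (volume.restrict (tsupport φ)) := ⟨by simpa using
      hφ.compact.measure_lt_top⟩
  have h1 : MemLp (fun p : E × ℝ => P p.1 p.2 • k (ρ p.1 p.2)) 2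
      ((volume.restrict (tsupport φ)).prod stdGauss) := by
    refine (h.memLp_integrand (Lp.stronglyMeasurable k) (Lp.memLp k)).of_measure_le_smul hC ?_
    rw [← Measure.prod_smul_left]
    exact Measure.prod_mono hle le_rfl
  obtain ⟨B, hB⟩ := hφ.smooth.continuous.bounded_above_of_compact_support hφ.compact
  have h2 : Integrable (fun p : E × ℝ => φ p.1 • (P p.1 p.2 • k (ρ p.1 p.2)))
      ((volume.restrict (tsupport φ)).prod stdGauss) :=
    (h1.integrable one_le_two).bdd_smul B
      (hφ.smooth.continuous.comp continuous_fst).aestronglyMeasurable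
      (Eventually.of_forall fun p => hB p.1)
  have e : (volume.restrict (tsupport φ)).prod stdGauss
      = ((volume.restrict Ω).prod stdGauss).restrict (tsupport φ ×ˢ univ) := by
    rw [← Measure.prod_restrict, Measure.restrict_univ, Measure.restrict_restrict
      (isClosed_tsupport φ).measurableSet, inter_eq_self_of_subset_left hφ.subset]
  rw [e] at h2
  refine (integrableOn_iff_integrable_of_support_subset ?_).1 h2
  intro p hp
  refine ⟨?_, mem_univ _⟩
  by_contra hp'
  exact hp (by simp [image_eq_zero_of_notMem_tsupport hp'])

/-- Fubini: the pairing of a superposition with a test function is the average over `ζ` of the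
pairings for fixed `ζ`. -/
theorem IsWeightedDomain.integral_test_toCLM (hμ : IsWeightedDomain Ω μ)
    (h : IsSuperposition μ ρ P A a) {φ : E → ℝ} (hφ : IsTestFun Ω φ) (k : Lp ℂ 2 μ) :
    ∫ p in Ω, φ p • h.toCLM k p
      = ∫ ζ, (∫ p in Ω, φ p • (P p ζ • k (ρ p ζ))) ∂stdGauss := by
  have h1 := hμ.integrable_test_superposition h hφ k
  have e1 : ∫ p in Ω, φ p • h.toCLM k p = ∫ p in Ω, φ p • superpose ρ P k p :=
    integral_congr_ae ((hμ.congr_ae (h.coeFn_toCLM k)).mono fun p hp => by simp only [hp])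
  rw [e1]
  simp only [superpose, ← integral_smul]
  exact integral_integral_swap h1

end Superposition

/-! ### Exponential weights -/

section Weights

theorem abs_sqrt_one_add_sq_sub_le (x y : ℝ) : |√(1 + x ^ 2) - √(1 + y ^ 2)| ≤ |x - y| := by
  have key : ∀ x y : ℝ, √(1 + x ^ 2) - √(1 + y ^ 2) ≤ |x - y| := by
    intro x y
    have hy : |y| ≤ √(1 + y ^ 2) := by
      rw [← Real.sqrt_sq_eq_abs]; exact Real.sqrt_le_sqrt (by linarith)
    have hs := Real.sq_sqrt (show 0 ≤ 1 + y ^ 2 by positivity)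
    rw [sub_le_iff_le_add]
    refine Real.sqrt_le_iff.2 ⟨by positivity, ?_⟩
    have h1 : (x - y) * y ≤ |x - y| * √(1 + y ^ 2) :=
      (le_abs_self _).trans (by rw [abs_mul]; gcongr)
    nlinarith [sq_abs (x - y)]
  refine abs_le.2 ⟨?_, key x y⟩
  have := key y x
  rw [abs_sub_comm] at this
  linarith

theorem sqrt_one_add_sq_le (x : ℝ) : √(1 + x ^ 2) ≤ 1 + |x| := by
  have := abs_sqrt_one_add_sq_sub_le x 0
  simp only [ne_eq, OfNat.ofNat_ne_zero, not_false_eq_true, zero_pow, add_zero, Real.sqrt_one,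
    sub_zero] at this
  linarith [le_abs_self (√(1 + x ^ 2) - 1)]

theorem continuous_weight (lam : ℝ) : Continuous fun x : ℝ => Real.exp (-2 * lam * √(1 + x ^ 2))
    := by
  fun_prop

theorem weight_add_le (lam x c : ℝ) : Real.exp (-2 * lam * √(1 + (x + c) ^ 2))
    ≤ Real.exp (2 * |lam| * |c|) * Real.exp (-2 * lam * √(1 + x ^ 2)) := by
  rw [← Real.exp_add]
  refine Real.exp_le_exp.2 ?_
  have h := abs_sqrt_one_add_sq_sub_le x (x + c)
  have h2 : lam * (√(1 + x ^ 2) - √(1 + (x + c) ^ 2)) ≤ |lam| * |c| := by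
    refine (le_abs_self _).trans ?_
    rw [abs_mul]
    refine mul_le_mul_of_nonneg_left ?_ (abs_nonneg _)
    simpa using h
  linarith

/-- A translation by `c` changes the weighted measure at most by the factor `e^{2|lam||c|}`. -/
theorem lintegral_weightMeasure_sub_le (lam c : ℝ) {F : ℝ → ℝ≥0∞} (hF : Measurable F) :
    ∫⁻ x, F (x - c) ∂(weightMeasure lam)
      ≤ ENNReal.ofReal (Real.exp (2 * |lam| * |c|)) * ∫⁻ x, F x ∂(weightMeasure lam) := by
  have hw := (continuous_weight lam).measurable.ennreal_ofReal
  rw [weightMeasure, lintegral_withDensity_eq_lintegral_mul _ hw (by fun_prop),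
    lintegral_withDensity_eq_lintegral_mul _ hw hF, ← lintegral_const_mul _ (hw.mul hF),
    ← lintegral_add_right_eq_self _ c]
  refine lintegral_mono fun x => ?_
  simp only [Pi.mul_apply, add_sub_cancel_right]
  rw [← mul_assoc, ← ENNReal.ofReal_mul (Real.exp_nonneg _)]
  gcongr
  exact weight_add_le lam x c

/-- A measure with a positive continuous density on an open set. -/
theorem isWeightedDomain_withDensity {E : Type*} [NormedAddCommGroup E] [NormedSpace ℝ E]
    [MeasureSpace E] [BorelSpace E] {Ω : Set E} (hΩ : IsOpen Ω) {w : E → ℝ} (hw : Continuous w)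
    (hpos : ∀ x, 0 < w x) :
    IsWeightedDomain Ω ((volume.restrict Ω).withDensity fun x => ENNReal.ofReal (w x)) where
  isOpen := hΩ
  ac := withDensity_absolutelyContinuous _ _
  ac' := withDensity_absolutelyContinuous' hw.measurable.ennreal_ofReal.aemeasurable
    (Eventually.of_forall fun x => by simpa using hpos x)
  le := by
    intro K hK hKΩ
    obtain rfl | hne := K.eq_empty_or_nonempty
    · exact ⟨0, by simp, by simp⟩
    obtain ⟨x₀, -, hx₀⟩ := hK.exists_isMinOn hne hw.continuousOn
    refine ⟨ENNReal.ofReal (w x₀)⁻¹, by simp, ?_⟩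
    refine Measure.le_iff.2 fun s hs => ?_
    rw [Measure.smul_apply, withDensity_apply _ hs, Measure.restrict_restrict hs, smul_eq_mul,
      ← lintegral_const_mul _ hw.measurable.ennreal_ofReal, Measure.restrict_apply hs]
    calc volume (s ∩ K) = ∫⁻ x in s ∩ K, 1 := by simp
      _ ≤ ∫⁻ x in s ∩ K, ENNReal.ofReal (w x₀)⁻¹ * ENNReal.ofReal (w x) := by
        refine setLIntegral_mono' (hs.inter hK.measurableSet) fun x hx => ?_
        rw [← ENNReal.ofReal_mul (inv_nonneg.2 (hpos x₀).le), ENNReal.one_le_ofReal,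
          inv_mul_eq_div, one_le_div (hpos x₀)]
        exact hx₀ hx.2
      _ ≤ _ := lintegral_mono_set (inter_subset_inter_right s hKΩ)

theorem isWeightedDomain_line (lam : ℝ) : IsWeightedDomain univ (weightMeasure lam) := by
  have := isWeightedDomain_withDensity isOpen_univ (continuous_weight lam) fun x => Real.exp_pos _
  rwa [Measure.restrict_univ] at this

instance (lam : ℝ) : SFinite (weightMeasure lam) := by unfold weightMeasure; infer_instance

instance (lam : ℝ) : IsLocallyFiniteMeasure (weightMeasure lam) :=
  IsLocallyFiniteMeasure.withDensity_coe (continuous_real_toNNReal.comp (continuous_weight lam))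

instance (α β lam : ℝ) : IsLocallyFiniteMeasure (stripMeasure α β lam) := by
  unfold stripMeasure; infer_instance

instance (α β lam : ℝ) : SFinite (stripMeasure α β lam) := by
  unfold stripMeasure; infer_instance

theorem volume_restrict_strip (α β : ℝ) : (volume : Measure (ℝ × ℝ)).restrict (strip α β)
    = ((volume : Measure ℝ).restrict (Ioo α β)).prod volume := by
  rw [strip, Measure.volume_eq_prod, ← Measure.prod_restrict, Measure.restrict_univ]

theorem isOpen_strip (α β : ℝ) : IsOpen (strip α β) := isOpen_Ioo.prod isOpen_univ

theorem stripMeasure_eq (α β lam : ℝ) : stripMeasure α β lam =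
    ((volume : Measure (ℝ × ℝ)).restrict (strip α β)).withDensity
      fun p => ENNReal.ofReal (Real.exp (-2 * lam * √(1 + p.2 ^ 2))) := by
  rw [volume_restrict_strip, stripMeasure, weightMeasure,
    prod_withDensity_right (continuous_weight lam).measurable.ennreal_ofReal]

theorem isWeightedDomain_strip (α β lam : ℝ) :
    IsWeightedDomain (strip α β) (stripMeasure α β lam) := by
  rw [stripMeasure_eq]
  exact isWeightedDomain_withDensity (isOpen_strip α β)
    ((continuous_weight lam).comp continuous_snd) fun x => Real.exp_pos _

theorem ae_stripMeasure_mem (α β lam : ℝ) : ∀ᵐ p ∂(stripMeasure α β lam), p ∈ strip α β :=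
  (isWeightedDomain_strip α β lam).ac.ae_le (ae_restrict_mem (isOpen_strip α β).measurableSet)

theorem integrable_exp_neg_abs : Integrable fun x : ℝ => Real.exp (-|x|) := by
  refine (integrable_inv_one_add_sq.const_mul 2).mono' (by fun_prop)
    (Eventually.of_forall fun x => ?_)
  rw [Real.norm_of_nonneg (Real.exp_nonneg _), Real.exp_neg, ← div_eq_mul_inv,
    inv_le_comm₀ (Real.exp_pos _) (by positivity), inv_div]
  have := Real.quadratic_le_exp_of_nonneg (abs_nonneg x)
  rw [sq_abs] at this
  linarith [abs_nonneg x, sq_nonneg x]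

/-- `e^{-2b|x|}` beats the weight as soon as `b > |lam|`. -/
theorem integrable_exp_mul_weight (lam : ℝ) :
    Integrable fun x : ℝ => Real.exp (-2 * (|lam| + 1) * |x|) * Real.exp (2 * |lam| * √(1 + x ^
        2)) := by
  refine (integrable_exp_neg_abs.const_mul (Real.exp (2 * |lam|))).mono' (by fun_prop)
    (Eventually.of_forall fun x => ?_)
  rw [Real.norm_of_nonneg (by positivity), ← Real.exp_add, ← Real.exp_add]
  refine Real.exp_le_exp.2 ?_
  have := mul_le_mul_of_nonneg_left (sqrt_one_add_sq_le x) (abs_nonneg lam)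
  nlinarith [abs_nonneg x]

theorem lintegral_exp_weightMeasure_lt_top (lam : ℝ) :
    ∫⁻ x, ENNReal.ofReal (Real.exp (-2 * (|lam| + 1) * |x|)) ∂(weightMeasure lam) < ⊤ := by
  have hw := (continuous_weight lam).measurable.ennreal_ofReal
  rw [weightMeasure, lintegral_withDensity_eq_lintegral_mul _ hw (by fun_prop)]
  refine lt_of_le_of_lt (lintegral_mono fun x => ?_) (integrable_exp_mul_weight
      lam).lintegral_lt_top
  rw [Pi.mul_apply, ← ENNReal.ofReal_mul (Real.exp_nonneg _), mul_comm]
  have h1 : -2 * lam ≤ 2 * |lam| := by linarith [neg_abs_le lam]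
  exact ENNReal.ofReal_le_ofReal (mul_le_mul_of_nonneg_left
    (Real.exp_le_exp.2 (mul_le_mul_of_nonneg_right h1 (Real.sqrt_nonneg _))) (Real.exp_nonneg _))

/-- The Cauchy–Schwarz inequality, in the form of the inequality of the means. -/
theorem mul_le_half_sq_weight (lam x r : ℝ) : Real.exp (-(|lam| + 1) * |x|) * r
    ≤ r ^ 2 * Real.exp (-2 * lam * √(1 + x ^ 2))
      + Real.exp (-2 * (|lam| + 1) * |x|) * Real.exp (2 * |lam| * √(1 + x ^ 2)) := by
  set u := Real.exp (-lam * √(1 + x ^ 2)) with hu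
  set e := Real.exp (-(|lam| + 1) * |x|) with he
  set v := Real.exp (lam * √(1 + x ^ 2)) with hv
  have huv : u * v = 1 := by rw [hu, hv, ← Real.exp_add]; simp
  have h1 : Real.exp (-2 * lam * √(1 + x ^ 2)) = u ^ 2 := by
    rw [hu, ← Real.exp_nat_mul]; congr 1; push_cast; ring
  have h2 : Real.exp (-2 * (|lam| + 1) * |x|) = e ^ 2 := by
    rw [he, ← Real.exp_nat_mul]; congr 1; push_cast; ring
  have h3 : v ^ 2 ≤ Real.exp (2 * |lam| * √(1 + x ^ 2)) := by
    rw [hv, ← Real.exp_nat_mul]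
    refine Real.exp_le_exp.2 ?_
    push_cast
    nlinarith [Real.sqrt_nonneg (1 + x ^ 2), le_abs_self lam]
  rw [h1, h2]
  have h4 : e ^ 2 * v ^ 2 ≤ e ^ 2 * Real.exp (2 * |lam| * √(1 + x ^ 2)) := by gcongr
  have h5 : e * r = (e * v) * (r * u) := by
    linear_combination (-(e * r)) * huv
  nlinarith [sq_nonneg (e * v - r * u), sq_nonneg (e * v), sq_nonneg (r * u)]

/-- Weighted square integrability controls an exponentially weighted first moment. -/
theorem lintegral_exp_mul_le (m : ℝ) {g : ℝ → ℂ} (hg : AEStronglyMeasurable g) :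
    ∫⁻ x, ENNReal.ofReal (Real.exp (-(|m| + 1) * |x|)) * ‖g x‖ₑ
      ≤ eLpNorm g 2 (weightMeasure m) ^ 2
        + ∫⁻ x, ENNReal.ofReal
          (Real.exp (-2 * (|m| + 1) * |x|) * Real.exp (2 * |m| * √(1 + x ^ 2))) := by
  have hw := (continuous_weight m).measurable.ennreal_ofReal
  rw [eLpNorm_two_sq, weightMeasure, lintegral_withDensity_eq_lintegral_mul₀ hw.aemeasurable
    (hg.enorm.pow_const 2),
    ← lintegral_add_right _ (by fun_prop)]
  refine lintegral_mono fun x => ?_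
  have h := mul_le_half_sq_weight m x ‖g x‖
  rw [Pi.mul_apply, ← ofReal_norm, ← ENNReal.ofReal_mul (Real.exp_nonneg _),
    ← ENNReal.ofReal_pow (norm_nonneg _), ← ENNReal.ofReal_mul (Real.exp_nonneg _),
    ← ENNReal.ofReal_add (by positivity) (by positivity)]
  refine ENNReal.ofReal_le_ofReal (h.trans_eq ?_)
  ring

theorem integrable_exp_mul_of_memLp (m : ℝ) {g : ℝ → ℂ} (hg : MemLp g 2 (weightMeasure m)) :
    Integrable fun x => Real.exp (-(|m| + 1) * |x|) • g x := by
  have hm : AEStronglyMeasurable g := by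
    have := (isWeightedDomain_line m).ac'
    rw [Measure.restrict_univ] at this
    exact hg.1.mono_ac this
  refine ⟨(by fun_prop : Continuous fun x : ℝ => Real.exp (-(|m| + 1) *
      |x|)).aestronglyMeasurable.smul
    hm, ?_⟩
  refine lt_of_le_of_lt (lintegral_mono fun x => ?_) ((lintegral_exp_mul_le m hm).trans_lt
    (ENNReal.add_lt_top.2 ⟨ENNReal.pow_lt_top hg.2, (integrable_exp_mul_weight
        m).lintegral_lt_top⟩))
  rw [enorm_smul, ← ofReal_norm, Real.norm_of_nonneg (Real.exp_nonneg _)]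

theorem integrable_exp_mul_strip (α β lam : ℝ) (k : L2Strip α β lam) :
    Integrable (fun p : ℝ × ℝ => Real.exp (-(|lam| + 1) * |p.2|) • k p)
      (volume.restrict (strip α β)) := by
  have hw : Measurable fun p : ℝ × ℝ => ENNReal.ofReal (Real.exp (-2 * lam * √(1 + p.2 ^ 2))) :=
    ((continuous_weight lam).comp continuous_snd).measurable.ennreal_ofReal
  have hk : StronglyMeasurable k := Lp.stronglyMeasurable k
  have h1 := (memLp_two_iff hk.aestronglyMeasurable).1 (Lp.memLp k)
  have h2 : ∫⁻ q, ‖k q‖ₑ ^ 2 ∂((volume : Measure (ℝ × ℝ)).restrict (strip α β)).withDensity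
      (fun p => ENNReal.ofReal (Real.exp (-2 * lam * √(1 + p.2 ^ 2)))) < ⊤ := by
    rw [← stripMeasure_eq]; exact h1
  rw [lintegral_withDensity_eq_lintegral_mul _ hw
    (hk.measurable.enorm.pow_const 2)] at h2
  have i1 : Integrable (fun p : ℝ × ℝ => ‖k p‖ ^ 2 * Real.exp (-2 * lam * √(1 + p.2 ^ 2)))
      (volume.restrict (strip α β)) := by
    refine ⟨((hk.norm.pow 2).mul (by
      exact ((continuous_weight lam).comp continuous_snd).stronglyMeasurable)).aestronglyMeasurable,
      lt_of_le_of_lt (lintegral_mono fun p => ?_) h2⟩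
    rw [Pi.mul_apply, ← ofReal_norm, ← ofReal_norm, ← ENNReal.ofReal_pow (norm_nonneg _),
      ← ENNReal.ofReal_mul (Real.exp_nonneg _), Real.norm_of_nonneg (by positivity)]
    exact ENNReal.ofReal_le_ofReal (mul_comm _ _).le
  have i2 : Integrable (fun p : ℝ × ℝ =>
      Real.exp (-2 * (|lam| + 1) * |p.2|) * Real.exp (2 * |lam| * √(1 + p.2 ^ 2)))
      (volume.restrict (strip α β)) := by
    rw [volume_restrict_strip]
    simpa using (integrable_const (μ := (volume : Measure ℝ).restrict (Ioo α β)) (1 : ℝ)).mul_prod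
      (integrable_exp_mul_weight lam)
  refine (i1.add i2).mono' (((by fun_prop : Continuous fun p : ℝ × ℝ =>
    Real.exp (-(|lam| + 1) * |p.2|)).stronglyMeasurable.smul hk).aestronglyMeasurable)
    (Eventually.of_forall fun p => ?_)
  rw [norm_smul, Real.norm_of_nonneg (Real.exp_nonneg _)]
  exact mul_le_half_sq_weight lam p.2 ‖k p‖

end Weights

/-! ### Strong continuity and the weak evolution equation -/

section Evolution

/-- Averaging operators whose substitutions tend to the identity converge strongly to the
identity, provided that they map functions with compact support to functions with a common
square integrable bound. -/
theorem IsSuperposition.tendsto_id {E : Type*} [NormedAddCommGroup E] [NormedSpace ℝ E]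
    [FiniteDimensional ℝ E] [MeasurableSpace E] [BorelSpace E] {μ : Measure E} [SFinite μ]
    [IsFiniteMeasureOnCompacts μ] {ρ : ℝ → E → ℝ → E} {A a : ℝ}
    {T : ℝ → Lp ℂ 2 μ →L[ℂ] Lp ℂ 2 μ}
    (h : ∀ t ∈ Ioc (0 : ℝ) 1, IsSuperposition μ (ρ t) (fun _ _ => 1) A a)
    (hT : ∀ t ∈ Ioc (0 : ℝ) 1, ∀ k, T t k =ᵐ[μ] superpose (ρ t) (fun _ _ => 1) k)
    (hρ : ∀ q ζ, Tendsto (fun t => ρ t q ζ) (𝓝[>] 0) (𝓝 q))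
    (hdom : ∀ g : E → ℂ, Continuous g → HasCompactSupport g → ∃ (D : E → ℝ) (b : ℝ), Measurable D ∧
      ∫⁻ q, ‖D q‖ₑ ^ 2 ∂μ < ⊤ ∧ ∀ t ∈ Ioc (0 : ℝ) 1, ∀ᵐ q ∂μ, ∀ ζ,
        ‖g (ρ t q ζ)‖ ≤ D q * Real.exp (b * |ζ|)) (k : Lp ℂ 2 μ) :
    Tendsto (fun t => T t k) (𝓝[>] 0) (𝓝 k) := by
  have hT' : ∀ t (ht : t ∈ Ioc (0 : ℝ) 1), T t = (h t ht).toCLM := fun t ht =>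
    ContinuousLinearMap.ext fun k => Lp.ext ((hT t ht k).trans ((h t ht).coeFn_toCLM k).symm)
  have hM : ∀ᶠ t in 𝓝[>] (0 : ℝ), ‖T t‖ ≤ √(A * gaussMoment a) := by
    filter_upwards [Ioc_mem_nhdsGT zero_lt_one] with t ht
    rw [hT' t ht]
    exact (h t ht).norm_toCLM_le
  -- it suffices to consider a dense set of functions
  have hcl : IsClosed {k : Lp ℂ 2 μ | Tendsto (fun t => T t k) (𝓝[>] 0) (𝓝 k)} := by
    refine isClosed_of_closure_subset fun k hk => ?_
    rw [mem_ofPred_eq, Metric.tendsto_nhds]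
    intro ε hε
    set c := √(A * gaussMoment a) with hc
    have hc0 : 0 ≤ c := Real.sqrt_nonneg _
    obtain ⟨k', hk', hd⟩ := Metric.mem_closure_iff.1 hk (ε / (2 * (c + 2))) (by positivity)
    have hk' : Tendsto (fun t => T t k') (𝓝[>] 0) (𝓝 k') := hk'
    filter_upwards [hM, Metric.tendsto_nhds.1 hk' (ε / 2) (by positivity)] with t h1 h2
    rw [dist_eq_norm] at hd h2 ⊢
    have e : T t k - k = T t (k - k') + (T t k' - k') - (k - k') := by
      rw [map_sub]; abel
    rw [e]
    have h3 : ‖T t (k - k')‖ ≤ c * ‖k - k'‖ := ((T t).le_opNorm _).trans (by gcongr)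
    rw [lt_div_iff₀ (by positivity)] at hd
    calc _ ≤ ‖T t (k - k')‖ + ‖T t k' - k'‖ + ‖k - k'‖ :=
          (norm_sub_le _ _).trans (by gcongr; exact norm_add_le _ _)
      _ < ε := by nlinarith [norm_nonneg (k - k')]
  refine hcl.closure_subset_iff.2 ?_ (Lp.dense_hasCompactSupport_contDiff (μ := μ) (F := ℂ) (p :=
      2) (by simp) k)
  rintro k ⟨g, hkg, hgc, hgs⟩
  have hg := hgs.continuous
  obtain ⟨D, b, hD, hD2, hDb⟩ := hdom g hg hgc
  have hgm : Measurable g := hg.measurable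
  -- by Jensen's inequality and dominated convergence
  have hlim : Tendsto (fun t => ∫⁻ p : E × ℝ, ‖g (ρ t p.1 p.2) - g p.1‖ₑ ^ 2 ∂(μ.prod stdGauss))
      (𝓝[>] 0) (𝓝 0) := by
    have := tendsto_lintegral_filter_of_dominated_convergence (μ := μ.prod stdGauss) (l := 𝓝[>] (0
        : ℝ))
      (F := fun t p => ‖g (ρ t p.1 p.2) - g p.1‖ₑ ^ 2) (f := fun _ => 0)
      (fun p => 2 * (‖D p.1‖ₑ ^ 2 * ENNReal.ofReal (Real.exp (2 * b * |p.2|)) + ‖g p.1‖ₑ ^ 2)) ?_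
          ?_ ?_ ?_
    · simpa using this
    · filter_upwards [Ioc_mem_nhdsGT zero_lt_one] with t ht
      have := (h t ht).meas_subst
      fun_prop
    · filter_upwards [Ioc_mem_nhdsGT zero_lt_one] with t ht
      have h1 : ∀ᵐ p : E × ℝ ∂(μ.prod stdGauss), ∀ ζ, ‖g (ρ t p.1 ζ)‖ ≤ D p.1 * Real.exp (b * |ζ|)
          :=
        Measure.quasiMeasurePreserving_fst.ae (hDb t ht)
      filter_upwards [h1] with p hp
      have hp := hp p.2
      have e1 : ‖g (ρ t p.1 p.2) - g p.1‖ ^ 2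
          ≤ 2 * ((‖D p.1‖ * Real.exp (b * |p.2|)) ^ 2 + ‖g p.1‖ ^ 2) := by
        have h2 : ‖g (ρ t p.1 p.2)‖ ≤ ‖D p.1‖ * Real.exp (b * |p.2|) :=
          hp.trans (by gcongr; exact le_abs_self _)
        have h3 := norm_sub_le (g (ρ t p.1 p.2)) (g p.1)
        have h4 := norm_nonneg (g (ρ t p.1 p.2) - g p.1)
        have h5 := norm_nonneg (g p.1)
        nlinarith [sq_nonneg (‖D p.1‖ * Real.exp (b * |p.2|) - ‖g p.1‖)]
      have e2 : Real.exp (2 * b * |p.2|) = Real.exp (b * |p.2|) ^ 2 := by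
        rw [← Real.exp_nat_mul]; congr 1; push_cast; ring
      rw [e2, ← ofReal_norm, ← ofReal_norm, ← ofReal_norm (g p.1), ← ENNReal.ofReal_pow
          (norm_nonneg _),
        ← ENNReal.ofReal_pow (norm_nonneg _), ← ENNReal.ofReal_pow (norm_nonneg _),
        ← ENNReal.ofReal_mul (by positivity), ← ENNReal.ofReal_add (by positivity) (by positivity),
        show (2 : ℝ≥0∞) = ENNReal.ofReal 2 by simp, ← ENNReal.ofReal_mul (by positivity)]
      refine ENNReal.ofReal_le_ofReal (e1.trans_eq ?_)
      ring
    · rw [lintegral_const_mul _ (by fun_prop), lintegral_add_left (by fun_prop)]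
      refine (ENNReal.mul_lt_top (by simp) (ENNReal.add_lt_top.2 ⟨?_, ?_⟩)).ne
      · rw [lintegral_prod_mul (f := fun q => ‖D q‖ₑ ^ 2)
          (g := fun ζ => ENNReal.ofReal (Real.exp (2 * b * |ζ|))) (by fun_prop) (by fun_prop),
          lintegral_exp_abs_stdGauss]
        exact ENNReal.mul_lt_top hD2 (by simp)
      · have hg2 : MemLp g 2 μ := hg.memLp_of_hasCompactSupport hgc
        have := lintegral_prod (μ := μ) (ν := stdGauss) (fun p : E × ℝ => ‖g p.1‖ₑ ^ 2)
          (by fun_prop)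
        rw [this]
        simpa using (memLp_two_iff hg2.1).1 hg2
    · refine Eventually.of_forall fun p => ?_
      have h1 := ((hg.tendsto p.1).comp (hρ p.1 p.2)).sub_const (g p.1)
      rw [sub_self] at h1
      have h2 := (ENNReal.continuous_pow 2).tendsto _ |>.comp h1.enorm
      simpa [Function.comp_def] using h2
  rw [mem_ofPred_eq, tendsto_iff_edist_tendsto_0]
  have hsq : Tendsto (fun t => edist (T t k) k ^ 2) (𝓝[>] 0) (𝓝 0) := by
    refine tendsto_of_tendsto_of_tendsto_of_le_of_le' tendsto_const_nhds hlim
      (Eventually.of_forall fun _ => zero_le) ?_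
    filter_upwards [Ioc_mem_nhdsGT zero_lt_one] with t ht
    rw [Lp.edist_def, eLpNorm_two_sq]
    have hm : Measurable fun p : E × ℝ => ρ t p.1 p.2 := (h t ht).meas_subst
    rw [lintegral_prod _ (by fun_prop)]
    refine lintegral_mono_ae ?_
    have hgL : MemLp g 2 μ := hg.memLp_of_hasCompactSupport hgc
    filter_upwards [(hT t ht k).trans ((h t ht).superpose_congr hkg), hkg,
      (h t ht).ae_integrable hg.stronglyMeasurable hgL] with q h1 h2 h3
    rw [Pi.sub_apply, h1, h2]
    have h3 : Integrable (fun ζ => g (ρ t q ζ)) stdGauss := by simpa using h3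
    have e : superpose (ρ t) (fun _ _ => 1) g q - g q = ∫ ζ, (g (ρ t q ζ) - g q) ∂stdGauss := by
      rw [integral_sub h3 (integrable_const _)]
      simp [superpose]
    rw [e]
    have hm1 : Measurable fun ζ => g (ρ t q ζ) - g q :=
      (hgm.comp (hm.comp measurable_prodMk_left)).sub_const _
    calc _ ≤ (∫⁻ ζ, ‖g (ρ t q ζ) - g q‖ₑ ∂stdGauss) ^ 2 := by
          gcongr; exact enorm_integral_le_lintegral_enorm _
      _ ≤ (eLpNorm (fun ζ => g (ρ t q ζ) - g q) 2 stdGauss) ^ 2 := by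
          gcongr
          rw [← eLpNorm_one_eq_lintegral_enorm]
          exact eLpNorm_le_eLpNorm_of_exponent_le one_le_two hm1.aestronglyMeasurable
      _ = _ := eLpNorm_two_sq _ _
  have := (ENNReal.continuous_rpow_const (y := 1 / 2)).tendsto 0 |>.comp hsq
  rw [ENNReal.zero_rpow_of_pos (by norm_num)] at this
  refine this.congr fun t => ?_
  rw [Function.comp, ← ENNReal.rpow_natCast, ← ENNReal.rpow_mul]
  norm_num

variable {E : Type*} [NormedAddCommGroup E] [NormedSpace ℝ E] [MeasureSpace E] [BorelSpace E]
  [SecondCountableTopology E] [LocallyCompactSpace E] [IsLocallyFiniteMeasure (volume : Measure E)]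
  [SFinite (volume : Measure E)]
  {Ω : Set E} {μ : Measure E}

/-- The weak evolution equation: if the pairings of `S t k` with the test functions `φ` and `φL`
are pairings of `k` with functions `Ψ t` and `ΨL t` such that `∂ₜ Ψ = ΨL`, then
`⟨S t k, φ⟩ - ⟨k, φ⟩ = ∫₀ᵗ ⟨S s k, φL⟩ ds`. -/
theorem weak_evolution {S : ℝ → Lp ℂ 2 μ →L[ℂ] Lp ℂ 2 μ} {φ φL : E → ℝ} {Ψ ΨL : ℝ → E → ℝ}
    {k : Lp ℂ 2 μ} {t : ℝ} (ht : 0 ≤ t)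
    (h1 : ∀ s ∈ Icc 0 t, ∫ p in Ω, φ p • S s k p = ∫ p in Ω, Ψ s p • k p)
    (h2 : ∀ s ∈ Icc 0 t, ∫ p in Ω, φL p • S s k p = ∫ p in Ω, ΨL s p • k p)
    (hint : ∀ s ∈ Icc 0 t, Integrable (fun p => Ψ s p • k p) (volume.restrict Ω))
    (hΨ : ∀ p, Ψ t p - Ψ 0 p = ∫ s in (0 : ℝ)..t, ΨL s p)
    (hm : Measurable fun q : E × ℝ => ΨL q.2 q.1) {G : E → ℝ}
    (hG : Integrable (fun p => G p • k p) (volume.restrict Ω))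
    (hΨG : ∀ᵐ p ∂(volume.restrict Ω), ∀ s ∈ Icc 0 t, |ΨL s p| ≤ G p) :
    (∫ p in Ω, φ p • S t k p) - ∫ p in Ω, φ p • S 0 k p
      = ∫ s in (0 : ℝ)..t, ∫ p in Ω, φL p • S s k p := by
  rw [h1 t ⟨ht, le_rfl⟩, h1 0 ⟨le_rfl, ht⟩, ← integral_sub (hint t ⟨ht, le_rfl⟩) (hint 0 ⟨le_rfl,
      ht⟩)]
  have e1 : ∫ s in (0 : ℝ)..t, ∫ p in Ω, φL p • S s k p
      = ∫ s in (0 : ℝ)..t, ∫ p in Ω, ΨL s p • k p :=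
    intervalIntegral.integral_congr fun s hs => by
      rw [uIcc_of_le ht] at hs
      exact h2 s hs
  rw [e1, intervalIntegral.integral_of_le ht]
  have hk : AEStronglyMeasurable k (volume.restrict Ω) := (Lp.stronglyMeasurable
      k).aestronglyMeasurable
  have hI : Integrable (fun q : E × ℝ => ΨL q.2 q.1 • k q.1)
      ((volume.restrict Ω).prod (volume.restrict (Ioc 0 t))) := by
    have hb : Integrable (fun q : E × ℝ => ‖G q.1 • k q.1‖ * 1)
        ((volume.restrict Ω).prod (volume.restrict (Ioc 0 t))) :=
      hG.norm.mul_prod (integrable_const (1 : ℝ))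
    refine hb.mono' (hm.aestronglyMeasurable.smul
      ((Lp.stronglyMeasurable k).comp_measurable measurable_fst).aestronglyMeasurable) ?_
    have a1 : ∀ᵐ q : E × ℝ ∂((volume.restrict Ω).prod (volume.restrict (Ioc 0 t))),
        ∀ s ∈ Icc 0 t, |ΨL s q.1| ≤ G q.1 := Measure.quasiMeasurePreserving_fst.ae hΨG
    have a2 : ∀ᵐ q : E × ℝ ∂((volume.restrict Ω).prod (volume.restrict (Ioc 0 t))),
        q.2 ∈ Ioc 0 t := Measure.quasiMeasurePreserving_snd.ae (ae_restrict_mem measurableSet_Ioc)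
    filter_upwards [a1, a2] with q hq1 hq2
    rw [mul_one, norm_smul, norm_smul]
    gcongr
    exact (hq1 q.2 (Ioc_subset_Icc_self hq2)).trans (le_abs_self _)
  rw [← integral_integral_swap hI]
  refine integral_congr_ae (Eventually.of_forall fun p => ?_)
  simp only
  rw [← sub_smul, hΨ p, intervalIntegral.integral_of_le ht, integral_smul_const]

/-- The value of an average along two curves of an evolution: with `c' = V(c)`, `d' = W(c)`,
the function `Ψ(t) = e^{mt} ∫ φ(c(t), y + d(t) + √(2d(t)) ζ) dγ(ζ)` has the derivative that
one obtains by replacing `φ` with `m φ + V ∂_σ φ + W (∂ₓ φ + ∂ₓ² φ)`. The term `∂ₓ² φ`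
stems from Stein's identity. -/
theorem gaussian_evolution {φ φs φx φxx : ℝ × ℝ → ℝ} {B : ℝ}
    (hs : ∀ p, HasFDerivAt φ
      (φs p • ContinuousLinearMap.fst ℝ ℝ ℝ + φx p • ContinuousLinearMap.snd ℝ ℝ ℝ) p)
    (hx : ∀ p : ℝ × ℝ, HasDerivAt (fun y => φx (p.1, y)) (φxx p) p.2)
    (hcs : Continuous φs) (hcx : Continuous φx) (hcxx : Continuous φxx)
    (hB : ∀ p, |φ p| ≤ B) (hBs : ∀ p, |φs p| ≤ B) (hBx : ∀ p, |φx p| ≤ B) (hBxx : ∀ p, |φxx p| ≤ B)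
    {c d V W : ℝ → ℝ} (hV : Continuous V) (hW : Continuous W)
    (hc : ∀ t, HasDerivAt c (V (c t)) t) (hd : ∀ t, HasDerivAt d (W (c t)) t)
    (hdpos : ∀ t, 0 < t → 0 < d t) (m y : ℝ) {t : ℝ} (ht : 0 ≤ t) :
    Real.exp (m * t) * ∫ ζ, φ (c t, y + d t + √(2 * d t) * ζ) ∂stdGauss
      - ∫ ζ, φ (c 0, y + d 0 + √(2 * d 0) * ζ) ∂stdGauss
    = ∫ s in (0 : ℝ)..t, Real.exp (m * s) * ∫ ζ, (fun p : ℝ × ℝ =>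
        m * φ p + V p.1 * φs p + W p.1 * (φx p + φxx p))
          (c s, y + d s + √(2 * d s) * ζ) ∂stdGauss := by
  have hB0 : 0 ≤ B := (abs_nonneg _).trans (hB 0)
  have hφ : Continuous φ := continuous_iff_continuousAt.2 fun p => (hs p).continuousAt
  have hcc : Continuous c := continuous_iff_continuousAt.2 fun p => (hc p).continuousAt
  have hdc : Continuous d := continuous_iff_continuousAt.2 fun p => (hd p).continuousAt
  -- averages of bounded continuous functions along the curves are continuous
  have hcont : ∀ {f : ℝ × ℝ → ℝ}, Continuous f → (∀ p, |f p| ≤ B) →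
      Continuous fun s => ∫ ζ, f (c s, y + d s + √(2 * d s) * ζ) ∂stdGauss := by
    intro f hf hfB
    refine continuous_of_dominated (bound := fun _ => B) (fun s => ?_) (fun s => ?_)
      (integrable_const B) ?_
    · exact (by fun_prop : Continuous _).aestronglyMeasurable
    · exact Eventually.of_forall fun ζ => hfB _
    · exact Eventually.of_forall fun ζ => by fun_prop
  have hInt : ∀ {f : ℝ × ℝ → ℝ}, Continuous f → (∀ p, |f p| ≤ B) → ∀ s,
      Integrable (fun ζ => f (c s, y + d s + √(2 * d s) * ζ)) stdGauss := by
    intro f hf hfB s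
    exact Integrable.of_bound (by fun_prop : Continuous _).aestronglyMeasurable B
      (Eventually.of_forall fun ζ => hfB _)
  have hΨL : ∀ s, ∫ ζ, (fun p : ℝ × ℝ => m * φ p + V p.1 * φs p + W p.1 * (φx p + φxx p))
          (c s, y + d s + √(2 * d s) * ζ) ∂stdGauss
      = m * ∫ ζ, φ (c s, y + d s + √(2 * d s) * ζ) ∂stdGauss
        + V (c s) * ∫ ζ, φs (c s, y + d s + √(2 * d s) * ζ) ∂stdGauss
        + W (c s) * (∫ ζ, φx (c s, y + d s + √(2 * d s) * ζ) ∂stdGauss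
          + ∫ ζ, φxx (c s, y + d s + √(2 * d s) * ζ) ∂stdGauss) := by
    intro s
    have e1 := integral_add (((hInt hφ hB s).const_mul m).add ((hInt hcs hBs s).const_mul (V (c
        s))))
      (((hInt hcx hBx s).add (hInt hcxx hBxx s)).const_mul (W (c s)))
    simp only [Pi.add_apply] at e1
    simp only
    rw [e1, integral_add ((hInt hφ hB s).const_mul _) ((hInt hcs hBs s).const_mul _),
      integral_const_mul, integral_const_mul, integral_const_mul,
      integral_add (hInt hcx hBx s) (hInt hcxx hBxx s)]
  simp only [hΨL]
  have key : ∀ s, 0 < s → HasDerivAt (fun s => ∫ ζ, φ (c s, y + d s + √(2 * d s) * ζ) ∂stdGauss)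
      (V (c s) * ∫ ζ, φs (c s, y + d s + √(2 * d s) * ζ) ∂stdGauss
        + W (c s) * (∫ ζ, φx (c s, y + d s + √(2 * d s) * ζ) ∂stdGauss
          + ∫ ζ, φxx (c s, y + d s + √(2 * d s) * ζ) ∂stdGauss)) s := by
    intro s hs0
    -- the speed of `√(2d)`
    set D : ℝ → ℝ := fun r => W (c r) / √(2 * d r) with hD
    set F' : ℝ → ℝ → ℝ := fun r ζ => V (c r) * φs (c r, y + d r + √(2 * d r) * ζ)
      + (W (c r) + D r * ζ) * φx (c r, y + d r + √(2 * d r) * ζ) with hF'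
    have hDc : ContinuousOn D (Icc (s / 2) (2 * s)) := by
      refine ContinuousOn.div (by fun_prop) (by fun_prop) fun r hr => ?_
      exact (Real.sqrt_pos.2 (by have := hdpos r (by linarith [hr.1]); linarith)).ne'
    obtain ⟨M1, hM1⟩ := isCompact_Icc.exists_bound_of_continuousOn hDc
    obtain ⟨M2, hM2⟩ := (isCompact_Icc (a := s / 2) (b := 2 * s)).exists_bound_of_continuousOn
      (hV.comp hcc).continuousOn
    obtain ⟨M3, hM3⟩ := (isCompact_Icc (a := s / 2) (b := 2 * s)).exists_bound_of_continuousOn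
      (hW.comp hcc).continuousOn
    have hsI : s ∈ Icc (s / 2) (2 * s) := ⟨by linarith, by linarith⟩
    have hM10 : 0 ≤ M1 := (norm_nonneg _).trans (hM1 s hsI)
    have hid : Integrable (fun ζ : ℝ => ζ) stdGauss :=
      memLp_one_iff_integrable.1 (ProbabilityTheory.memLp_id_gaussianReal (μ := 0) (v := 1) 1)
    have hd' := hasDerivAt_integral_of_dominated_loc_of_deriv_le (μ := stdGauss)
      (F := fun r ζ => φ (c r, y + d r + √(2 * d r) * ζ)) (F' := F') (x₀ := s)
      (s := Icc (s / 2) (2 * s)) (bound := fun ζ => M2 * B + (M3 + M1 * |ζ|) * B)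
      (Icc_mem_nhds (by linarith) (by linarith))
      (Eventually.of_forall fun r => (by fun_prop : Continuous _).aestronglyMeasurable)
      (hInt hφ hB s)
      (by exact (by fun_prop : Continuous _).aestronglyMeasurable)
      (Eventually.of_forall fun ζ r hr => ?_)
      (by exact (integrable_const _).add (((integrable_const _).add (hid.abs.const_mul
          _)).mul_const _))
      (Eventually.of_forall fun ζ r hr => ?_)
    · refine hd'.2.congr_deriv ?_
      simp only [hF']
      have i1 : Integrable (fun ζ => ζ * φx (c s, y + d s + √(2 * d s) * ζ)) stdGauss := by
        have := hid.bdd_mul (c := B) (f := fun ζ => φx (c s, y + d s + √(2 * d s) * ζ))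
          (by fun_prop : Continuous _).aestronglyMeasurable (Eventually.of_forall fun ζ => hBx _)
        simpa [mul_comm] using this
      have e1 : ∀ ζ, (W (c s) + D s * ζ) * φx (c s, y + d s + √(2 * d s) * ζ)
          = W (c s) * φx (c s, y + d s + √(2 * d s) * ζ)
            + D s * (ζ * φx (c s, y + d s + √(2 * d s) * ζ)) := fun ζ => by ring
      simp only [e1]
      have e2 := integral_add ((hInt hcs hBs s).const_mul (V (c s)))
        (((hInt hcx hBx s).const_mul (W (c s))).add (i1.const_mul (D s)))
      simp only [Pi.add_apply] at e2
      rw [e2, integral_add ((hInt hcx hBx s).const_mul _) (i1.const_mul _), integral_const_mul,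
        integral_const_mul, integral_const_mul]
      have hpos : 0 < √(2 * d s) := Real.sqrt_pos.2 (by have := hdpos s hs0; linarith)
      -- Stein's identity cancels the singular factor `1 / √(2d)` of the speed
      have stein := integral_mul_stdGauss (F := fun ζ => φx (c s, y + d s + √(2 * d s) * ζ))
        (F' := fun ζ => √(2 * d s) * φxx (c s, y + d s + √(2 * d s) * ζ))
        (B := (1 + √(2 * d s)) * B) (fun ζ => by
          have h2 : HasDerivAt (fun ζ : ℝ => y + d s + √(2 * d s) * ζ) (√(2 * d s)) ζ := by
            simpa using ((hasDerivAt_id ζ).const_mul (√(2 * d s))).const_add (y + d s)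
          have h1 := HasDerivAt.comp (h₂ := fun y => φx (c s, y)) ζ
            (hx (c s, y + d s + √(2 * d s) * ζ)) h2
          exact HasDerivAt.congr_deriv h1 (mul_comm _ _)) (by fun_prop)
        (fun ζ => (hBx _).trans (by nlinarith)) (fun ζ => by
          rw [abs_mul, abs_of_pos hpos]
          nlinarith [hBxx (c s, y + d s + √(2 * d s) * ζ)])
      rw [stein, integral_const_mul]
      have hDs : D s * √(2 * d s) = W (c s) := by
        simp only [hD]; field_simp
      rw [← mul_assoc (D s), hDs]
      ring
    · simp only [hF']
      refine (norm_add_le _ _).trans (add_le_add ?_ ?_)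
      · rw [norm_mul]
        exact mul_le_mul (hM2 r hr) (hBs _) (norm_nonneg _) ((norm_nonneg _).trans (hM2 r hr))
      · rw [norm_mul]
        refine mul_le_mul ((norm_add_le _ _).trans (add_le_add (hM3 r hr) ?_)) (hBx _)
          (norm_nonneg _) (by have := (norm_nonneg _).trans (hM3 r hr); positivity)
        rw [norm_mul]
        exact mul_le_mul_of_nonneg_right (hM1 r hr) (norm_nonneg _)
    · have hr0 : 0 < d r := hdpos r (by linarith [hr.1])
      have h1 : HasDerivAt (fun r => y + d r + √(2 * d r) * ζ) (W (c r) + D r * ζ) r := by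
        have h2 := (((hd r).const_mul 2).sqrt (by linarith)).mul_const ζ
        refine (((hd r).const_add y).add h2).congr_deriv ?_
        have hne : √(2 * d r) ≠ 0 := (Real.sqrt_pos.2 (by linarith)).ne'
        simp only [hD]
        field_simp
      have h3 := (hs (c r, y + d r + √(2 * d r) * ζ)).comp_hasDerivAt r ((hc r).prodMk h1)
      refine h3.congr_deriv ?_
      simp [hF']
      ring
  have hexp : ∀ s, HasDerivAt (fun s => Real.exp (m * s)) (Real.exp (m * s) * m) s := fun s => by
    simpa using ((hasDerivAt_id s).const_mul m).exp
  have c1 := hcont hφ hB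
  have c2 := hcont hcs hBs
  have c3 := hcont hcx hBx
  have c4 := hcont hcxx hBxx
  rw [intervalIntegral.integral_eq_sub_of_hasDerivAt_of_le
    (f := fun s => Real.exp (m * s) * ∫ ζ, φ (c s, y + d s + √(2 * d s) * ζ) ∂stdGauss) ht]
  · simp
  · exact Continuous.continuousOn (by fun_prop)
  · intro s hs
    refine ((hexp s).mul (key s hs.1)).congr_deriv ?_
    ring
  · exact Continuous.intervalIntegrable (by fun_prop) _ _

end Evolution

/-! ### The heat semigroup with drift on the weighted line -/

section Line

/-- A function vanishing for `|z| > R` and bounded by `B` is, at `z = x + s`, bounded by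
`B e^{b(R + |s|)} e^{-b|x|}`. -/
theorem norm_le_mul_exp_of_ne_zero {V : Type*} [NormedAddCommGroup V] {v : V} {B R b x s : ℝ}
    (hb : 0 ≤ b) (hv : ‖v‖ ≤ B) (hR : v ≠ 0 → |x + s| ≤ R) :
    ‖v‖ ≤ B * Real.exp (b * (R + |s|)) * Real.exp (-b * |x|) := by
  have hB : 0 ≤ B := (norm_nonneg _).trans hv
  by_cases h : v = 0
  · rw [h, norm_zero]; positivity
  · have h1 := hR h
    have h2 : |x| ≤ R + |s| := by
      have := abs_sub (x + s) s
      rw [add_sub_cancel_right] at this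
      linarith
    rw [mul_assoc, ← Real.exp_add]
    refine hv.trans (le_mul_of_one_le_right hB (Real.one_le_exp ?_))
    nlinarith

theorem HasCompactSupport.exists_radius {E V : Type*} [NormedAddCommGroup E]
    [NormedAddCommGroup V] {g : E → V} (hg : HasCompactSupport g) :
    ∃ R : ℝ, ∀ z, g z ≠ 0 → ‖z‖ ≤ R := by
  obtain ⟨R, hR⟩ := hg.isBounded.exists_norm_le
  exact ⟨R, fun z hz => hR z (subset_tsupport g hz)⟩

/-- The substitution `x ↦ x - t - √(2t) ζ`; its Gaussian average is `e^{tB}`. -/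
noncomputable def lineSubst (t x ζ : ℝ) : ℝ := x - (t + √(2 * t) * ζ)

theorem abs_shift_le {t T : ℝ} (ht : t ≤ T) (ht0 : 0 ≤ t) (ζ : ℝ) :
    |t + √(2 * t) * ζ| ≤ T + √(2 * T) * |ζ| := by
  refine (abs_add_le _ _).trans ?_
  rw [abs_mul, abs_of_nonneg ht0, abs_of_nonneg (Real.sqrt_nonneg _)]
  gcongr

theorem isSuperposition_lineSubst (lam : ℝ) {t T : ℝ} (ht0 : 0 ≤ t) (ht : t ≤ T) :
    IsSuperposition (weightMeasure lam) (lineSubst t) (fun _ _ => 1)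
      (Real.exp (2 * |lam| * T)) (2 * |lam| * √(2 * T)) where
  nonneg := (Real.exp_nonneg _)
  meas_subst := by unfold lineSubst; fun_prop
  meas_weight := measurable_const
  bound := fun ζ F hF => by
    simp only [enorm_one, one_pow, one_mul, lineSubst]
    refine (lintegral_weightMeasure_sub_le lam _ hF).trans ?_
    gcongr
    rw [← Real.exp_add]
    refine Real.exp_le_exp.2 ?_
    have := mul_le_mul_of_nonneg_left (abs_shift_le ht ht0 ζ) (abs_nonneg lam)
    linarith

/-- The heat semigroup with drift, `e^{tB} g(x) = ∫ g(x - t - √(2t) ζ) dγ(ζ)`; the value `0` for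
`t < 0` is immaterial. -/
noncomputable def heat (lam t : ℝ) : L2Line lam →L[ℂ] L2Line lam :=
  if h : 0 ≤ t then (isSuperposition_lineSubst lam h le_rfl).toCLM else 0

variable {lam : ℝ}

theorem heat_eq_toCLM {t : ℝ} (ht : 0 ≤ t) :
    heat lam t = (isSuperposition_lineSubst lam ht le_rfl).toCLM := dif_pos ht

theorem coeFn_heat {t : ℝ} (ht : 0 ≤ t) (k : L2Line lam) :
    heat lam t k =ᵐ[weightMeasure lam] superpose (lineSubst t) (fun _ _ => 1) k := by
  rw [heat_eq_toCLM ht]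
  exact IsSuperposition.coeFn_toCLM _ k

theorem heat_add {s t : ℝ} (hs : 0 ≤ s) (ht : 0 ≤ t) :
    heat lam (s + t) = (heat lam s).comp (heat lam t) := by
  refine ContinuousLinearMap.ext fun k => Lp.ext ?_
  have hk := Lp.stronglyMeasurable k
  have h1 := isSuperposition_lineSubst lam hs le_rfl
  have h3 := isSuperposition_lineSubst lam (add_nonneg hs ht) le_rfl
  refine (coeFn_heat (add_nonneg hs ht) k).trans ?_
  refine EventuallyEq.trans ?_ (coeFn_heat hs (heat lam t k)).symm
  refine EventuallyEq.trans ?_ (h1.superpose_congr (coeFn_heat ht k)).symm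
  filter_upwards [h3.ae_integrable hk (Lp.memLp k)] with x hx
  have hab : √(2 * s) ^ 2 + √(2 * t) ^ 2 = √(2 * (s + t)) ^ 2 := by
    rw [Real.sq_sqrt (by positivity), Real.sq_sqrt (by positivity), Real.sq_sqrt (by positivity)]
    ring
  have := integral_integral_stdGauss hab (F := fun u => k (x - (s + t) - u))
    (hk.comp_measurable (by fun_prop)) (by simpa [lineSubst, sub_sub] using hx)
  simp only [superpose, lineSubst, one_smul]
  simp only [sub_sub] at this ⊢
  rw [← this]
  congr 1; ext ζ; congr 1; ext ζ'
  congr 1; ring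

theorem heat_zero : heat lam 0 = ContinuousLinearMap.id ℂ _ := by
  refine ContinuousLinearMap.ext fun k => Lp.ext ((coeFn_heat le_rfl k).trans ?_)
  refine Eventually.of_forall fun x => ?_
  simp [superpose, lineSubst]

theorem isC0Semigroup_heat : IsC0Semigroup (heat lam) where
  add := fun _ _ hs ht => heat_add hs ht
  zero := heat_zero
  tendsto := by
    refine IsSuperposition.tendsto_id (ρ := lineSubst)
      (fun t ht => isSuperposition_lineSubst lam ht.1.le ht.2) (fun t ht k => coeFn_heat ht.1.le k)
      (fun x ζ => ?_) (fun g hg hgc => ?_)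
    · have : Continuous fun t => lineSubst t x ζ := by unfold lineSubst; fun_prop
      have h := this.tendsto 0
      simp only [lineSubst, mul_zero, Real.sqrt_zero, zero_mul, add_zero, sub_zero] at h
      exact h.mono_left nhdsWithin_le_nhds
    · obtain ⟨R, hR⟩ := hgc.exists_radius
      obtain ⟨B, hB⟩ := hg.bounded_above_of_compact_support hgc
      have hB0 : 0 ≤ B := (norm_nonneg _).trans (hB 0)
      set b := |lam| + 1 with hb
      have hb0 : 0 ≤ b := by positivity
      refine ⟨fun x => B * Real.exp (b * (R + 1)) * Real.exp (-b * |x|), b * √(2 * 1), by fun_prop,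
        ?_, fun t ht => Eventually.of_forall fun x ζ => ?_⟩
      · have e : ∀ x : ℝ, ‖B * Real.exp (b * (R + 1)) * Real.exp (-b * |x|)‖ₑ ^ 2
            = ENNReal.ofReal ((B * Real.exp (b * (R + 1))) ^ 2)
              * ENNReal.ofReal (Real.exp (-2 * b * |x|)) := fun x => by
          rw [← ofReal_norm, Real.norm_of_nonneg (by positivity), ← ENNReal.ofReal_pow (by
              positivity),
            ← ENNReal.ofReal_mul (by positivity), mul_pow, ← Real.exp_nat_mul]
          congr 3; push_cast; ring
        simp only [e]
        rw [lintegral_const_mul _ (by fun_prop)]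
        exact ENNReal.mul_lt_top (by simp) (lintegral_exp_weightMeasure_lt_top lam)
      · have h1 := norm_le_mul_exp_of_ne_zero (s := -(t + √(2 * t) * ζ)) (x := x) hb0
          (hB (lineSubst t x ζ)) (fun h => hR _ h)
        refine h1.trans ?_
        rw [abs_neg]
        have h2 := mul_le_mul_of_nonneg_left (abs_shift_le ht.2 ht.1.le ζ) hb0
        calc _ ≤ B * Real.exp (b * (R + 1) + b * √(2 * 1) * |ζ|) * Real.exp (-b * |x|) := by
              gcongr
              linarith
          _ = _ := by rw [Real.exp_add]; ring

/-- Change of variables for a fixed `ζ`. -/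
theorem integral_smul_lineSubst (φ : ℝ → ℝ) (k : ℝ → ℂ) (t ζ : ℝ) :
    ∫ x, φ x • k (lineSubst t x ζ) = ∫ y, φ (y + (t + √(2 * t) * ζ)) • k y := by
  rw [← integral_sub_right_eq_self (fun y => φ (y + (t + √(2 * t) * ζ)) • k y) (t + √(2 * t) * ζ)]
  simp [lineSubst]

theorem hasWeakDeriv_heat {t : ℝ} (ht : 0 ≤ t) {k k' : L2Line lam}
    (h : HasWeakDeriv univ (1 : ℝ) k k') :
    HasWeakDeriv univ (1 : ℝ) (heat lam t k) (heat lam t k') := by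
  have hμ := isWeightedDomain_line lam
  refine hμ.hasWeakDeriv_of_forall fun φ hφ => ?_
  rw [heat_eq_toCLM ht, hμ.integral_test_toCLM _ (hφ.fderiv_apply 1), hμ.integral_test_toCLM _ hφ,
    ← integral_neg]
  congr 1; ext ζ
  simp only [one_smul, Measure.restrict_univ]
  rw [integral_smul_lineSubst (fun p => fderiv ℝ φ p 1), integral_smul_lineSubst]
  have hc : IsTestFun univ (fun y => φ (y + (t + √(2 * t) * ζ))) :=
    ⟨hφ.smooth.comp (contDiff_id.add contDiff_const),
      hφ.compact.comp_homeomorph (Homeomorph.addRight (t + √(2 * t) * ζ)), subset_univ _⟩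
  have := h.integral_eq hc
  simp only [Measure.restrict_univ] at this
  rw [← this]
  congr 1; ext y
  rw [fderiv_comp_add_right]

/-- The average of a test function that represents the dual of `heat`. -/
noncomputable def lineDual (φ : ℝ → ℝ) (t y : ℝ) : ℝ :=
  ∫ ζ, φ (y + (t + √(2 * t) * ζ)) ∂stdGauss

theorem lineDual_bound {φ : ℝ → ℝ} (hφ : IsTestFun univ φ) {b : ℝ} (hb : 0 ≤ b) (T : ℝ) :
    ∃ C : ℝ, 0 ≤ C ∧ ∀ t ∈ Icc 0 T, ∀ y ζ : ℝ,
      ‖φ (y + (t + √(2 * t) * ζ))‖ ≤ C * Real.exp (b * √(2 * T) * |ζ|) * Real.exp (-b * |y|) := by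
  obtain ⟨R, hR⟩ := hφ.compact.exists_radius
  obtain ⟨B, hB⟩ := hφ.smooth.continuous.bounded_above_of_compact_support hφ.compact
  have hB0 : 0 ≤ B := (norm_nonneg _).trans (hB 0)
  refine ⟨B * Real.exp (b * (R + T)), by positivity, fun t ht y ζ => ?_⟩
  have h1 := norm_le_mul_exp_of_ne_zero (s := t + √(2 * t) * ζ) (x := y) hb
    (hB (y + (t + √(2 * t) * ζ))) (fun h => hR _ h)
  refine h1.trans ?_
  have h2 := mul_le_mul_of_nonneg_left (abs_shift_le ht.2 ht.1 ζ) hb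
  calc _ ≤ B * Real.exp (b * (R + T) + b * √(2 * T) * |ζ|) * Real.exp (-b * |y|) := by
        gcongr
        linarith
    _ = _ := by rw [Real.exp_add]; ring

theorem integrable_lineDual_kernel {φ : ℝ → ℝ} (hφ : IsTestFun univ φ) {t : ℝ} (ht : 0 ≤ t)
    (k : L2Line lam) : Integrable (fun p : ℝ × ℝ => φ (p.2 + (t + √(2 * t) * p.1)) • k p.2)
      (stdGauss.prod volume) := by
  obtain ⟨C, hC0, hC⟩ := lineDual_bound hφ (b := |lam| + 1) (by positivity) t
  have h1 := ((integrable_exp_abs_stdGauss ((|lam| + 1) * √(2 * t))).const_mul C).mul_prod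
    (integrable_exp_mul_of_memLp lam (Lp.memLp k)).norm
  have hk := Lp.stronglyMeasurable k
  have hφc := hφ.smooth.continuous
  refine h1.mono' ((by fun_prop : Continuous fun p : ℝ × ℝ => φ (p.2 + (t + √(2 * t) * p.1)))
    |>.aestronglyMeasurable.smul (hk.comp_measurable measurable_snd).aestronglyMeasurable)
    (Eventually.of_forall fun p => ?_)
  rw [norm_smul, norm_smul, Real.norm_of_nonneg (Real.exp_nonneg _), ← mul_assoc]
  gcongr
  exact hC t ⟨ht, le_rfl⟩ p.2 p.1

theorem integral_test_heat {φ : ℝ → ℝ} (hφ : IsTestFun univ φ) {t : ℝ} (ht : 0 ≤ t)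
    (k : L2Line lam) : ∫ p in univ, φ p • heat lam t k p = ∫ p in univ, lineDual φ t p • k p := by
  have hμ := isWeightedDomain_line lam
  rw [heat_eq_toCLM ht, hμ.integral_test_toCLM _ hφ]
  simp only [one_smul, Measure.restrict_univ, integral_smul_lineSubst]
  rw [integral_integral_swap (f := fun ζ y => φ (y + (t + √(2 * t) * ζ)) • k y)
    (integrable_lineDual_kernel hφ ht k)]
  congr 1; ext y
  exact integral_smul_const (fun ζ => φ (y + (t + √(2 * t) * ζ))) (k y)

theorem integrable_lineDual_smul {φ : ℝ → ℝ} (hφ : IsTestFun univ φ) {t : ℝ} (ht : 0 ≤ t)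
    (k : L2Line lam) : Integrable (fun p => lineDual φ t p • k p) := by
  refine (integrable_lineDual_kernel hφ ht k).integral_prod_right.congr
    (Eventually.of_forall fun y => ?_)
  exact integral_smul_const (fun ζ => φ (y + (t + √(2 * t) * ζ))) (k y)

/-- The weak form of `∂ₜ u = B u`, tested with `φ`; the adjoint of `B` is `∂ₓ² + ∂ₓ`. -/
theorem heat_weak_evolution {φ : ℝ → ℝ} (hφ : IsTestFun univ φ) {t : ℝ} (ht : 0 ≤ t)
    (k : L2Line lam) :
    (∫ p in univ, φ p • heat lam t k p) - ∫ p in univ, φ p • heat lam 0 k p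
      = ∫ s in (0 : ℝ)..t, ∫ p in univ,
        (fderiv ℝ φ p 1 + fderiv ℝ (fun q => fderiv ℝ φ q 1) p 1) • heat lam s k p := by
  have hx := hφ.fderiv_apply (1 : ℝ)
  have hxx := hx.fderiv_apply (1 : ℝ)
  set φx : ℝ → ℝ := fun q => fderiv ℝ φ q 1 with hφx
  set φxx : ℝ → ℝ := fun q => fderiv ℝ φx q 1 with hφxx
  have hL : IsTestFun univ (fun p => φx p + φxx p) :=
    ⟨hx.smooth.add hxx.smooth, hx.compact.add hxx.compact, subset_univ _⟩
  obtain ⟨C, hC0, hC⟩ := lineDual_bound hL (b := |lam| + 1) (by positivity) t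
  refine weak_evolution (Ψ := lineDual φ) (ΨL := lineDual fun p => φx p + φxx p)
    (G := fun y => C * gaussMoment ((|lam| + 1) * √(2 * t)) * Real.exp (-(|lam| + 1) * |y|)) ht
    (fun s hs => integral_test_heat hφ hs.1 k) (fun s hs => integral_test_heat hL hs.1 k)
    (fun s hs => (integrable_lineDual_smul hφ hs.1 k).integrableOn) (fun y => ?_) ?_ ?_ ?_
  · obtain ⟨B1, hB1⟩ := hφ.smooth.continuous.bounded_above_of_compact_support hφ.compact
    obtain ⟨B2, hB2⟩ := hx.smooth.continuous.bounded_above_of_compact_support hx.compact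
    obtain ⟨B3, hB3⟩ := hxx.smooth.continuous.bounded_above_of_compact_support hxx.compact
    have hB0 : 0 ≤ B1 ∧ 0 ≤ B2 ∧ 0 ≤ B3 := ⟨(norm_nonneg _).trans (hB1 0),
      (norm_nonneg _).trans (hB2 0), (norm_nonneg _).trans (hB3 0)⟩
    have hder : ∀ {ψ : ℝ → ℝ}, IsTestFun univ ψ → ∀ x, HasDerivAt ψ (fderiv ℝ ψ x 1) x :=
      fun hψ x => (hψ.smooth.differentiable (by simp) x).hasDerivAt
    have := gaussian_evolution (φ := fun p => φ p.2) (φs := fun _ => 0) (φx := fun p => φx p.2)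
      (φxx := fun p => φxx p.2) (B := B1 + B2 + B3)
      (fun p => by
        have h1 : HasFDerivAt (fun q : ℝ × ℝ => q.2) (ContinuousLinearMap.snd ℝ ℝ ℝ) p :=
          hasFDerivAt_snd
        have := (hder hφ p.2).comp_hasFDerivAt p h1
        refine this.congr_fderiv ?_
        rw [zero_smul, zero_add])
      (fun p => hder hx p.2) continuous_const (hx.smooth.continuous.comp continuous_snd)
      (hxx.smooth.continuous.comp continuous_snd)
      (fun p => (hB1 p.2).trans (by linarith)) (fun p => by simp; linarith)
      (fun p => (hB2 p.2).trans (by linarith)) (fun p => (hB3 p.2).trans (by linarith))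
      (c := fun _ => 0) (d := fun t => t) (V := fun _ => 0) (W := fun _ => 1)
      continuous_const continuous_const (fun t => hasDerivAt_const _ _) (fun t => hasDerivAt_id t)
      (fun t ht => ht) 0 y ht
    simpa [lineDual, add_assoc] using this
  · have hcx : Continuous φx := hx.smooth.continuous
    have hcxx : Continuous φxx := hxx.smooth.continuous
    have : StronglyMeasurable fun q : (ℝ × ℝ) × ℝ =>
        (fun p => φx p + φxx p) (q.1.1 + (q.1.2 + √(2 * q.1.2) * q.2)) :=
      Continuous.stronglyMeasurable (by fun_prop)
    exact (this.integral_prod_right' (ν := stdGauss)).measurable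
  · have := (integrable_exp_mul_of_memLp lam (Lp.memLp k)).smul
      (C * gaussMoment ((|lam| + 1) * √(2 * t)))
    rw [Measure.restrict_univ]
    refine this.congr (Eventually.of_forall fun y => ?_)
    simp only [Pi.smul_apply, smul_smul]
  · refine Eventually.of_forall fun y s hs => ?_
    have h1 := norm_integral_le_of_norm_le (μ := stdGauss)
      (((integrable_exp_abs_stdGauss ((|lam| + 1) * √(2 * t))).const_mul C).mul_const
        (Real.exp (-(|lam| + 1) * |y|)))
      (Eventually.of_forall fun ζ => hC s hs y ζ)
    rw [integral_mul_const, integral_const_mul] at h1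
    exact h1

theorem memSobolev_two_of_line {f fx fxx : L2Line lam} (h1 : HasWeakDeriv univ (1 : ℝ) f fx)
    (h2 : HasWeakDeriv univ (1 : ℝ) fx fxx) : MemSobolev univ (weightMeasure lam) 2 f := by
  have hμ := isWeightedDomain_line lam
  have key : ∀ {f g : L2Line lam} (v : ℝ), HasWeakDeriv univ (1 : ℝ) f g →
      HasWeakDeriv univ v f (v • g : L2Line lam) := fun v h => by
    simpa using hμ.hasWeakDeriv_comb h h v 0
  intro v
  refine ⟨v • fx, key v h1, fun w => ⟨w • v • fxx, key w (hμ.hasWeakDeriv_smul v h2), trivial⟩⟩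

theorem exists_of_memSobolev_line {f : L2Line lam} (h : MemSobolev univ (weightMeasure lam) 2 f) :
    ∃ η, (f, η) ∈ opB lam := by
  obtain ⟨fx, h1, h2⟩ := h 1
  obtain ⟨fxx, h3, -⟩ := h2 1
  exact ⟨fxx - fx, h, fx, fxx, h1, h3, rfl⟩

/-- The semigroup preserves `H²` on the line and commutes with `B`. -/
theorem opB_invariant {ξ η : L2Line lam} (h : (ξ, η) ∈ opB lam) {t : ℝ} (ht : 0 ≤ t) :
    (heat lam t ξ, heat lam t η) ∈ opB lam := by
  obtain ⟨-, fx, fxx, h1, h2, h3⟩ := h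
  have e1 := hasWeakDeriv_heat ht h1
  have e2 := hasWeakDeriv_heat ht h2
  have h3 : η = fxx - fx := h3
  exact ⟨memSobolev_two_of_line e1 e2, heat lam t fx, heat lam t fxx, e1, e2, by
    change heat lam t η = _
    rw [h3, map_sub]⟩

theorem convex_opB : Convex ℝ (opB lam) := by
  have hμ := isWeightedDomain_line lam
  rintro ⟨ξ, η⟩ ⟨-, fx, fxx, h1, h2, h3⟩ ⟨ξ', η'⟩ ⟨-, fx', fxx', h1', h2', h3'⟩ a b - - -
  have e1 := hμ.hasWeakDeriv_add (hμ.hasWeakDeriv_smul a h1) (hμ.hasWeakDeriv_smul b h1')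
  have e2 := hμ.hasWeakDeriv_add (hμ.hasWeakDeriv_smul a h2) (hμ.hasWeakDeriv_smul b h2')
  refine ⟨memSobolev_two_of_line e1 e2, _, _, e1, e2, ?_⟩
  have h3 : η = fxx - fx := h3
  have h3' : η' = fxx' - fx' := h3'
  change a • η + b • η' = _
  rw [h3, h3', smul_sub, smul_sub]
  abel

theorem heat_sub_eq_integral {ξ η : L2Line lam} (h : (ξ, η) ∈ opB lam) {t : ℝ} (ht : 0 ≤ t) :
    heat lam t ξ - ξ = ∫ s in (0 : ℝ)..t, heat lam s η := by
  have hμ := isWeightedDomain_line lam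
  have hC : IsC0Semigroup (heat lam) := isC0Semigroup_heat
  refine hμ.eq_of_integral_eq fun φ hφ => ?_
  obtain ⟨Λ, hΛ⟩ := hμ.exists_pairing hφ
  rw [← hΛ, ← hΛ, map_sub, ← ContinuousLinearMap.intervalIntegral_comp_comm _
    (hC.intervalIntegrable η ht)]
  have h0 : heat lam 0 ξ = ξ := by rw [heat_zero]; rfl
  have e := heat_weak_evolution hφ ht ξ
  rw [h0, ← hΛ, ← hΛ] at e
  rw [e]
  refine intervalIntegral.integral_congr fun s hs => ?_
  rw [uIcc_of_le ht] at hs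
  obtain ⟨-, fx, fxx, h1, h2, h3⟩ := h
  have h3 : η = fxx - fx := h3
  have hx := hφ.fderiv_apply (1 : ℝ)
  have e1 := (hasWeakDeriv_heat hs.1 h1).integral_eq hφ
  have e2 := (hasWeakDeriv_heat hs.1 h1).integral_eq hx
  have e3 := (hasWeakDeriv_heat hs.1 h2).integral_eq hφ
  simp only [add_smul]
  rw [integral_add (hμ.integrable_smul hx _) (hμ.integrable_smul (hx.fderiv_apply 1) _), e1, e2, e3,
    h3, map_sub, map_sub, hΛ, hΛ]
  ring

/-- `B` generates the heat semigroup with drift. -/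
theorem generates_opB : Generates (opB lam) (heat lam) := by
  refine generates_of_invariant_dense isC0Semigroup_heat convex_opB ?_
    (fun _ _ h _ ht => opB_invariant h ht) (fun _ _ h _ ht => heat_sub_eq_integral h ht)
  exact ((isWeightedDomain_line lam).dense_memSobolev 2).mono fun f hf =>
      exists_of_memSobolev_line hf

end Line

/-! ### The flow and the variance parameter -/

section Flow

/-- The standing assumptions on the parameters; in particular the flow `δ_t`, `t ≥ 0`, contracts
towards the point `θ` of the interval `(α, β)`. -/
structure IsStripParams (κ θ α β : ℝ) : Prop where
  κ_pos : 0 < κ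
  α_pos : 0 < α
  α_lt : α < θ
  lt_β : θ < β

variable {κ θ α β : ℝ}

theorem deltaFlow_eq (κ θ t σ : ℝ) : deltaFlow κ θ t σ = θ - (θ - σ) * Real.exp (-κ * t) := by
  unfold deltaFlow; ring

theorem deltaFlow_zero (σ : ℝ) : deltaFlow κ θ 0 σ = σ := by simp [deltaFlow]

theorem deltaFlow_add (s t σ : ℝ) :
    deltaFlow κ θ (s + t) σ = deltaFlow κ θ t (deltaFlow κ θ s σ) := by
  simp only [deltaFlow_eq, mul_add, Real.exp_add]; ring

theorem deltaFlow_neg_apply (t σ : ℝ) : deltaFlow κ θ (-t) (deltaFlow κ θ t σ) = σ := by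
  rw [← deltaFlow_add, add_neg_cancel, deltaFlow_zero]

theorem deltaFlow_apply_neg (t σ : ℝ) : deltaFlow κ θ t (deltaFlow κ θ (-t) σ) = σ := by
  rw [← deltaFlow_add, neg_add_cancel, deltaFlow_zero]

theorem IsStripParams.deltaFlow_mem (H : IsStripParams κ θ α β) {t σ : ℝ} (ht : 0 ≤ t)
    (hσ : σ ∈ Ioo α β) : deltaFlow κ θ t σ ∈ Ioo α β := by
  have h1 : Real.exp (-κ * t) ≤ 1 := Real.exp_le_one_iff.2 (by nlinarith [H.κ_pos])
  have h2 := Real.exp_pos (-κ * t)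
  have h3 := H.α_lt
  have h4 := H.lt_β
  rw [deltaFlow_eq]
  constructor <;> nlinarith [hσ.1, hσ.2]

theorem hasDerivAt_deltaFlow_time (t σ : ℝ) : HasDerivAt (fun t => deltaFlow κ θ t σ)
    (κ * (θ - deltaFlow κ θ t σ)) t := by
  simp only [deltaFlow_eq]
  have h := (((hasDerivAt_id t).const_mul (-κ)).exp.const_mul (θ - σ)).const_sub θ
  refine h.congr_deriv ?_
  simp only [id]; ring

theorem hasDerivAt_deltaFlow_space (t σ : ℝ) : HasDerivAt (fun σ => deltaFlow κ θ t σ)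
    (Real.exp (-κ * t)) σ := by
  simp only [deltaFlow_eq]
  have h := (((hasDerivAt_id σ).const_sub θ).mul_const (Real.exp (-κ * t))).const_sub θ
  refine h.congr_deriv ?_
  ring

@[fun_prop]
theorem continuous_deltaFlow {Y : Type*} [TopologicalSpace Y] {f g : Y → ℝ} (hf : Continuous f)
    (hg : Continuous g) : Continuous fun y => deltaFlow κ θ (f y) (g y) := by
  unfold deltaFlow; fun_prop

@[fun_prop]
theorem continuous_frakD {Y : Type*} [TopologicalSpace Y] {f g : Y → ℝ} (hf : Continuous f)
    (hg : Continuous g) : Continuous fun y => frakD κ θ (f y) (g y) := by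
  unfold frakD; fun_prop

theorem contDiff_deltaFlow (t : ℝ) : ContDiff ℝ ∞ fun σ => deltaFlow κ θ t σ := by
  unfold deltaFlow; fun_prop

theorem contDiff_frakD (t : ℝ) : ContDiff ℝ ∞ fun σ => frakD κ θ t σ := by
  unfold frakD; fun_prop

theorem frakD_zero (σ : ℝ) : frakD κ θ 0 σ = 0 := by simp [frakD]

theorem hasDerivAt_frakD_time (hκ : κ ≠ 0) (t σ : ℝ) : HasDerivAt (fun t => frakD κ θ t σ)
    (deltaFlow κ θ t σ ^ 2 / 2) t := by
  have h1 : ∀ c : ℝ, HasDerivAt (fun t : ℝ => Real.exp (c * t)) (Real.exp (c * t) * c) t := fun c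
      => by
    simpa using ((hasDerivAt_id t).const_mul c).exp
  have h := (((((h1 (-2 * κ)).const_sub 1).const_mul ((θ - σ) ^ 2 / (4 * κ))).sub
    (((h1 (-κ)).const_sub 1).const_mul (θ * (θ - σ) / κ))).add
    ((hasDerivAt_id t).const_mul (1 / 2 * θ ^ 2)))
  refine h.congr_deriv ?_
  have e : Real.exp (-2 * κ * t) = Real.exp (-κ * t) ^ 2 := by
    rw [← Real.exp_nat_mul]; congr 1; push_cast; ring
  rw [e, deltaFlow_eq]
  field_simp
  ring

/-- The derivative of the variance parameter in `σ`. -/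
noncomputable def frakDs (κ θ t σ : ℝ) : ℝ :=
  θ / κ * (1 - Real.exp (-κ * t)) - (θ - σ) / (2 * κ) * (1 - Real.exp (-2 * κ * t))

theorem contDiff_frakDs (t : ℝ) : ContDiff ℝ ∞ fun σ => frakDs κ θ t σ := by
  unfold frakDs; fun_prop

@[fun_prop]
theorem continuous_frakDs {Y : Type*} [TopologicalSpace Y] {f g : Y → ℝ} (hf : Continuous f)
    (hg : Continuous g) : Continuous fun y => frakDs κ θ (f y) (g y) := by
  unfold frakDs; fun_prop

theorem hasDerivAt_frakD_space (hκ : κ ≠ 0) (t σ : ℝ) :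
    HasDerivAt (fun σ => frakD κ θ t σ) (frakDs κ θ t σ) σ := by
  have h0 := (hasDerivAt_id σ).const_sub θ
  have h := ((((h0.pow 2).div_const (4 * κ)).mul_const (1 - Real.exp (-2 * κ * t))).sub
    (((h0.const_mul θ).div_const κ).mul_const (1 - Real.exp (-κ * t)))).add_const (1 / 2 * θ ^ 2 *
        t)
  refine h.congr_deriv ?_
  simp only [frakDs, id]
  field_simp
  ring

/-- The transport equation `∂ₜ 𝔇 = κ(θ - σ) ∂_σ 𝔇 + σ²/2`. -/
theorem frakD_transport (hκ : κ ≠ 0) (t σ : ℝ) :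
    deltaFlow κ θ t σ ^ 2 / 2 = κ * (θ - σ) * frakDs κ θ t σ + σ ^ 2 / 2 := by
  have e : Real.exp (-2 * κ * t) = Real.exp (-κ * t) ^ 2 := by
    rw [← Real.exp_nat_mul]; congr 1; push_cast; ring
  rw [frakDs, e, deltaFlow_eq]
  field_simp
  ring

/-- The variance parameter is the integrated variance along the flow. -/
theorem frakD_eq_integral (hκ : κ ≠ 0) (t σ : ℝ) :
    frakD κ θ t σ = ∫ s in (0 : ℝ)..t, deltaFlow κ θ s σ ^ 2 / 2 := by
  rw [intervalIntegral.integral_eq_sub_of_hasDerivAt (fun s _ => hasDerivAt_frakD_time hκ s σ)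
    (Continuous.intervalIntegrable (by fun_prop) _ _), frakD_zero, sub_zero]

/-- The cocycle property of the variance parameter. -/
theorem frakD_add (hκ : κ ≠ 0) (s t σ : ℝ) :
    frakD κ θ (s + t) σ = frakD κ θ s σ + frakD κ θ t (deltaFlow κ θ s σ) := by
  have e : ∀ u : ℝ, Real.exp (-2 * κ * u) = Real.exp (-κ * u) ^ 2 := fun u => by
    rw [← Real.exp_nat_mul]; congr 1; push_cast; ring
  simp only [frakD, deltaFlow_eq, e, mul_add, Real.exp_add]
  field_simp
  ring

/-- For `t ≥ 0` the inverse substitution shifts by the variance parameter at the preimage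
`δ_{-t}(σ)`. -/
theorem neg_frakD_neg (hκ : κ ≠ 0) (t σ : ℝ) :
    -frakD κ θ (-t) σ = frakD κ θ t (deltaFlow κ θ (-t) σ) := by
  have := frakD_add (θ := θ) hκ (-t) t σ
  rw [neg_add_cancel, frakD_zero] at this
  linarith

/-- The integrand `δ_s(σ)² / 2` is nonnegative and does not vanish identically, for any real `σ`. -/
theorem frakD_pos (hκ : 0 < κ) (hθ : 0 < θ) {t : ℝ} (ht : 0 < t) (σ : ℝ) : 0 < frakD κ θ t σ := by
  rw [frakD_eq_integral hκ.ne']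
  refine intervalIntegral.integral_pos ht (Continuous.continuousOn (by fun_prop))
    (fun s _ => by positivity) ?_
  -- the flow has at most one zero
  by_cases hσ : σ = 0
  · refine ⟨t, ⟨ht.le, le_rfl⟩, ?_⟩
    have h1 : Real.exp (-κ * t) < 1 := Real.exp_lt_one_iff.2 (by nlinarith)
    have : 0 < deltaFlow κ θ t σ := by rw [deltaFlow_eq, hσ]; nlinarith
    positivity
  · refine ⟨0, ⟨le_rfl, ht.le⟩, ?_⟩
    rw [deltaFlow_zero]
    positivity

theorem frakD_nonneg (hκ : 0 < κ) (hθ : 0 < θ) {t : ℝ} (ht : 0 ≤ t) (σ : ℝ) : 0 ≤ frakD κ θ t σ :=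
    by
  rcases ht.eq_or_lt with rfl | h
  · rw [frakD_zero]
  · exact (frakD_pos hκ hθ h σ).le

theorem IsStripParams.θ_pos (H : IsStripParams κ θ α β) : 0 < θ := H.α_pos.trans H.α_lt

theorem IsStripParams.frakD_le (H : IsStripParams κ θ α β) {t T σ : ℝ} (ht : 0 ≤ t) (htT : t ≤ T)
    (hσ : σ ∈ Ioo α β) : frakD κ θ t σ ≤ β ^ 2 / 2 * T := by
  rw [frakD_eq_integral H.κ_pos.ne']
  have := intervalIntegral.integral_mono_on (μ := volume) (g := fun _ => β ^ 2 / 2) ht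
    (Continuous.intervalIntegrable (by fun_prop) _ _) (Continuous.intervalIntegrable (by fun_prop)
        _ _)
    (fun s hs => by
      have h := H.deltaFlow_mem hs.1 hσ
      have h0 := H.α_pos
      have : deltaFlow κ θ s σ ^ 2 ≤ β ^ 2 := pow_le_pow_left₀ (h0.trans h.1).le h.2.le 2
      linarith : ∀ s ∈ Icc 0 t, deltaFlow κ θ s σ ^ 2 / 2 ≤ β ^ 2 / 2)
  refine this.trans ?_
  rw [intervalIntegral.integral_const, sub_zero, smul_eq_mul, mul_comm]
  gcongr

end Flow

/-! ### The semigroup on the strip -/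

section Strip

variable {κ θ α β lam : ℝ}

/-- The substitution `(σ, x) ↦ (δ_t(σ), x - 𝔇 - √(2𝔇) ζ)`, `𝔇 = 𝔇(t, σ)`. -/
noncomputable def stripSubst (κ θ t : ℝ) (q : ℝ × ℝ) (ζ : ℝ) : ℝ × ℝ :=
  (deltaFlow κ θ t q.1, q.2 - (frakD κ θ t q.1 + √(2 * frakD κ θ t q.1) * ζ))

/-- The inverse of `stripSubst κ θ t · ζ`. By `neg_frakD_neg` the variance that occurs is the one
at the preimage `δ_{-t}(σ)`. -/
noncomputable def stripInv (κ θ t : ℝ) (q : ℝ × ℝ) (ζ : ℝ) : ℝ × ℝ :=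
  (deltaFlow κ θ (-t) q.1, q.2 + (-frakD κ θ (-t) q.1 + √(2 * -frakD κ θ (-t) q.1) * ζ))

theorem stripInv_stripSubst (hκ : κ ≠ 0) (t : ℝ) (q : ℝ × ℝ) (ζ : ℝ) :
    stripInv κ θ t (stripSubst κ θ t q ζ) ζ = q := by
  simp only [stripInv, stripSubst, neg_frakD_neg hκ, deltaFlow_neg_apply, sub_add_cancel]

theorem stripSubst_stripInv (hκ : κ ≠ 0) (t : ℝ) (q : ℝ × ℝ) (ζ : ℝ) :
    stripSubst κ θ t (stripInv κ θ t q ζ) ζ = q := by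
  simp only [stripInv, stripSubst, neg_frakD_neg hκ, deltaFlow_apply_neg, add_sub_cancel_right]

/-- The substitution for fixed `t` and `ζ` as a homeomorphism of the plane. -/
noncomputable def stripHomeo (hκ : κ ≠ 0) (θ t ζ : ℝ) : (ℝ × ℝ) ≃ₜ (ℝ × ℝ) where
  toFun q := stripSubst κ θ t q ζ
  invFun q := stripInv κ θ t q ζ
  left_inv q := stripInv_stripSubst hκ t q ζ
  right_inv q := stripSubst_stripInv hκ t q ζ
  continuous_toFun := by unfold stripSubst; fun_prop
  continuous_invFun := by unfold stripInv; fun_prop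

theorem map_deltaFlow (t : ℝ) : (volume : Measure ℝ).map (fun σ => deltaFlow κ θ t σ)
    = ENNReal.ofReal (Real.exp (κ * t)) • volume := by
  have e : (fun σ => deltaFlow κ θ t σ) = (fun x => θ * (1 - Real.exp (-κ * t)) + x) ∘
      (fun σ => σ * Real.exp (-κ * t)) := rfl
  rw [e, ← Measure.map_map (by fun_prop) (by fun_prop),
    Real.map_volume_mul_right (Real.exp_pos _).ne', Measure.map_smul,
    (measurePreserving_add_left volume (θ * (1 - Real.exp (-κ * t)))).map_eq,
    abs_of_pos (inv_pos.2 (Real.exp_pos _)), ← Real.exp_neg]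
  congr 3; ring

/-- For fixed `ζ` the substitution is a shear followed by the affine map `δ_t` in `σ`, so it
multiplies Lebesgue measure by a constant. -/
theorem map_stripSubst (t ζ : ℝ) :
    (volume : Measure (ℝ × ℝ)).map (fun q => stripSubst κ θ t q ζ)
      = ENNReal.ofReal (Real.exp (κ * t)) • volume := by
  have h1 : MeasurePreserving
      (fun q : ℝ × ℝ => (q.1, q.2 - (frakD κ θ t q.1 + √(2 * frakD κ θ t q.1) * ζ)))
      volume volume := by
    refine MeasurePreserving.skew_product (μa := (volume : Measure ℝ)) (μb := volume)
      (μc := (volume : Measure ℝ)) (μd := volume) (f := id)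
      (g := fun σ x => x - (frakD κ θ t σ + √(2 * frakD κ θ t σ) * ζ))
      (MeasurePreserving.id _) ?_ (Eventually.of_forall fun σ => ?_)
    · exact Continuous.measurable (by fun_prop)
    · exact (measurePreserving_sub_right volume _).map_eq
  have hδ : Measurable fun σ => deltaFlow κ θ t σ := Continuous.measurable (by fun_prop)
  have e : (fun q => stripSubst κ θ t q ζ) = (Prod.map (fun σ => deltaFlow κ θ t σ) id) ∘
      (fun q : ℝ × ℝ => (q.1, q.2 - (frakD κ θ t q.1 + √(2 * frakD κ θ t q.1) * ζ))) := rfl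
  rw [e, ← Measure.map_map (hδ.prodMap measurable_id) h1.measurable, h1.map_eq,
    Measure.volume_eq_prod, ← Measure.map_prod_map _ _ hδ measurable_id, map_deltaFlow,
        Measure.map_id, Measure.prod_smul_left]

theorem abs_strip_shift_le (H : IsStripParams κ θ α β) {t T σ : ℝ} (ht : 0 ≤ t) (htT : t ≤ T)
    (hσ : σ ∈ Ioo α β) (ζ : ℝ) : |frakD κ θ t σ + √(2 * frakD κ θ t σ) * ζ|
      ≤ β ^ 2 / 2 * T + √(2 * (β ^ 2 / 2 * T)) * |ζ| :=
  abs_shift_le (H.frakD_le ht htT hσ) (frakD_nonneg H.κ_pos H.θ_pos ht σ) ζ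

/-- Weights `p(σ, ζ)` of at most exponential growth in `ζ`, uniformly in `σ`. -/
structure IsExpWeight (α β : ℝ) (p : ℝ → ℝ → ℝ) (C c : ℝ) : Prop where
  nonneg : 0 ≤ C
  meas : Measurable (fun q : ℝ × ℝ => p q.1 q.2)
  bound : ∀ σ ∈ Ioo α β, ∀ ζ, |p σ ζ| ≤ C * Real.exp (c * |ζ|)

/-- Over the strip the shift of `x` is at most affine in `|ζ|`, so the exponential weight changes at
most by a factor that is exponential in `|ζ|`. The constants are uniform for `t ≤ T`. -/
theorem isSuperposition_stripSubst (H : IsStripParams κ θ α β) (lam : ℝ) {p : ℝ → ℝ → ℝ} {C c : ℝ}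
    (hp : IsExpWeight α β p C c) {t T : ℝ} (ht : 0 ≤ t) (htT : t ≤ T) :
    IsSuperposition (stripMeasure α β lam) (stripSubst κ θ t) (fun q ζ => p q.1 ζ)
      (C ^ 2 * Real.exp (κ * T) * Real.exp (2 * |lam| * (β ^ 2 / 2 * T)))
      (2 * c + 2 * |lam| * √(2 * (β ^ 2 / 2 * T))) where
  nonneg := by positivity
  meas_subst := by
    refine Continuous.measurable ?_
    unfold stripSubst; fun_prop
  meas_weight := hp.meas.comp (by fun_prop : Measurable fun q : (ℝ × ℝ) × ℝ => (q.1.1, q.2))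
  bound := fun ζ F hF => by
    have hw : Measurable fun p : ℝ × ℝ => ENNReal.ofReal (Real.exp (-2 * lam * √(1 + p.2 ^ 2))) :=
      ((continuous_weight lam).comp continuous_snd).measurable.ennreal_ofReal
    have hpm : Measurable fun q : ℝ × ℝ => p q.1 ζ :=
      hp.meas.comp (by fun_prop : Measurable fun q : ℝ × ℝ => (q.1, ζ))
    have hsm : Measurable fun q => stripSubst κ θ t q ζ := by
      refine Continuous.measurable ?_
      unfold stripSubst; fun_prop
    have hst : MeasurableSet (strip α β) := (isOpen_strip α β).measurableSet
    rw [stripMeasure_eq, lintegral_withDensity_eq_lintegral_mul (g := fun q => ‖p q.1 ζ‖ₑ ^ 2 *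
      F (stripSubst κ θ t q ζ)) _ hw ((hpm.enorm.pow_const 2).mul (hF.comp hsm)),
      lintegral_withDensity_eq_lintegral_mul _ hw hF]
    set G : ℝ × ℝ → ℝ≥0∞ := (strip α β).indicator
      (fun q => ENNReal.ofReal (Real.exp (-2 * lam * √(1 + q.2 ^ 2))) * F q) with hG
    have hGm : Measurable G := (hw.mul hF).indicator hst
    set K := C ^ 2 * Real.exp (2 * c * |ζ|) *
      Real.exp (2 * |lam| * (β ^ 2 / 2 * T + √(2 * (β ^ 2 / 2 * T)) * |ζ|)) with hK
    have hK0 : 0 ≤ K := by positivity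
    calc _ ≤ ∫⁻ q in strip α β, ENNReal.ofReal K * G (stripSubst κ θ t q ζ) := by
          refine setLIntegral_mono' hst fun q hq => ?_
          have hq1 : q.1 ∈ Ioo α β := hq.1
          have hmem : stripSubst κ θ t q ζ ∈ strip α β := ⟨H.deltaFlow_mem ht hq1, mem_univ _⟩
          rw [hG, indicator_of_mem hmem, Pi.mul_apply, ← mul_assoc, ← mul_assoc,
            ← ENNReal.ofReal_mul hK0, ← ofReal_norm, ← ENNReal.ofReal_pow (norm_nonneg _),
            ← ENNReal.ofReal_mul (Real.exp_nonneg _)]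
          refine mul_le_mul_left (ENNReal.ofReal_le_ofReal ?_) _
          set s := frakD κ θ t q.1 + √(2 * frakD κ θ t q.1) * ζ with hs
          have h1 : ‖p q.1 ζ‖ ^ 2 ≤ C ^ 2 * Real.exp (2 * c * |ζ|) := by
            have := pow_le_pow_left₀ (abs_nonneg _) (hp.bound q.1 hq1 ζ) 2
            rw [Real.norm_eq_abs]
            refine this.trans_eq ?_
            rw [mul_pow, ← Real.exp_nat_mul]; congr 2; push_cast; ring
          have h2 := weight_add_le lam (q.2 - s) s
          rw [sub_add_cancel] at h2
          have h3 : Real.exp (2 * |lam| * |s|)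
              ≤ Real.exp (2 * |lam| * (β ^ 2 / 2 * T + √(2 * (β ^ 2 / 2 * T)) * |ζ|)) := by
            refine Real.exp_le_exp.2 (mul_le_mul_of_nonneg_left ?_ (by positivity))
            exact abs_strip_shift_le H ht htT hq1 ζ
          have h4 : Real.exp (-2 * lam * √(1 + q.2 ^ 2))
              ≤ Real.exp (2 * |lam| * (β ^ 2 / 2 * T + √(2 * (β ^ 2 / 2 * T)) * |ζ|))
                * Real.exp (-2 * lam * √(1 + (q.2 - s) ^ 2)) := h2.trans (by gcongr)
          calc _ ≤ (Real.exp (2 * |lam| * (β ^ 2 / 2 * T + √(2 * (β ^ 2 / 2 * T)) * |ζ|))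
                * Real.exp (-2 * lam * √(1 + (q.2 - s) ^ 2))) * (C ^ 2 * Real.exp (2 * c * |ζ|))
                    := by
                gcongr
            _ = _ := by rw [hK]; simp only [stripSubst, ← hs]; ring
      _ ≤ ∫⁻ q, ENNReal.ofReal K * G (stripSubst κ θ t q ζ) := setLIntegral_le_lintegral _ _
      _ = ENNReal.ofReal K * (ENNReal.ofReal (Real.exp (κ * t)) * ∫⁻ q, G q) := by
          rw [lintegral_const_mul (f := fun q => G (stripSubst κ θ t q ζ)) _ (hGm.comp hsm), ←
              lintegral_map hGm hsm,
            map_stripSubst, lintegral_smul_measure, smul_eq_mul]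
      _ ≤ _ := by
          rw [← mul_assoc, ← ENNReal.ofReal_mul hK0, hG, lintegral_indicator hst]
          refine mul_le_mul_left (ENNReal.ofReal_le_ofReal ?_) _
          have h1 : Real.exp (κ * t) ≤ Real.exp (κ * T) :=
            Real.exp_le_exp.2 (mul_le_mul_of_nonneg_left htT H.κ_pos.le)
          calc K * Real.exp (κ * t) ≤ K * Real.exp (κ * T) := by gcongr
            _ = _ := by
              rw [hK, add_mul (2 * c), Real.exp_add, mul_add (2 * |lam|), Real.exp_add]
              ring_nf

theorem isExpWeight_one (α β : ℝ) : IsExpWeight α β (fun _ _ => 1) 1 0 :=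
  ⟨zero_le_one, measurable_const, fun _ _ _ => by simp⟩

/-- The operator `k ↦ ∫ p(σ, ζ) k(δ_t(σ), x - 𝔇 - √(2𝔇) ζ) dγ(ζ)`. -/
noncomputable def weightedOp (H : IsStripParams κ θ α β) (lam : ℝ) {p : ℝ → ℝ → ℝ} {C c : ℝ}
    (hp : IsExpWeight α β p C c) {t : ℝ} (ht : 0 ≤ t) : L2Strip α β lam →L[ℂ] L2Strip α β lam :=
  (isSuperposition_stripSubst H lam hp ht le_rfl).toCLM

/-- The semigroup `e^{tL₀}`, as the superposition with constant weight; the value `0` for `t < 0` is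
immaterial. -/
noncomputable def stripOp (H : IsStripParams κ θ α β) (lam t : ℝ) :
    L2Strip α β lam →L[ℂ] L2Strip α β lam :=
  if ht : 0 ≤ t then weightedOp H lam (isExpWeight_one α β) ht else 0

theorem stripOp_eq (H : IsStripParams κ θ α β) {t : ℝ} (ht : 0 ≤ t) :
    stripOp H lam t = weightedOp H lam (isExpWeight_one α β) ht := dif_pos ht

theorem coeFn_weightedOp (H : IsStripParams κ θ α β) {p : ℝ → ℝ → ℝ} {C c : ℝ}
    (hp : IsExpWeight α β p C c) {t : ℝ} (ht : 0 ≤ t) (k : L2Strip α β lam) :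
    weightedOp H lam hp ht k =ᵐ[stripMeasure α β lam]
      superpose (stripSubst κ θ t) (fun q ζ => p q.1 ζ) k :=
  IsSuperposition.coeFn_toCLM _ k

theorem coeFn_stripOp (H : IsStripParams κ θ α β) {t : ℝ} (ht : 0 ≤ t) (k : L2Strip α β lam) :
    stripOp H lam t k =ᵐ[stripMeasure α β lam] superpose (stripSubst κ θ t) (fun _ _ => 1) k := by
  rw [stripOp_eq H ht]
  exact coeFn_weightedOp H _ ht k

theorem stripOp_add (H : IsStripParams κ θ α β) {s t : ℝ} (hs : 0 ≤ s) (ht : 0 ≤ t) :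
    stripOp H lam (s + t) = (stripOp H lam s).comp (stripOp H lam t) := by
  refine ContinuousLinearMap.ext fun k => Lp.ext ?_
  have hk := Lp.stronglyMeasurable k
  have h1 := isSuperposition_stripSubst H lam (isExpWeight_one α β) hs le_rfl
  have h3 := isSuperposition_stripSubst H lam (isExpWeight_one α β) (add_nonneg hs ht) le_rfl
  refine (coeFn_stripOp H (add_nonneg hs ht) k).trans ?_
  refine EventuallyEq.trans ?_ (coeFn_stripOp H hs (stripOp H lam t k)).symm
  refine EventuallyEq.trans ?_ (h1.superpose_congr (coeFn_stripOp H ht k)).symm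
  filter_upwards [h3.ae_integrable hk (Lp.memLp k)] with q hq
  have hD := frakD_add (θ := θ) H.κ_pos.ne' s t q.1
  have d1 := frakD_nonneg H.κ_pos H.θ_pos hs q.1
  have d2 := frakD_nonneg H.κ_pos H.θ_pos ht (deltaFlow κ θ s q.1)
  have hab : √(2 * frakD κ θ s q.1) ^ 2 + √(2 * frakD κ θ t (deltaFlow κ θ s q.1)) ^ 2
      = √(2 * frakD κ θ (s + t) q.1) ^ 2 := by
    rw [hD, Real.sq_sqrt (by positivity), Real.sq_sqrt (by positivity), Real.sq_sqrt (by
        positivity)]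
    ring
  have := integral_integral_stdGauss hab
    (F := fun u => k (deltaFlow κ θ (s + t) q.1, q.2 - frakD κ θ (s + t) q.1 - u))
    (hk.comp_measurable (by fun_prop)) (by simpa [stripSubst, sub_sub] using hq)
  simp only [superpose, stripSubst, one_smul]
  simp only [sub_sub] at this ⊢
  rw [← this]
  congr 1; ext ζ; congr 1; ext ζ'
  rw [deltaFlow_add, hD]
  congr 2; ring

theorem stripOp_zero (H : IsStripParams κ θ α β) : stripOp H lam 0 = ContinuousLinearMap.id ℂ _ :=
    by
  refine ContinuousLinearMap.ext fun k => Lp.ext ((coeFn_stripOp H le_rfl k).trans ?_)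
  refine Eventually.of_forall fun q => ?_
  simp [superpose, stripSubst, frakD_zero, deltaFlow_zero]

theorem isC0Semigroup_stripOp (H : IsStripParams κ θ α β) : IsC0Semigroup (stripOp H lam) where
  add := fun _ _ hs ht => stripOp_add H hs ht
  zero := stripOp_zero H
  tendsto := by
    refine IsSuperposition.tendsto_id (ρ := stripSubst κ θ)
      (fun t ht => isSuperposition_stripSubst H lam (isExpWeight_one α β) ht.1.le ht.2)
      (fun t ht k => coeFn_stripOp H ht.1.le k) (fun q ζ => ?_) (fun g hg hgc => ?_)
    · have : Continuous fun t => stripSubst κ θ t q ζ := by unfold stripSubst; fun_prop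
      have h := this.tendsto 0
      simp only [stripSubst, deltaFlow_zero, frakD_zero, mul_zero, Real.sqrt_zero, zero_mul,
        add_zero, sub_zero] at h
      exact h.mono_left nhdsWithin_le_nhds
    · obtain ⟨R, hR⟩ := hgc.exists_radius
      obtain ⟨B, hB⟩ := hg.bounded_above_of_compact_support hgc
      have hB0 : 0 ≤ B := (norm_nonneg _).trans (hB 0)
      set b := |lam| + 1 with hb
      have hb0 : 0 ≤ b := by positivity
      set Dm := β ^ 2 / 2 * 1 with hDm
      refine ⟨fun q => B * Real.exp (b * (R + Dm)) * Real.exp (-b * |q.2|), b * √(2 * Dm),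
        by fun_prop, ?_, fun t ht => ?_⟩
      · have e : ∀ q : ℝ × ℝ, ‖B * Real.exp (b * (R + Dm)) * Real.exp (-b * |q.2|)‖ₑ ^ 2
            = ENNReal.ofReal ((B * Real.exp (b * (R + Dm))) ^ 2)
              * ENNReal.ofReal (Real.exp (-2 * b * |q.2|)) := fun q => by
          rw [← ofReal_norm, Real.norm_of_nonneg (by positivity), ← ENNReal.ofReal_pow (by
              positivity),
            ← ENNReal.ofReal_mul (by positivity), mul_pow, ← Real.exp_nat_mul]
          congr 3; push_cast; ring
        simp only [e]
        rw [lintegral_const_mul _ (by fun_prop), stripMeasure]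
        have := lintegral_prod_mul (μ := (volume : Measure ℝ).restrict (Ioo α β))
          (ν := weightMeasure lam) (f := fun _ => 1)
          (g := fun x => ENNReal.ofReal (Real.exp (-2 * b * |x|))) (by fun_prop) (by fun_prop)
        simp only [one_mul] at this
        rw [this]
        refine ENNReal.mul_lt_top (by simp) (ENNReal.mul_lt_top (by simp) ?_)
        exact lintegral_exp_weightMeasure_lt_top lam
      · filter_upwards [ae_stripMeasure_mem α β lam] with q hq ζ
        have h1 := norm_le_mul_exp_of_ne_zero
          (s := -(frakD κ θ t q.1 + √(2 * frakD κ θ t q.1) * ζ)) (x := q.2) hb0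
          (hB (stripSubst κ θ t q ζ)) (fun h => (norm_snd_le (stripSubst κ θ t q ζ)).trans (hR _ h))
        refine h1.trans ?_
        rw [abs_neg]
        have h2 : b * |frakD κ θ t q.1 + √(2 * frakD κ θ t q.1) * ζ| ≤ b * (Dm + √(2 * Dm) * |ζ|) :=
          mul_le_mul_of_nonneg_left (abs_strip_shift_le H ht.1.le ht.2 hq.1 ζ) hb0
        calc _ ≤ B * Real.exp (b * (R + Dm) + b * √(2 * Dm) * |ζ|) * Real.exp (-b * |q.2|) := by
              gcongr
              linarith
          _ = _ := by rw [Real.exp_add]; ring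

end Strip

/-! ### The substitution and test functions -/

section StripTest

variable {κ θ α β lam : ℝ}

theorem fderiv_mul_fst {a : ℝ → ℝ} {a' : ℝ} {χ : ℝ × ℝ → ℝ} {q : ℝ × ℝ} (ha : HasDerivAt a a' q.1)
    (hχ : DifferentiableAt ℝ χ q) (v : ℝ × ℝ) : fderiv ℝ (fun q => a q.1 * χ q) q v
      = a q.1 * fderiv ℝ χ q v + a' * v.1 * χ q := by
  have h1 : HasFDerivAt (fun q : ℝ × ℝ => a q.1) (a' • ContinuousLinearMap.fst ℝ ℝ ℝ) q :=
    ha.comp_hasFDerivAt q hasFDerivAt_fst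
  have h2 : HasFDerivAt (fun q : ℝ × ℝ => a q.1 * χ q) _ q := h1.mul hχ.hasFDerivAt
  rw [h2.fderiv]
  simp only [_root_.add_apply, _root_.smul_apply, ContinuousLinearMap.coe_fst', smul_eq_mul]
  ring

/-- Change of variables for a fixed `ζ`. -/
theorem integral_smul_stripSubst (H : IsStripParams κ θ α β) {t : ℝ} (ht : 0 ≤ t) {χ : ℝ × ℝ → ℝ}
    (hχ : ∀ q, q ∉ strip α β → χ q = 0) (k : ℝ × ℝ → ℂ) (ζ : ℝ) :
    ∫ q in strip α β, χ q • k (stripSubst κ θ t q ζ)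
      = Real.exp (κ * t) • ∫ q in strip α β, χ (stripInv κ θ t q ζ) • k q := by
  have hκ := H.κ_pos.ne'
  rw [setIntegral_eq_integral_of_forall_compl_eq_zero (fun q hq => by rw [hχ q hq, zero_smul]),
    setIntegral_eq_integral_of_forall_compl_eq_zero (fun q hq => by
      rw [hχ, zero_smul]
      intro h
      refine hq ?_
      rw [← stripSubst_stripInv (θ := θ) hκ t q ζ]
      exact ⟨H.deltaFlow_mem ht h.1, mem_univ _⟩)]
  have h1 := (stripHomeo hκ θ t ζ).measurableEmbedding.integral_map (μ := volume)
    (fun q => χ (stripInv κ θ t q ζ) • k q)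
  have h2 : (volume : Measure (ℝ × ℝ)).map (stripHomeo hκ θ t ζ)
      = ENNReal.ofReal (Real.exp (κ * t)) • volume := map_stripSubst t ζ
  rw [h2, integral_smul_measure, ENNReal.toReal_ofReal (Real.exp_nonneg _)] at h1
  rw [h1]
  refine integral_congr_ae (Eventually.of_forall fun q => ?_)
  change _ = χ (stripInv κ θ t (stripSubst κ θ t q ζ) ζ) • k (stripSubst κ θ t q ζ)
  rw [stripInv_stripSubst hκ]

theorem contDiff_sqrt_frakD (H : IsStripParams κ θ α β) {t : ℝ} (ht : 0 < t) :
    ContDiff ℝ ∞ fun σ => √(2 * frakD κ θ t σ) :=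
  (contDiff_const.mul (contDiff_frakD t)).sqrt fun σ =>
    (mul_pos two_pos (frakD_pos H.κ_pos H.θ_pos ht σ)).ne'

/-- The derivative of the shift `𝔇 + √(2𝔇) ζ` in `σ`. -/
noncomputable def shiftDs (κ θ t σ ζ : ℝ) : ℝ :=
  frakDs κ θ t σ + frakDs κ θ t σ / √(2 * frakD κ θ t σ) * ζ

theorem hasDerivAt_sqrt_frakD (H : IsStripParams κ θ α β) {t : ℝ} (ht : 0 < t) (σ : ℝ) :
    HasDerivAt (fun σ => √(2 * frakD κ θ t σ)) (frakDs κ θ t σ / √(2 * frakD κ θ t σ)) σ := by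
  have hD := frakD_pos H.κ_pos H.θ_pos ht σ
  refine (((hasDerivAt_frakD_space H.κ_pos.ne' t σ).const_mul 2).sqrt
    (by positivity)).congr_deriv ?_
  rw [mul_div_mul_left _ _ two_ne_zero]

theorem hasDerivAt_shift (H : IsStripParams κ θ α β) {t : ℝ} (ht : 0 < t) (σ ζ : ℝ) :
    HasDerivAt (fun σ => frakD κ θ t σ + √(2 * frakD κ θ t σ) * ζ) (shiftDs κ θ t σ ζ) σ :=
  (hasDerivAt_frakD_space H.κ_pos.ne' t σ).add ((hasDerivAt_sqrt_frakD H ht σ).mul_const ζ)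

theorem contDiff_frakDs_div (H : IsStripParams κ θ α β) {t : ℝ} (ht : 0 < t) :
    ContDiff ℝ ∞ fun σ => frakDs κ θ t σ / √(2 * frakD κ θ t σ) :=
  (contDiff_frakDs t).div (contDiff_sqrt_frakD H ht) fun σ => by
    have := frakD_pos H.κ_pos H.θ_pos ht σ
    positivity

theorem contDiff_shiftDs (H : IsStripParams κ θ α β) {t : ℝ} (ht : 0 < t) (ζ : ℝ) :
    ContDiff ℝ ∞ fun σ => shiftDs κ θ t σ ζ :=
  (contDiff_frakDs t).add ((contDiff_frakDs_div H ht).mul contDiff_const)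

theorem stripInv_eq (H : IsStripParams κ θ α β) (t : ℝ) (q : ℝ × ℝ) (ζ : ℝ) :
    stripInv κ θ t q ζ = (deltaFlow κ θ (-t) q.1, q.2 + (frakD κ θ t (deltaFlow κ θ (-t) q.1)
      + √(2 * frakD κ θ t (deltaFlow κ θ (-t) q.1)) * ζ)) := by
  rw [stripInv, neg_frakD_neg H.κ_pos.ne']

theorem contDiff_stripInv (H : IsStripParams κ θ α β) {t : ℝ} (ht : 0 < t) (ζ : ℝ) :
    ContDiff ℝ ∞ fun q => stripInv κ θ t q ζ := by
  have h0 : ContDiff ℝ ∞ fun q : ℝ × ℝ => deltaFlow κ θ (-t) q.1 :=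
    (contDiff_deltaFlow (-t)).comp contDiff_fst
  simp only [stripInv_eq H]
  exact h0.prodMk (contDiff_snd.add (((contDiff_frakD t).comp h0).add
    (((contDiff_sqrt_frakD H ht).comp h0).mul contDiff_const)))

theorem hasFDerivAt_stripInv (H : IsStripParams κ θ α β) {t : ℝ} (ht : 0 < t) (q : ℝ × ℝ) (ζ : ℝ) :
    HasFDerivAt (fun q => stripInv κ θ t q ζ)
      ((Real.exp (κ * t) • ContinuousLinearMap.fst ℝ ℝ ℝ).prod (ContinuousLinearMap.snd ℝ ℝ ℝ +
        (shiftDs κ θ t (deltaFlow κ θ (-t) q.1) ζ * Real.exp (κ * t)) •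
          ContinuousLinearMap.fst ℝ ℝ ℝ)) q := by
  have h0 := hasDerivAt_deltaFlow_space (κ := κ) (θ := θ) (-t) q.1
  rw [neg_mul_neg] at h0
  have h1 := (hasDerivAt_shift H ht (deltaFlow κ θ (-t) q.1) ζ).comp q.1 h0
  have hf : HasFDerivAt (fun q : ℝ × ℝ => q.1) (ContinuousLinearMap.fst ℝ ℝ ℝ) q := hasFDerivAt_fst
  have hs : HasFDerivAt (fun q : ℝ × ℝ => q.2) (ContinuousLinearMap.snd ℝ ℝ ℝ) q := hasFDerivAt_snd
  simp only [stripInv_eq H]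
  exact (h0.comp_hasFDerivAt q hf).prodMk (hs.add (h1.comp_hasFDerivAt q hf))

/-- Test functions are carried to test functions, since the flow maps the interval into itself. -/
theorem IsTestFun.comp_stripInv (H : IsStripParams κ θ α β) {t : ℝ} (ht : 0 < t) {χ : ℝ × ℝ → ℝ}
    (hχ : IsTestFun (strip α β) χ) (ζ : ℝ) :
    IsTestFun (strip α β) (fun q => χ (stripInv κ θ t q ζ)) where
  smooth := hχ.smooth.comp (contDiff_stripInv H ht ζ)
  compact := hχ.compact.comp_homeomorph (stripHomeo H.κ_pos.ne' θ t ζ).symm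
  subset := by
    intro q hq
    have h1 : stripInv κ θ t q ζ ∈ tsupport χ := by
      have hc : Continuous fun q => stripInv κ θ t q ζ := (contDiff_stripInv H ht ζ).continuous
      refine closure_minimal (t := (fun q => stripInv κ θ t q ζ) ⁻¹' tsupport χ) (fun p hp => ?_)
        ((isClosed_tsupport χ).preimage hc) hq
      exact subset_tsupport χ hp
    rw [← stripSubst_stripInv (θ := θ) H.κ_pos.ne' t q ζ]
    exact ⟨H.deltaFlow_mem ht.le (hχ.subset h1).1, mem_univ _⟩

variable {k ks kx : L2Strip α β lam} {χ : ℝ × ℝ → ℝ} {t : ℝ}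

theorem integrable_smul_stripSubst (H : IsStripParams κ θ α β) (ht : 0 < t)
    (hχ : IsTestFun (strip α β) χ) (k : L2Strip α β lam) (ζ : ℝ) :
    Integrable (fun q => χ q • k (stripSubst κ θ t q ζ)) (volume.restrict (strip α β)) := by
  have hκ := H.κ_pos.ne'
  have hst : MeasurableSet (strip α β) := (isOpen_strip α β).measurableSet
  have h1 := (isWeightedDomain_strip α β lam).integrable_smul (hχ.comp_stripInv H ht ζ) k
  have h2 : Integrable (fun q => χ (stripInv κ θ t q ζ) • k q) := by
    refine (integrableOn_iff_integrable_of_support_subset fun q hq => ?_).1 h1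
    by_contra h
    exact hq (by simp [(hχ.comp_stripInv H ht ζ).eq_zero h])
  have h3 : Integrable (fun q => χ (stripInv κ θ t q ζ) • k q)
      (volume.map (stripHomeo hκ θ t ζ)) := by
    have e : (volume : Measure (ℝ × ℝ)).map (stripHomeo hκ θ t ζ)
      = ENNReal.ofReal (Real.exp (κ * t)) • volume := map_stripSubst t ζ
    rw [e]
    exact h2.smul_measure (by simp)
  rw [(stripHomeo hκ θ t ζ).measurableEmbedding.integrable_map_iff] at h3
  refine (h3.congr (Eventually.of_forall fun q => ?_)).restrict
  change χ (stripInv κ θ t (stripSubst κ θ t q ζ) ζ) • k (stripSubst κ θ t q ζ) = _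
  rw [stripInv_stripSubst hκ]

/-- Integration by parts in `x`, for a fixed `ζ`. -/
theorem integral_fderiv_space_stripSubst (H : IsStripParams κ θ α β) (ht : 0 < t)
    (hk : HasWeakDeriv (strip α β) ((0, 1) : ℝ × ℝ) k kx) (hχ : IsTestFun (strip α β) χ) (ζ : ℝ) :
    ∫ q in strip α β, fderiv ℝ χ q (0, 1) • k (stripSubst κ θ t q ζ)
      = -∫ q in strip α β, χ q • kx (stripSubst κ θ t q ζ) := by
  rw [integral_smul_stripSubst H ht.le (χ := fun q => fderiv ℝ χ q (0, 1))
      (fun q hq => hχ.fderiv_eq_zero hq _), integral_smul_stripSubst H ht.le (fun q hq =>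
          hχ.eq_zero hq),
    ← smul_neg, ← hk.integral_eq (hχ.comp_stripInv H ht ζ)]
  congr 2; ext q; congr 1
  have h1 := ((hχ.smooth.differentiable (by simp) (stripInv κ θ t q ζ)).hasFDerivAt.comp q
    (hasFDerivAt_stripInv H ht q ζ)).fderiv
  rw [Function.comp_def] at h1
  rw [h1]
  simp

/-- Integration by parts in `σ`, for a fixed `ζ`. -/
theorem integral_fderiv_flow_stripSubst (H : IsStripParams κ θ α β) (ht : 0 < t)
    (hs : HasWeakDeriv (strip α β) ((1, 0) : ℝ × ℝ) k ks)
    (hx : HasWeakDeriv (strip α β) ((0, 1) : ℝ × ℝ) k kx) (hχ : IsTestFun (strip α β) χ) (ζ : ℝ) :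
    ∫ q in strip α β, fderiv ℝ χ q (1, 0) • k (stripSubst κ θ t q ζ)
      = -(Real.exp (-κ * t) • ∫ q in strip α β, χ q • ks (stripSubst κ θ t q ζ))
        + ∫ q in strip α β, (shiftDs κ θ t q.1 ζ * χ q) • kx (stripSubst κ θ t q ζ) := by
  have hω := hχ.comp_stripInv H ht ζ
  have hψ : IsTestFun (strip α β) (fun q => shiftDs κ θ t q.1 ζ * χ q) :=
    hχ.mul_left ((contDiff_shiftDs H ht ζ).comp contDiff_fst)
  have e0 : Real.exp (-κ * t) * Real.exp (κ * t) = 1 := by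
    rw [← Real.exp_add]; simp
  have e0' : Real.exp (κ * t) * Real.exp (-κ * t) = 1 := by rw [mul_comm, e0]
  have e1 : ∀ q, fderiv ℝ (fun q => shiftDs κ θ t q.1 ζ * χ q) q (0, 1)
      = shiftDs κ θ t q.1 ζ * fderiv ℝ χ q (0, 1) := fun q => by
    rw [fderiv_mul_fst ((contDiff_shiftDs H ht ζ).differentiable (by simp) q.1).hasDerivAt
      (hχ.smooth.differentiable (by simp) q)]
    simp
  have e2 := integral_fderiv_space_stripSubst H ht hx hψ ζ
  simp only [e1] at e2
  have e3 := hs.integral_eq hω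
  have e4 : ∀ q, fderiv ℝ (fun q => χ (stripInv κ θ t q ζ)) q (1, 0) = Real.exp (κ * t) *
      (fderiv ℝ χ (stripInv κ θ t q ζ) (1, 0)
        + shiftDs κ θ t (stripInv κ θ t q ζ).1 ζ * fderiv ℝ χ (stripInv κ θ t q ζ) (0, 1)) :=
    fun q => by
      have h1 := ((hχ.smooth.differentiable (by simp) (stripInv κ θ t q ζ)).hasFDerivAt.comp q
        (hasFDerivAt_stripInv H ht q ζ)).fderiv
      rw [Function.comp_def] at h1
      rw [h1]
      have h2 : ((Real.exp (κ * t), shiftDs κ θ t (deltaFlow κ θ (-t) q.1) ζ * Real.exp (κ * t)) :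
          ℝ × ℝ)
          = Real.exp (κ * t) • ((1, 0) : ℝ × ℝ)
            + (shiftDs κ θ t (deltaFlow κ θ (-t) q.1) ζ * Real.exp (κ * t)) • ((0, 1) : ℝ × ℝ) := by
        ext <;> simp
      have h3 : (stripInv κ θ t q ζ).1 = deltaFlow κ θ (-t) q.1 := rfl
      simp only [ContinuousLinearMap.comp_apply, ContinuousLinearMap.prod_apply,
        _root_.add_apply, _root_.smul_apply, ContinuousLinearMap.coe_fst',
        ContinuousLinearMap.coe_snd', smul_eq_mul, mul_one, zero_add]
      rw [h2, map_add, map_smul, map_smul, h3, smul_eq_mul, smul_eq_mul]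
      ring
  have i1 := integrable_smul_stripSubst H ht (hχ.fderiv_apply (1, 0)) k ζ
  have i2 : Integrable (fun q => (shiftDs κ θ t q.1 ζ * fderiv ℝ χ q (0, 1)) •
      k (stripSubst κ θ t q ζ)) (volume.restrict (strip α β)) := integrable_smul_stripSubst H ht
    ((hχ.fderiv_apply (0, 1)).mul_left ((contDiff_shiftDs H ht ζ).comp contDiff_fst)) k ζ
  rw [← neg_eq_iff_eq_neg.2 e2, integral_smul_stripSubst H ht.le (fun q hq => hχ.eq_zero hq),
    smul_smul, e0, one_smul, ← e3, ← sub_eq_add_neg, eq_sub_iff_add_eq, ← integral_add i1 i2]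
  simp only [← add_smul]
  rw [integral_smul_stripSubst H ht.le (χ := fun q => fderiv ℝ χ q (1, 0) +
    shiftDs κ θ t q.1 ζ * fderiv ℝ χ q (0, 1)) (fun q hq => by
      rw [hχ.fderiv_eq_zero hq, hχ.fderiv_eq_zero hq, mul_zero, add_zero]), ← integral_smul]
  congr 1; ext q
  rw [e4, smul_smul]

end StripTest

/-! ### Weak derivatives of the weighted superpositions -/

section StripRules

variable {κ θ α β lam : ℝ} {k ks kx : L2Strip α β lam} {t : ℝ} {p p' r : ℝ → ℝ → ℝ}
  {C c C' c' C'' c'' : ℝ}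

theorem integral_test_weightedOp (H : IsStripParams κ θ α β) (hp : IsExpWeight α β p C c)
    (ht : 0 ≤ t) {φ : ℝ × ℝ → ℝ} (hφ : IsTestFun (strip α β) φ) (k : L2Strip α β lam) :
    ∫ q in strip α β, φ q • weightedOp H lam hp ht k q
      = ∫ ζ, (∫ q in strip α β, (p q.1 ζ * φ q) • k (stripSubst κ θ t q ζ)) ∂stdGauss := by
  rw [weightedOp, (isWeightedDomain_strip α β lam).integral_test_toCLM _ hφ]
  simp only [smul_smul, mul_comm (φ _)]

theorem integrable_test_weightedOp (H : IsStripParams κ θ α β) (hp : IsExpWeight α β p C c)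
    (ht : 0 ≤ t) {φ : ℝ × ℝ → ℝ} (hφ : IsTestFun (strip α β) φ) (k : L2Strip α β lam) :
    Integrable (fun ζ => ∫ q in strip α β, (p q.1 ζ * φ q) • k (stripSubst κ θ t q ζ)) stdGauss :=
        by
  have h := (isWeightedDomain_strip α β lam).integrable_test_superposition
    (isSuperposition_stripSubst H lam hp ht le_rfl) hφ k
  refine h.integral_prod_right.congr (Eventually.of_forall fun ζ => ?_)
  simp only [smul_smul, mul_comm (φ _)]

/-- Weak derivatives in `x` commute with the weighted superpositions. -/
theorem hasWeakDeriv_weightedOp_space (H : IsStripParams κ θ α β) (hp : IsExpWeight α β p C c)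
    (hps : ∀ ζ, ContDiff ℝ ∞ fun σ => p σ ζ) (ht : 0 < t)
    (hx : HasWeakDeriv (strip α β) ((0, 1) : ℝ × ℝ) k kx) :
    HasWeakDeriv (strip α β) ((0, 1) : ℝ × ℝ) (weightedOp H lam hp ht.le k)
      (weightedOp H lam hp ht.le kx) := by
  refine (isWeightedDomain_strip α β lam).hasWeakDeriv_of_forall fun φ hφ => ?_
  rw [integral_test_weightedOp H hp ht.le (hφ.fderiv_apply (0, 1)),
    integral_test_weightedOp H hp ht.le hφ, ← integral_neg]
  congr 1; ext ζ
  have := integral_fderiv_space_stripSubst H ht hx (hφ.mul_left ((hps ζ).comp contDiff_fst)) ζ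
  rw [Function.comp_def] at this
  rw [← this]
  congr 1; ext q; congr 1
  have e := fderiv_mul_fst ((hps ζ).differentiable (by simp) q.1).hasDerivAt
    (hφ.smooth.differentiable (by simp) q) (0, 1)
  simpa using e.symm

/-- The chain rule for the weighted superpositions in the direction of the flow. -/
theorem hasWeakDeriv_weightedOp_flow (H : IsStripParams κ θ α β) (hp : IsExpWeight α β p C c)
    (hp' : IsExpWeight α β p' C' c') (hr : IsExpWeight α β r C'' c'')
    (hps : ∀ ζ, ContDiff ℝ ∞ fun σ => p σ ζ) (hd : ∀ ζ σ, HasDerivAt (fun σ => p σ ζ) (p' σ ζ) σ)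
    (ht : 0 < t) (hrp : ∀ σ ζ, r σ ζ = p σ ζ * shiftDs κ θ t σ ζ)
    (hs : HasWeakDeriv (strip α β) ((1, 0) : ℝ × ℝ) k ks)
    (hx : HasWeakDeriv (strip α β) ((0, 1) : ℝ × ℝ) k kx) :
    HasWeakDeriv (strip α β) ((1, 0) : ℝ × ℝ) (weightedOp H lam hp ht.le k)
      (weightedOp H lam hp' ht.le k + (Real.exp (-κ * t) • weightedOp H lam hp ht.le ks
        - weightedOp H lam hr ht.le kx) : L2Strip α β lam) := by
  have hμ := isWeightedDomain_strip α β lam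
  refine hμ.hasWeakDeriv_of_forall fun φ hφ => ?_
  obtain ⟨Λ, hΛ⟩ := hμ.exists_pairing hφ
  have hΛs : ∀ (a : ℝ) (f : L2Strip α β lam), Λ (a • f) = a • Λ f := fun a f =>
    (Λ.restrictScalars ℝ).map_smul a f
  have i1 : Integrable (fun ζ => Real.exp (-κ * t) •
      ∫ q in strip α β, (p q.1 ζ * φ q) • ks (stripSubst κ θ t q ζ)) stdGauss :=
    (integrable_test_weightedOp H hp ht.le hφ ks).smul (Real.exp (-κ * t))
  have i2 := integrable_test_weightedOp H hr ht.le hφ kx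
  have i3 := integrable_test_weightedOp H hp' ht.le hφ k
  have i12 : Integrable (fun ζ => Real.exp (-κ * t) •
      (∫ q in strip α β, (p q.1 ζ * φ q) • ks (stripSubst κ θ t q ζ))
        - ∫ q in strip α β, (r q.1 ζ * φ q) • kx (stripSubst κ θ t q ζ)) stdGauss := i1.sub i2
  rw [← hΛ (_ + _), map_add, map_sub, hΛs, hΛ, hΛ, hΛ,
    integral_test_weightedOp H hp ht.le (hφ.fderiv_apply (1, 0)),
    integral_test_weightedOp H hp ht.le hφ, integral_test_weightedOp H hp' ht.le hφ,
    integral_test_weightedOp H hr ht.le hφ, ← integral_smul,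
    ← integral_sub i1 i2, ← integral_add i3 i12, ← integral_neg]
  congr 1; ext ζ
  have hχ := hφ.mul_left ((hps ζ).comp contDiff_fst)
  have e1 : ∀ q, fderiv ℝ (fun q => p q.1 ζ * φ q) q (1, 0)
      = p q.1 ζ * fderiv ℝ φ q (1, 0) + p' q.1 ζ * φ q := fun q => by
    rw [fderiv_mul_fst (hd ζ q.1) (hφ.smooth.differentiable (by simp) q)]
    simp
  have hp's : ContDiff ℝ ∞ fun σ => p' σ ζ := by
    have : (fun σ => p' σ ζ) = deriv fun σ => p σ ζ := funext fun σ => ((hd ζ σ).deriv).symm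
    rw [this]
    exact ((contDiff_infty_iff_deriv).1 (hps ζ)).2
  have key := integral_fderiv_flow_stripSubst H ht hs hx hχ ζ
  simp only [Function.comp_apply, e1, add_smul] at key
  have j1 : Integrable (fun q => (p q.1 ζ * fderiv ℝ φ q (1, 0)) • k (stripSubst κ θ t q ζ))
      (volume.restrict (strip α β)) := integrable_smul_stripSubst H ht
    ((hφ.fderiv_apply (1, 0)).mul_left ((hps ζ).comp contDiff_fst)) k ζ
  have j2 : Integrable (fun q => (p' q.1 ζ * φ q) • k (stripSubst κ θ t q ζ))
      (volume.restrict (strip α β)) := integrable_smul_stripSubst H ht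
    (hφ.mul_left (hp's.comp contDiff_fst)) k ζ
  rw [integral_add j1 j2] at key
  rw [eq_sub_of_add_eq key]
  have e2 : ∀ q : ℝ × ℝ, r q.1 ζ * φ q = shiftDs κ θ t q.1 ζ * (p q.1 ζ * φ q) := fun q => by
    rw [hrp]; ring
  simp only [e2]
  abel

end StripRules

/-! ### Duality and Stein's identity on the strip -/

section StripDual

variable {κ θ α β lam : ℝ} {p : ℝ → ℝ → ℝ} {C c : ℝ} {φ : ℝ × ℝ → ℝ} {t : ℝ}

/-- Polynomials of degree two in `ζ` with continuous coefficients in `σ` are admissible weights. -/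
theorem exists_isExpWeight (α β : ℝ) {b₀ b₁ b₂ : ℝ → ℝ} (h₀ : Continuous b₀) (h₁ : Continuous b₁)
    (h₂ : Continuous b₂) :
    ∃ C, IsExpWeight α β (fun σ ζ => b₀ σ + b₁ σ * ζ + b₂ σ * ζ ^ 2) C 2 := by
  obtain ⟨C, hC⟩ := isCompact_Icc.exists_bound_of_continuousOn (s := Icc α β)
    (f := fun σ => |b₀ σ| + |b₁ σ| + |b₂ σ|) (by fun_prop)
  refine ⟨max C 0, le_max_right _ _, Continuous.measurable (by fun_prop), fun σ hσ ζ => ?_⟩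
  have h := (le_abs_self _).trans (hC σ (Ioo_subset_Icc_self hσ))
  have e1 : 1 + |ζ| ≤ Real.exp |ζ| := by linarith [Real.add_one_le_exp |ζ|]
  have e2 : Real.exp (2 * |ζ|) = Real.exp |ζ| ^ 2 := by rw [← Real.exp_nat_mul]; norm_num
  have e3 : (1 + |ζ|) ^ 2 ≤ Real.exp (2 * |ζ|) := by rw [e2]; gcongr
  have hz := abs_nonneg ζ
  have hz2 := sq_nonneg |ζ|
  calc |b₀ σ + b₁ σ * ζ + b₂ σ * ζ ^ 2| ≤ |b₀ σ| + |b₁ σ| * |ζ| + |b₂ σ| * |ζ| ^ 2 := by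
        refine (abs_add_le _ _).trans (add_le_add ((abs_add_le _ _).trans_eq ?_) ?_)
        · rw [abs_mul]
        · rw [abs_mul, abs_pow]
    _ ≤ |b₀ σ| * Real.exp (2 * |ζ|) + |b₁ σ| * Real.exp (2 * |ζ|) + |b₂ σ| * Real.exp (2 * |ζ|) :=
        by
        have : 1 ≤ Real.exp (2 * |ζ|) := Real.one_le_exp (by positivity)
        gcongr
        · exact le_mul_of_one_le_right (abs_nonneg _) this
        · nlinarith
        · nlinarith
    _ = (|b₀ σ| + |b₁ σ| + |b₂ σ|) * Real.exp (2 * |ζ|) := by ring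
    _ ≤ _ := by
        gcongr
        exact h.trans (le_max_left _ _)

/-- A test function composed with the inverse substitution decays exponentially in `x`, at any
prescribed rate `b`. -/
theorem stripInv_bound (H : IsStripParams κ θ α β) (hφ : IsTestFun (strip α β) φ) {b : ℝ}
    (hb : 0 ≤ b) (T : ℝ) : ∃ C : ℝ, 0 ≤ C ∧ ∀ t ∈ Icc 0 T, ∀ (q : ℝ × ℝ) (ζ : ℝ),
      ‖φ (stripInv κ θ t q ζ)‖
        ≤ C * Real.exp (b * √(2 * (β ^ 2 / 2 * T)) * |ζ|) * Real.exp (-b * |q.2|) := by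
  obtain ⟨R, hR⟩ := hφ.compact.exists_radius
  obtain ⟨B, hB⟩ := hφ.smooth.continuous.bounded_above_of_compact_support hφ.compact
  have hB0 : 0 ≤ B := (norm_nonneg _).trans (hB 0)
  refine ⟨B * Real.exp (b * (R + β ^ 2 / 2 * T)), by positivity, fun t ht q ζ => ?_⟩
  by_cases h0 : φ (stripInv κ θ t q ζ) = 0
  · rw [h0, norm_zero]; positivity
  have hm : deltaFlow κ θ (-t) q.1 ∈ Ioo α β := by
    by_contra h
    exact h0 (hφ.eq_zero fun h' => h h'.1)
  have h2 := mul_le_mul_of_nonneg_left (abs_strip_shift_le H ht.1 ht.2 hm ζ) hb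
  have h1 := norm_le_mul_exp_of_ne_zero (R := R) (s := frakD κ θ t (deltaFlow κ θ (-t) q.1)
      + √(2 * frakD κ θ t (deltaFlow κ θ (-t) q.1)) * ζ) (x := q.2) hb (hB (stripInv κ θ t q ζ))
    (fun h => by
      have := (norm_snd_le (stripInv κ θ t q ζ)).trans (hR _ h)
      rw [stripInv_eq H] at this
      exact this)
  refine h1.trans ?_
  calc _ ≤ B * Real.exp (b * (R + β ^ 2 / 2 * T) + b * √(2 * (β ^ 2 / 2 * T)) * |ζ|)
        * Real.exp (-b * |q.2|) := by
        gcongr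
        linarith
    _ = _ := by rw [Real.exp_add]; ring

theorem continuous_stripInv (κ θ : ℝ) :
    Continuous fun r : (ℝ × (ℝ × ℝ)) × ℝ => stripInv κ θ r.1.1 r.1.2 r.2 := by
  unfold stripInv; fun_prop

theorem integrable_stripDual_kernel (H : IsStripParams κ θ α β) (hp : IsExpWeight α β p C c)
    (hφ : IsTestFun (strip α β) φ) (ht : 0 ≤ t) (k : L2Strip α β lam) :
    Integrable (fun r : ℝ × (ℝ × ℝ) =>
      (p (deltaFlow κ θ (-t) r.2.1) r.1 * φ (stripInv κ θ t r.2 r.1)) • k r.2)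
      (stdGauss.prod (volume.restrict (strip α β))) := by
  obtain ⟨C', hC0, hC⟩ := stripInv_bound H hφ (b := |lam| + 1) (by positivity) t
  set w := √(2 * (β ^ 2 / 2 * t)) with hw
  have h1 := ((integrable_exp_abs_stdGauss (c + (|lam| + 1) * w)).const_mul (C * C')).mul_prod
    (integrable_exp_mul_strip α β lam k).norm
  have hk := Lp.stronglyMeasurable k
  have hφc := hφ.smooth.continuous
  have hi : Continuous fun r : ℝ × (ℝ × ℝ) => φ (stripInv κ θ t r.2 r.1) :=
    hφc.comp ((continuous_stripInv κ θ).comp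
      (by fun_prop : Continuous fun r : ℝ × (ℝ × ℝ) => ((t, r.2), r.1)))
  have hpm : Measurable fun r : ℝ × (ℝ × ℝ) => p (deltaFlow κ θ (-t) r.2.1) r.1 :=
    hp.meas.comp (Continuous.measurable (by fun_prop) :
      Measurable fun r : ℝ × (ℝ × ℝ) => (deltaFlow κ θ (-t) r.2.1, r.1))
  refine h1.mono' (((hpm.mul hi.measurable).stronglyMeasurable).aestronglyMeasurable.smul
    (hk.comp_measurable measurable_snd).aestronglyMeasurable) (Eventually.of_forall fun r => ?_)
  rw [norm_smul, norm_smul, Real.norm_of_nonneg (Real.exp_nonneg _), norm_mul, ← mul_assoc]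
  refine mul_le_mul_of_nonneg_right ?_ (norm_nonneg _)
  by_cases h0 : φ (stripInv κ θ t r.2 r.1) = 0
  · rw [h0, norm_zero, mul_zero]
    have := hp.nonneg
    positivity
  have hm : deltaFlow κ θ (-t) r.2.1 ∈ Ioo α β := by
    by_contra h
    exact h0 (hφ.eq_zero fun h' => h h'.1)
  calc _ ≤ (C * Real.exp (c * |r.1|)) *
        (C' * Real.exp ((|lam| + 1) * w * |r.1|) * Real.exp (-(|lam| + 1) * |r.2.2|)) := by
        have := hp.nonneg
        gcongr
        · exact hp.bound _ hm _
        · exact hC t ⟨ht, le_rfl⟩ r.2 r.1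
    _ = _ := by rw [add_mul c, Real.exp_add]; ring

/-- The pairing of a weighted superposition with a test function, in dual form. -/
theorem integral_test_weightedOp_dual (H : IsStripParams κ θ α β) (hp : IsExpWeight α β p C c)
    (hφ : IsTestFun (strip α β) φ) (ht : 0 ≤ t) (k : L2Strip α β lam) :
    ∫ q in strip α β, φ q • weightedOp H lam hp ht k q
      = ∫ q in strip α β, (Real.exp (κ * t) * ∫ ζ, p (deltaFlow κ θ (-t) q.1) ζ
          * φ (stripInv κ θ t q ζ) ∂stdGauss) • k q := by
  rw [integral_test_weightedOp H hp ht hφ]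
  have e : ∀ ζ, ∫ q in strip α β, (p q.1 ζ * φ q) • k (stripSubst κ θ t q ζ)
      = Real.exp (κ * t) • ∫ q in strip α β,
        (p (deltaFlow κ θ (-t) q.1) ζ * φ (stripInv κ θ t q ζ)) • k q := fun ζ =>
    integral_smul_stripSubst H ht (χ := fun q => p q.1 ζ * φ q)
      (fun q hq => by rw [hφ.eq_zero hq, mul_zero]) k ζ
  simp only [e]
  rw [integral_smul, integral_integral_swap (f := fun ζ q =>
    (p (deltaFlow κ θ (-t) q.1) ζ * φ (stripInv κ θ t q ζ)) • k q)
    (integrable_stripDual_kernel H hp hφ ht k), ← integral_smul]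
  congr 1; ext q
  rw [integral_smul_const, smul_smul]

/-- Stein's identity for the superpositions: the weight `ζ` amounts to `-√(2𝔇) ∂ₓ`. -/
theorem weightedOp_id_eq (H : IsStripParams κ θ α β) {k kx : L2Strip α β lam} {C' c' : ℝ}
    (hz : IsExpWeight α β (fun _ ζ => ζ) C c) (ht : 0 < t)
    (hw : IsExpWeight α β (fun σ _ => √(2 * frakD κ θ t σ)) C' c')
    (hx : HasWeakDeriv (strip α β) ((0, 1) : ℝ × ℝ) k kx) :
    weightedOp H lam hz ht.le k = -weightedOp H lam hw ht.le kx := by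
  have hμ := isWeightedDomain_strip α β lam
  refine hμ.eq_of_integral_eq fun φ hφ => ?_
  have e1 := (hasWeakDeriv_weightedOp_space H hw (fun _ => contDiff_sqrt_frakD H ht) ht
      hx).integral_eq hφ
  have e2 : ∫ q in strip α β, φ q • (-weightedOp H lam hw ht.le kx : L2Strip α β lam) q
      = -∫ q in strip α β, φ q • weightedOp H lam hw ht.le kx q := by
    obtain ⟨Λ, hΛ⟩ := hμ.exists_pairing hφ
    rw [← hΛ, ← hΛ, map_neg]
  rw [e2, ← e1, integral_test_weightedOp_dual H hz hφ ht.le,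
    integral_test_weightedOp_dual H hw (hφ.fderiv_apply (0, 1)) ht.le]
  congr 1; ext q; congr 2
  have hxx := hφ.fderiv_apply ((0, 1) : ℝ × ℝ)
  obtain ⟨B1, hB1⟩ := hφ.smooth.continuous.bounded_above_of_compact_support hφ.compact
  obtain ⟨B2, hB2⟩ := hxx.smooth.continuous.bounded_above_of_compact_support hxx.compact
  set w := √(2 * frakD κ θ t (deltaFlow κ θ (-t) q.1)) with hwd
  have hb1 : 0 ≤ B1 := (norm_nonneg _).trans (hB1 0)
  have hb2 : 0 ≤ B2 := (norm_nonneg _).trans (hB2 0)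
  have hw0 : 0 ≤ w := Real.sqrt_nonneg _
  refine integral_mul_stdGauss (F := fun ζ => φ (stripInv κ θ t q ζ))
    (F' := fun ζ => w * fderiv ℝ φ (stripInv κ θ t q ζ) (0, 1)) (B := B1 + w * B2) (fun ζ => ?_) ?_
    (fun ζ => (hB1 _).trans (by nlinarith)) (fun ζ => ?_)
  · have h1 : HasDerivAt (fun ζ => stripInv κ θ t q ζ) (w • ((0, 1) : ℝ × ℝ)) ζ := by
      simp only [stripInv_eq H]
      have := (hasDerivAt_const ζ (deltaFlow κ θ (-t) q.1)).prodMk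
        ((((hasDerivAt_id ζ).const_mul w).const_add
          (frakD κ θ t (deltaFlow κ θ (-t) q.1))).const_add q.2)
      refine this.congr_deriv ?_
      ext <;> simp
    have := (hφ.smooth.differentiable (by simp) (stripInv κ θ t q ζ)).hasFDerivAt.comp_hasDerivAt
        ζ h1
    rwa [map_smul, smul_eq_mul] at this
  · exact continuous_const.mul (hxx.smooth.continuous.comp ((continuous_stripInv κ θ).comp
      (by fun_prop : Continuous fun ζ : ℝ => ((t, q), ζ))))
  · rw [abs_mul, abs_of_nonneg hw0]
    have : |fderiv ℝ φ (stripInv κ θ t q ζ) (0, 1)| ≤ B2 := hB2 _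
    nlinarith

end StripDual

/-! ### The semigroup preserves the Sobolev space and commutes with `L₀` -/

section StripInvariance

variable {κ θ α β lam : ℝ} {t : ℝ}

theorem weightedOp_zero (H : IsStripParams κ θ α β) {C c : ℝ}
    (hp : IsExpWeight α β (fun _ _ => 0) C c) (ht : 0 ≤ t) (k : L2Strip α β lam) :
    weightedOp H lam hp ht k = 0 := by
  refine Lp.ext ((coeFn_weightedOp H hp ht k).trans ?_)
  refine EventuallyEq.trans ?_ (Lp.coeFn_zero ..).symm
  exact Eventually.of_forall fun q => by simp [superpose]

theorem isExpWeight_zero (α β : ℝ) : IsExpWeight α β (fun _ _ => 0) 0 0 :=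
  ⟨le_rfl, measurable_const, fun _ _ _ => by simp⟩

theorem exists_isExpWeight_shiftDs (H : IsStripParams κ θ α β) (ht : 0 < t) :
    ∃ C, IsExpWeight α β (shiftDs κ θ t) C 2 := by
  obtain ⟨C, hC⟩ := exists_isExpWeight α β (contDiff_frakDs (κ := κ) (θ := θ) t).continuous
    (contDiff_frakDs_div H ht).continuous continuous_zero
  refine ⟨C, ?_⟩
  convert hC using 3
  simp [shiftDs]

theorem hasWeakDeriv_stripOp_space (H : IsStripParams κ θ α β) {k kx : L2Strip α β lam} (ht : 0 < t)
    (hx : HasWeakDeriv (strip α β) ((0, 1) : ℝ × ℝ) k kx) :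
    HasWeakDeriv (strip α β) ((0, 1) : ℝ × ℝ) (stripOp H lam t k) (stripOp H lam t kx) := by
  rw [stripOp_eq H ht.le]
  exact hasWeakDeriv_weightedOp_space H _ (fun _ => contDiff_const) ht hx

theorem hasWeakDeriv_stripOp_flow (H : IsStripParams κ θ α β) {k ks kx : L2Strip α β lam} {C c : ℝ}
    (ht : 0 < t) (ha : IsExpWeight α β (shiftDs κ θ t) C c)
    (hs : HasWeakDeriv (strip α β) ((1, 0) : ℝ × ℝ) k ks)
    (hx : HasWeakDeriv (strip α β) ((0, 1) : ℝ × ℝ) k kx) :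
    HasWeakDeriv (strip α β) ((1, 0) : ℝ × ℝ) (stripOp H lam t k)
      (Real.exp (-κ * t) • stripOp H lam t ks - weightedOp H lam ha ht.le kx : L2Strip α β lam) :=
          by
  have := hasWeakDeriv_weightedOp_flow H (isExpWeight_one α β) (isExpWeight_zero α β) ha
    (fun _ => contDiff_const) (fun _ _ => hasDerivAt_const _ _) ht (fun _ _ => (one_mul _).symm)
        hs hx
  rwa [weightedOp_zero, zero_add, ← stripOp_eq H ht.le] at this

/-- Derivatives in the two coordinate directions suffice for membership in `H²`. -/
theorem memSobolev_two_of_strip {f fs fx fss fsx fxs fxx : L2Strip α β lam}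
    (hs : HasWeakDeriv (strip α β) ((1, 0) : ℝ × ℝ) f fs)
    (hx : HasWeakDeriv (strip α β) ((0, 1) : ℝ × ℝ) f fx)
    (hss : HasWeakDeriv (strip α β) ((1, 0) : ℝ × ℝ) fs fss)
    (hsx : HasWeakDeriv (strip α β) ((0, 1) : ℝ × ℝ) fs fsx)
    (hxs : HasWeakDeriv (strip α β) ((1, 0) : ℝ × ℝ) fx fxs)
    (hxx : HasWeakDeriv (strip α β) ((0, 1) : ℝ × ℝ) fx fxx) :
    MemSobolev (strip α β) (stripMeasure α β lam) 2 f := by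
  have hμ := isWeightedDomain_strip α β lam
  have key : ∀ {f g g' : L2Strip α β lam} (v : ℝ × ℝ),
      HasWeakDeriv (strip α β) ((1, 0) : ℝ × ℝ) f g →
      HasWeakDeriv (strip α β) ((0, 1) : ℝ × ℝ) f g' →
      HasWeakDeriv (strip α β) v f (v.1 • g + v.2 • g' : L2Strip α β lam) := fun v h h' => by
    have := hμ.hasWeakDeriv_comb h h' v.1 v.2
    simpa using this
  intro v
  refine ⟨_, key v hs hx, fun w => ⟨_, hμ.hasWeakDeriv_add (hμ.hasWeakDeriv_smul v.1 (key w hss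
      hsx))
    (hμ.hasWeakDeriv_smul v.2 (key w hxs hxx)), trivial⟩⟩

/-- The semigroup preserves `H²`. The second derivative in `σ` involves the derivative and the
    square
of the weight `shiftDs`, which are polynomials in `ζ` of degree one and two. -/
theorem memSobolev_stripOp (H : IsStripParams κ θ α β) {f : L2Strip α β lam} (ht : 0 < t)
    (hf : MemSobolev (strip α β) (stripMeasure α β lam) 2 f) :
    MemSobolev (strip α β) (stripMeasure α β lam) 2 (stripOp H lam t f) := by
  have hμ := isWeightedDomain_strip α β lam
  obtain ⟨fs, hs, ms⟩ := hf (1, 0)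
  obtain ⟨fx, hx, mx⟩ := hf (0, 1)
  obtain ⟨fss, hss, -⟩ := ms (1, 0)
  obtain ⟨fsx, hsx, -⟩ := ms (0, 1)
  obtain ⟨fxs, hxs, -⟩ := mx (1, 0)
  obtain ⟨fxx, hxx, -⟩ := mx (0, 1)
  obtain ⟨C, ha⟩ := exists_isExpWeight_shiftDs H ht
  have hb0 := contDiff_frakDs (κ := κ) (θ := θ) t
  have hb1 := contDiff_frakDs_div H ht
  -- the derivative and the square of the weight `shiftDs`
  have hdd : ∀ {b : ℝ → ℝ}, ContDiff ℝ ∞ b → Continuous (deriv b) ∧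
      ∀ σ, HasDerivAt b (deriv b σ) σ := fun hb =>
    ⟨(contDiff_infty_iff_deriv.1 hb).2.continuous,
      fun σ => (hb.differentiable (by simp) σ).hasDerivAt⟩
  obtain ⟨C', ha'⟩ := exists_isExpWeight α β (hdd hb0).1 (hdd hb1).1 continuous_zero
  obtain ⟨C'', haa⟩ := exists_isExpWeight α β (hb0.continuous.pow 2)
    ((continuous_const.mul hb0.continuous).mul hb1.continuous : Continuous fun σ =>
      2 * frakDs κ θ t σ * (frakDs κ θ t σ / √(2 * frakD κ θ t σ))) (hb1.continuous.pow 2)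
  have e1 := hasWeakDeriv_stripOp_flow H ht ha hs hx
  have e2 := hasWeakDeriv_stripOp_flow H ht ha hxs hxx
  have e3 := hasWeakDeriv_weightedOp_flow H ha ha' haa (contDiff_shiftDs H ht)
    (fun ζ σ => by
      have := ((hdd hb0).2 σ).add (((hdd hb1).2 σ).mul_const ζ)
      exact this.congr_deriv (by simp)) ht (fun σ ζ => by
      simp only [shiftDs, Pi.pow_apply, Pi.mul_apply]
      ring) hxs hxx
  exact memSobolev_two_of_strip e1 (hasWeakDeriv_stripOp_space H ht hx)
    (hμ.hasWeakDeriv_sub (hμ.hasWeakDeriv_smul _ (hasWeakDeriv_stripOp_flow H ht ha hss hsx)) e3)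
    (hμ.hasWeakDeriv_sub (hμ.hasWeakDeriv_smul _ (hasWeakDeriv_stripOp_space H ht hsx))
      (hasWeakDeriv_weightedOp_space H ha (contDiff_shiftDs H ht) ht hxx))
    (hasWeakDeriv_stripOp_flow H ht ha hxs hxx) (hasWeakDeriv_stripOp_space H ht hxx)

end StripInvariance

/-! ### The generator on the strip -/

section StripGenerator

variable {κ θ α β lam : ℝ} {t : ℝ}

theorem ae_integrable_weighted (H : IsStripParams κ θ α β) {p : ℝ → ℝ → ℝ} {C c : ℝ}
    (hp : IsExpWeight α β p C c) (ht : 0 ≤ t) (k : L2Strip α β lam) :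
    ∀ᵐ q ∂(stripMeasure α β lam),
      Integrable (fun ζ => p q.1 ζ • k (stripSubst κ θ t q ζ)) stdGauss :=
  (isSuperposition_stripSubst H lam hp ht le_rfl).ae_integrable (Lp.stronglyMeasurable k)
      (Lp.memLp k)

/-- By Stein's identity the weight `shiftDs` acts like `∂_σ 𝔇 (1 - ∂ₓ)`. -/
theorem weightedOp_shiftDs_ae (H : IsStripParams κ θ α β) {k kx : L2Strip α β lam} {C c : ℝ}
    (ht : 0 < t) (ha : IsExpWeight α β (shiftDs κ θ t) C c)
    (hx : HasWeakDeriv (strip α β) ((0, 1) : ℝ × ℝ) k kx) :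
    ∀ᵐ q ∂(stripMeasure α β lam), weightedOp H lam ha ht.le k q
      = frakDs κ θ t q.1 • (stripOp H lam t k q - stripOp H lam t kx q) := by
  obtain ⟨C₁, hz⟩ := exists_isExpWeight α β continuous_zero continuous_one continuous_zero
  obtain ⟨C₂, hw⟩ := exists_isExpWeight α β (contDiff_sqrt_frakD H ht).continuous continuous_zero
    continuous_zero
  have hz : IsExpWeight α β (fun _ ζ => ζ) C₁ 2 := by
    convert hz using 3; simp
  have hw : IsExpWeight α β (fun σ _ => √(2 * frakD κ θ t σ)) C₂ 2 := by
    convert hw using 3; simp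
  have e := weightedOp_id_eq H hz ht hw hx
  filter_upwards [coeFn_weightedOp H ha ht.le k, coeFn_weightedOp H hz ht.le k,
    coeFn_weightedOp H hw ht.le kx, coeFn_stripOp H ht.le k, coeFn_stripOp H ht.le kx,
    ae_integrable_weighted H hz ht.le k, ae_integrable_weighted H (isExpWeight_one α β) ht.le k,
    Lp.coeFn_neg (weightedOp H lam hw ht.le kx)] with q h1 h2 h3 h4 h5 i1 i2 h6
  rw [e, h6, Pi.neg_apply, h3] at h2
  have hD := frakD_pos H.κ_pos H.θ_pos ht q.1
  set w := √(2 * frakD κ θ t q.1) with hwd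
  have hw0 : w ≠ 0 := by positivity
  have e3 : superpose (stripSubst κ θ t) (fun q _ => √(2 * frakD κ θ t q.1)) kx q
      = w • stripOp H lam t kx q := by
    rw [h5]
    simp only [superpose, one_smul]
    exact integral_smul w _
  rw [e3] at h2
  simp only [superpose, one_smul] at h1 h2 h4 i2
  have e4 : ∀ ζ, shiftDs κ θ t q.1 ζ • k (stripSubst κ θ t q ζ)
      = frakDs κ θ t q.1 • k (stripSubst κ θ t q ζ)
        + (frakDs κ θ t q.1 / w) • (ζ • k (stripSubst κ θ t q ζ)) := fun ζ => by
    rw [shiftDs, add_smul, mul_smul]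
  have i3 : Integrable (fun ζ => frakDs κ θ t q.1 • k (stripSubst κ θ t q ζ)) stdGauss :=
    i2.smul (frakDs κ θ t q.1)
  have i4 : Integrable (fun ζ => (frakDs κ θ t q.1 / w) • (ζ • k (stripSubst κ θ t q ζ)))
    stdGauss := i1.smul (frakDs κ θ t q.1 / w)
  rw [h1]
  simp only [e4]
  rw [integral_add i3 i4, integral_smul, integral_smul, ← h4, ← h2, smul_neg, smul_smul,
    div_mul_cancel₀ _ hw0, smul_sub, sub_eq_add_neg]

/-- The semigroup preserves the domain of `L₀` and commutes with `L₀`. In the weak derivative in `σ`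
of `S(t) ξ` the term `-∂_σ 𝔇 (∂ₓ - ∂ₓ²) S(t) ξ` appears; the transport equation for `𝔇` combines it
with `(σ²/2) B S(t) ξ` to `(δ_t(σ)²/2) B S(t) ξ`. -/
theorem opL0_invariant (H : IsStripParams κ θ α β) {ξ η : L2Strip α β lam}
    (h : (ξ, η) ∈ opL0 κ θ α β lam) (ht : 0 ≤ t) :
    (stripOp H lam t ξ, stripOp H lam t η) ∈ opL0 κ θ α β lam := by
  rcases ht.eq_or_lt with rfl | ht0
  · rw [stripOp_zero]; exact h
  obtain ⟨hm, fs, fx, fxx, hs, hx, hxx, hη⟩ := h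
  have hη : ∀ᵐ q ∂(stripMeasure α β lam), η q = ((κ * (θ - q.1) : ℝ) : ℂ) * fs q
    + ((q.1 ^ 2 / 2 : ℝ) : ℂ) * (fxx q - fx q) := hη
  obtain ⟨C, ha⟩ := exists_isExpWeight_shiftDs H ht0
  refine ⟨memSobolev_stripOp H ht0 hm, _, stripOp H lam t fx, stripOp H lam t fxx,
    hasWeakDeriv_stripOp_flow H ht0 ha hs hx, hasWeakDeriv_stripOp_space H ht0 hx,
    hasWeakDeriv_stripOp_space H ht0 hxx, ?_⟩
  have hsup := isSuperposition_stripSubst H lam (isExpWeight_one α β) ht le_rfl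
  filter_upwards [weightedOp_shiftDs_ae H ht0 ha hxx, coeFn_stripOp H ht η, coeFn_stripOp H ht fs,
    coeFn_stripOp H ht fx, coeFn_stripOp H ht fxx,
    hsup.superpose_congr hη, ae_integrable_weighted H (isExpWeight_one α β) ht fs,
    ae_integrable_weighted H (isExpWeight_one α β) ht fx,
    ae_integrable_weighted H (isExpWeight_one α β) ht fxx,
    Lp.coeFn_sub (Real.exp (-κ * t) • stripOp H lam t fs) (weightedOp H lam ha ht0.le fx),
    Lp.coeFn_smul (Real.exp (-κ * t)) (stripOp H lam t fs)] with
    q e1 e2 e3 e4 e5 e6 i3 i4 i5 e7 e8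
  rw [e7, Pi.sub_apply, e8, Pi.smul_apply, e1, e2, e6, e3, e4, e5]
  simp only [one_smul] at i3 i4 i5
  simp only [superpose, one_smul]
  have e9 : ∀ ζ, (stripSubst κ θ t q ζ).1 = deltaFlow κ θ t q.1 := fun ζ => rfl
  simp only [e9]
  have i6 : Integrable (fun ζ => ((deltaFlow κ θ t q.1 ^ 2 / 2 : ℝ) : ℂ) *
      (fxx (stripSubst κ θ t q ζ) - fx (stripSubst κ θ t q ζ))) stdGauss := (i5.sub i4).const_mul _
  rw [integral_add (i3.const_mul _) i6, integral_const_mul,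
    integral_const_mul, integral_sub i5 i4]
  have a1 : κ * (θ - deltaFlow κ θ t q.1) = κ * (θ - q.1) * Real.exp (-κ * t) := by
    rw [deltaFlow_eq]; ring
  rw [a1, frakD_transport H.κ_pos.ne']
  simp only [Complex.real_smul]
  push_cast
  ring

/-- The formal adjoint of `L₀`, applied to a test function. -/
noncomputable def adjointL0 (κ θ : ℝ) (φ : ℝ × ℝ → ℝ) (q : ℝ × ℝ) : ℝ :=
  κ * φ q + -(κ * (θ - q.1)) * fderiv ℝ φ q (1, 0) + q.1 ^ 2 / 2 *
    (fderiv ℝ φ q (0, 1) + fderiv ℝ (fun r => fderiv ℝ φ r (0, 1)) q (0, 1))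

theorem IsTestFun.add {E : Type*} [NormedAddCommGroup E] [NormedSpace ℝ E] {Ω : Set E}
    {φ ψ : E → ℝ} (hφ : IsTestFun Ω φ) (hψ : IsTestFun Ω ψ) : IsTestFun Ω (fun p => φ p + ψ p) where
  smooth := hφ.smooth.add hψ.smooth
  compact := hφ.compact.add hψ.compact
  subset := (tsupport_add φ ψ).trans (union_subset hφ.subset hψ.subset)

theorem IsTestFun.adjointL0 {Ω : Set (ℝ × ℝ)} {φ : ℝ × ℝ → ℝ} (hφ : IsTestFun Ω φ) (κ θ : ℝ) :
    IsTestFun Ω (adjointL0 κ θ φ) :=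
  ((hφ.mul_left contDiff_const).add ((hφ.fderiv_apply (1, 0)).mul_left (by fun_prop))).add
    (((hφ.fderiv_apply (0, 1)).add ((hφ.fderiv_apply (0, 1)).fderiv_apply (0, 1))).mul_left
      (by fun_prop))

/-- `adjointL0` is the adjoint of `L₀` in the unweighted pairing with test functions. -/
theorem integral_adjointL0 {φ : ℝ × ℝ → ℝ} (hφ : IsTestFun (strip α β) φ) {ξ η : L2Strip α β lam}
    (h : (ξ, η) ∈ opL0 κ θ α β lam) :
    ∫ q in strip α β, adjointL0 κ θ φ q • ξ q = ∫ q in strip α β, φ q • η q := by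
  have hμ := isWeightedDomain_strip α β lam
  obtain ⟨-, fs, fx, fxx, hs, hx, hxx, hη⟩ := h
  have hη : ∀ᵐ q ∂(stripMeasure α β lam), η q = ((κ * (θ - q.1) : ℝ) : ℂ) * fs q
    + ((q.1 ^ 2 / 2 : ℝ) : ℂ) * (fxx q - fx q) := hη
  have hψ : IsTestFun (strip α β) (fun q => κ * (θ - q.1) * φ q) := hφ.mul_left (by fun_prop)
  have hω : IsTestFun (strip α β) (fun q => q.1 ^ 2 / 2 * φ q) := hφ.mul_left (by fun_prop)
  have hωx := hω.fderiv_apply ((0, 1) : ℝ × ℝ)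
  have d1 : ∀ q, fderiv ℝ (fun q => κ * (θ - q.1) * φ q) q (1, 0)
      = κ * (θ - q.1) * fderiv ℝ φ q (1, 0) - κ * φ q := fun q => by
    have ha : HasDerivAt (fun σ => κ * (θ - σ)) (-κ) q.1 :=
      (((hasDerivAt_id q.1).const_sub θ).const_mul κ).congr_deriv (by simp)
    rw [fderiv_mul_fst ha (hφ.smooth.differentiable (by simp) q)]
    ring
  have d2 : ∀ {χ : ℝ × ℝ → ℝ}, IsTestFun (strip α β) χ → ∀ q,
      fderiv ℝ (fun q => q.1 ^ 2 / 2 * χ q) q (0, 1) = q.1 ^ 2 / 2 * fderiv ℝ χ q (0, 1) :=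
    fun hχ q => by
      have ha : HasDerivAt (fun σ : ℝ => σ ^ 2 / 2) q.1 q.1 :=
        ((hasDerivAt_pow 2 q.1).div_const 2).congr_deriv (by simp)
      rw [fderiv_mul_fst ha (hχ.smooth.differentiable (by simp) q)]
      ring
  have d3 : (fun q => fderiv ℝ (fun q => q.1 ^ 2 / 2 * φ q) q (0, 1))
      = fun q => q.1 ^ 2 / 2 * fderiv ℝ φ q (0, 1) := funext (d2 hφ)
  have i1 := hμ.integrable_smul (hψ.fderiv_apply (1, 0)) ξ
  have i2 := hμ.integrable_smul hωx ξ
  have i3 := hμ.integrable_smul (hωx.fderiv_apply (0, 1)) ξ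
  have e1 : ∫ q in strip α β, adjointL0 κ θ φ q • ξ q
      = ∫ q in strip α β, (-(fderiv ℝ (fun q => κ * (θ - q.1) * φ q) q (1, 0) • ξ q)
        + fderiv ℝ (fun q => q.1 ^ 2 / 2 * φ q) q (0, 1) • ξ q)
        + fderiv ℝ (fun q => fderiv ℝ (fun q => q.1 ^ 2 / 2 * φ q) q (0, 1)) q (0, 1) • ξ q := by
    congr 1; ext q
    rw [d3, d1, d2 hφ, d2 (hφ.fderiv_apply (0, 1)), ← neg_smul, ← add_smul, ← add_smul]
    congr 1
    rw [_root_.adjointL0]; ring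
  have i4 := hμ.integrable_smul hψ fs
  have i5 := hμ.integrable_smul hω fx
  have i6 := hμ.integrable_smul hω fxx
  have e2 : ∫ q in strip α β, φ q • η q = ∫ q in strip α β, ((κ * (θ - q.1) * φ q) • fs q
      - (q.1 ^ 2 / 2 * φ q) • fx q) + (q.1 ^ 2 / 2 * φ q) • fxx q := by
    refine integral_congr_ae ((hμ.congr_ae hη).mono fun q hq => ?_)
    simp only [hq, Complex.real_smul]
    push_cast
    ring
  have i12 : Integrable (fun q => -(fderiv ℝ (fun q => κ * (θ - q.1) * φ q) q (1, 0) • ξ q)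
      + fderiv ℝ (fun q => q.1 ^ 2 / 2 * φ q) q (0, 1) • ξ q) (volume.restrict (strip α β)) :=
    i1.neg.add i2
  have i45 : Integrable (fun q => (κ * (θ - q.1) * φ q) • fs q - (q.1 ^ 2 / 2 * φ q) • fx q)
      (volume.restrict (strip α β)) := i4.sub i5
  have i1' : Integrable (fun q => -(fderiv ℝ (fun q => κ * (θ - q.1) * φ q) q (1, 0) • ξ q))
      (volume.restrict (strip α β)) := i1.neg
  rw [e1, e2, integral_add i12 i3, integral_add i1' i2, integral_neg,
    integral_add i45 i6, integral_sub i4 i5, hs.integral_eq hψ, hx.integral_eq hω,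
    hx.integral_eq hωx, hxx.integral_eq hω]
  ring

/-- The dual of the semigroup on test functions. -/
noncomputable def stripDual (κ θ : ℝ) (φ : ℝ × ℝ → ℝ) (t : ℝ) (q : ℝ × ℝ) : ℝ :=
  Real.exp (κ * t) * ∫ ζ, φ (stripInv κ θ t q ζ) ∂stdGauss

theorem integral_test_stripOp (H : IsStripParams κ θ α β) {φ : ℝ × ℝ → ℝ}
    (hφ : IsTestFun (strip α β) φ) (ht : 0 ≤ t) (k : L2Strip α β lam) :
    ∫ q in strip α β, φ q • stripOp H lam t k q = ∫ q in strip α β, stripDual κ θ φ t q • k q := by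
  rw [stripOp_eq H ht, integral_test_weightedOp_dual H _ hφ ht]
  simp only [one_mul, stripDual]

theorem integrable_stripDual_smul (H : IsStripParams κ θ α β) {φ : ℝ × ℝ → ℝ}
    (hφ : IsTestFun (strip α β) φ) (ht : 0 ≤ t) (k : L2Strip α β lam) :
    Integrable (fun q => stripDual κ θ φ t q • k q) (volume.restrict (strip α β)) := by
  refine ((integrable_stripDual_kernel H (isExpWeight_one α β) hφ ht k).integral_prod_right.smul
    (Real.exp (κ * t))).congr (Eventually.of_forall fun q => ?_)
  simp only [one_mul, Pi.smul_apply, stripDual]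
  rw [integral_smul_const, smul_smul]

/-- The weak evolution equation of the semigroup, from the pointwise evolution of `stripDual`. -/
theorem stripOp_weak_evolution (H : IsStripParams κ θ α β) {φ : ℝ × ℝ → ℝ}
    (hφ : IsTestFun (strip α β) φ) (ht : 0 ≤ t) (k : L2Strip α β lam) :
    (∫ q in strip α β, φ q • stripOp H lam t k q) - ∫ q in strip α β, φ q • stripOp H lam 0 k q
      = ∫ s in (0 : ℝ)..t, ∫ q in strip α β, adjointL0 κ θ φ q • stripOp H lam s k q := by
  have hκ := H.κ_pos
  have hL := hφ.adjointL0 κ θ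
  obtain ⟨C, hC0, hC⟩ := stripInv_bound H hL (b := |lam| + 1) (by positivity) t
  set w := √(2 * (β ^ 2 / 2 * t)) with hw
  refine weak_evolution (Ψ := stripDual κ θ φ) (ΨL := stripDual κ θ (adjointL0 κ θ φ))
    (G := fun q => Real.exp (κ * t) * (C * gaussMoment ((|lam| + 1) * w))
      * Real.exp (-(|lam| + 1) * |q.2|)) ht
    (fun s hs => integral_test_stripOp H hφ hs.1 k) (fun s hs => integral_test_stripOp H hL hs.1 k)
    (fun s hs => integrable_stripDual_smul H hφ hs.1 k) (fun q => ?_) ?_ ?_ ?_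
  · have hs := hφ.fderiv_apply ((1, 0) : ℝ × ℝ)
    have hx := hφ.fderiv_apply ((0, 1) : ℝ × ℝ)
    have hxx := hx.fderiv_apply ((0, 1) : ℝ × ℝ)
    obtain ⟨B1, hB1⟩ := hφ.smooth.continuous.bounded_above_of_compact_support hφ.compact
    obtain ⟨B2, hB2⟩ := hx.smooth.continuous.bounded_above_of_compact_support hx.compact
    obtain ⟨B3, hB3⟩ := hxx.smooth.continuous.bounded_above_of_compact_support hxx.compact
    obtain ⟨B4, hB4⟩ := hs.smooth.continuous.bounded_above_of_compact_support hs.compact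
    have hB01 : 0 ≤ B1 := (norm_nonneg _).trans (hB1 0)
    have hB02 : 0 ≤ B2 := (norm_nonneg _).trans (hB2 0)
    have hB03 : 0 ≤ B3 := (norm_nonneg _).trans (hB3 0)
    have hB04 : 0 ≤ B4 := (norm_nonneg _).trans (hB4 0)
    have := gaussian_evolution (φ := φ) (φs := fun p => fderiv ℝ φ p (1, 0))
      (φx := fun p => fderiv ℝ φ p (0, 1))
      (φxx := fun p => fderiv ℝ (fun r => fderiv ℝ φ r (0, 1)) p (0, 1)) (B := B1 + B2 + B3 + B4)
      (fun p => by
        refine (hφ.smooth.differentiable (by simp) p).hasFDerivAt.congr_fderiv ?_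
        refine ContinuousLinearMap.ext fun v => ?_
        have hv : v = v.1 • ((1, 0) : ℝ × ℝ) + v.2 • ((0, 1) : ℝ × ℝ) := by ext <;> simp
        conv_lhs => rw [hv, map_add, map_smul, map_smul]
        simp [mul_comm])
      (fun p => by
        have h1 := (hx.smooth.differentiable (by simp) p).hasFDerivAt
        have h2 : HasDerivAt (fun y : ℝ => (p.1, y)) ((0, 1) : ℝ × ℝ) p.2 :=
          (hasDerivAt_const p.2 p.1).prodMk (hasDerivAt_id p.2)
        have h3 : HasFDerivAt (fun r => fderiv ℝ φ r (0, 1)) _ (p.1, p.2) := h1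
        exact h3.comp_hasDerivAt p.2 h2)
      hs.smooth.continuous hx.smooth.continuous hxx.smooth.continuous
      (fun p => (hB1 p).trans (by linarith)) (fun p => (hB4 p).trans (by linarith))
      (fun p => (hB2 p).trans (by linarith)) (fun p => (hB3 p).trans (by linarith))
      (c := fun t => deltaFlow κ θ (-t) q.1) (d := fun t => -frakD κ θ (-t) q.1)
      (V := fun c => -(κ * (θ - c))) (W := fun c => c ^ 2 / 2)
      (by fun_prop) (by fun_prop)
      (fun t => ((hasDerivAt_deltaFlow_time (-t) q.1).scomp t (hasDerivAt_neg t)).congr_deriv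
        (by simp))
      (fun t => ((hasDerivAt_frakD_time hκ.ne' (-t) q.1).scomp t (hasDerivAt_neg t)).neg.congr_deriv
        (by simp))
      (fun t ht => by rw [neg_frakD_neg hκ.ne']; exact frakD_pos hκ H.θ_pos ht _) κ q.2 ht
    simp only [add_assoc q.2] at this
    have e0 : Real.exp (κ * 0) = 1 := by simp
    rw [stripDual, stripDual, e0, one_mul]
    exact this
  · have : StronglyMeasurable fun r : ((ℝ × ℝ) × ℝ) × ℝ =>
        adjointL0 κ θ φ (stripInv κ θ r.1.2 r.1.1 r.2) :=
      (hL.smooth.continuous.comp ((continuous_stripInv κ θ).comp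
        (by fun_prop : Continuous fun r : ((ℝ × ℝ) × ℝ) × ℝ => ((r.1.2, r.1.1),
            r.2)))).stronglyMeasurable
    exact (by fun_prop : Measurable fun r : (ℝ × ℝ) × ℝ => Real.exp (κ * r.2)).mul
      (this.integral_prod_right' (ν := stdGauss)).measurable
  · refine ((integrable_exp_mul_strip α β lam k).smul
      (Real.exp (κ * t) * (C * gaussMoment ((|lam| + 1) * w)))).congr
      (Eventually.of_forall fun q => ?_)
    simp only [Pi.smul_apply, smul_smul]
  · refine Eventually.of_forall fun q s hs => ?_
    have h1 := norm_integral_le_of_norm_le (μ := stdGauss)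
      (((integrable_exp_abs_stdGauss ((|lam| + 1) * w)).const_mul C).mul_const
        (Real.exp (-(|lam| + 1) * |q.2|)))
      (Eventually.of_forall fun ζ => hC s hs q ζ)
    rw [integral_mul_const, integral_const_mul] at h1
    rw [stripDual, abs_mul, abs_of_pos (Real.exp_pos _), mul_assoc]
    refine mul_le_mul (Real.exp_le_exp.2 ?_) h1 (abs_nonneg _) (Real.exp_nonneg _)
    exact mul_le_mul_of_nonneg_left hs.2 hκ.le

theorem stripOp_sub_eq_integral (H : IsStripParams κ θ α β) {ξ η : L2Strip α β lam}
    (h : (ξ, η) ∈ opL0 κ θ α β lam) (ht : 0 ≤ t) :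
    stripOp H lam t ξ - ξ = ∫ s in (0 : ℝ)..t, stripOp H lam s η := by
  have hμ := isWeightedDomain_strip α β lam
  have hC : IsC0Semigroup (stripOp H lam) := isC0Semigroup_stripOp H
  refine hμ.eq_of_integral_eq fun φ hφ => ?_
  obtain ⟨Λ, hΛ⟩ := hμ.exists_pairing hφ
  rw [← hΛ, ← hΛ, map_sub, ← ContinuousLinearMap.intervalIntegral_comp_comm _
    (hC.intervalIntegrable η ht)]
  have h0 : stripOp H lam 0 ξ = ξ := by rw [stripOp_zero]; rfl
  have e := stripOp_weak_evolution H hφ ht ξ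
  rw [h0, ← hΛ, ← hΛ] at e
  rw [e]
  refine intervalIntegral.integral_congr fun s hs => ?_
  rw [uIcc_of_le ht] at hs
  change ∫ q in strip α β, adjointL0 κ θ φ q • stripOp H lam s ξ q = Λ (stripOp H lam s η)
  rw [integral_adjointL0 hφ (opL0_invariant H h hs.1), hΛ]

theorem convex_opL0 : Convex ℝ (opL0 κ θ α β lam) := by
  have hμ := isWeightedDomain_strip α β lam
  rintro ⟨ξ, η⟩ ⟨hm, fs, fx, fxx, h0, h1, h2, h3⟩ ⟨ξ', η'⟩ ⟨hm', fs', fx', fxx', h0', h1', h2', h3'⟩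
    a b - - -
  refine ⟨hμ.memSobolev_add (hμ.memSobolev_smul a hm) (hμ.memSobolev_smul b hm'), _, _, _,
    hμ.hasWeakDeriv_add (hμ.hasWeakDeriv_smul a h0) (hμ.hasWeakDeriv_smul b h0'),
    hμ.hasWeakDeriv_add (hμ.hasWeakDeriv_smul a h1) (hμ.hasWeakDeriv_smul b h1'),
    hμ.hasWeakDeriv_add (hμ.hasWeakDeriv_smul a h2) (hμ.hasWeakDeriv_smul b h2'), ?_⟩
  have hc : ∀ f g : L2Strip α β lam, ∀ᵐ q ∂(stripMeasure α β lam),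
      (a • f + b • g : L2Strip α β lam) q = a • f q + b • g q := fun f g => by
    filter_upwards [Lp.coeFn_add (a • f) (b • g), Lp.coeFn_smul a f, Lp.coeFn_smul b g]
      with q e1 e2 e3
    rw [e1, Pi.add_apply, e2, e3, Pi.smul_apply, Pi.smul_apply]
  filter_upwards [h3, h3', hc η η', hc fs fs', hc fx fx', hc fxx fxx'] with q e1 e2 e3 e4 e5 e6
  change (a • η + b • η' : L2Strip α β lam) q = _
  have e1 : η q = _ := e1
  have e2 : η' q = _ := e2
  rw [e3, e4, e5, e6, e1, e2]
  simp only [Complex.real_smul]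
  ring

/-- The coefficients of `L₀` are bounded on the strip, so `L₀` is defined on all of `H²`. -/
theorem exists_of_memSobolev_strip {f : L2Strip α β lam}
    (h : MemSobolev (strip α β) (stripMeasure α β lam) 2 f) : ∃ η, (f, η) ∈ opL0 κ θ α β lam := by
  obtain ⟨fs, hs, -⟩ := h (1, 0)
  obtain ⟨fx, hx, mx⟩ := h (0, 1)
  obtain ⟨fxx, hxx, -⟩ := mx (0, 1)
  have key : ∀ {a : ℝ → ℝ}, Continuous a → ∀ g : L2Strip α β lam,
      MemLp (fun q => ((a q.1 : ℝ) : ℂ) * g q) 2 (stripMeasure α β lam) := fun {a} ha g => by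
    obtain ⟨C, hC⟩ := isCompact_Icc.exists_bound_of_continuousOn (s := Icc α β) ha.continuousOn
    refine MemLp.of_le_mul (c := C) (Lp.memLp g) ?_ ?_
    · exact ((by fun_prop : Continuous fun q : ℝ × ℝ => ((a q.1 : ℝ) : ℂ)).stronglyMeasurable.mul
        (Lp.stronglyMeasurable g)).aestronglyMeasurable
    · filter_upwards [ae_stripMeasure_mem α β lam] with q hq
      rw [norm_mul, Complex.norm_real]
      exact mul_le_mul_of_nonneg_right (hC _ (Ioo_subset_Icc_self hq.1)) (norm_nonneg _)
  have hm := (key (by fun_prop : Continuous fun σ => κ * (θ - σ)) fs).add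
    (key (by fun_prop : Continuous fun σ : ℝ => σ ^ 2 / 2) (fxx - fx))
  refine ⟨hm.toLp _, h, fs, fx, fxx, hs, hx, hxx, ?_⟩
  filter_upwards [hm.coeFn_toLp, Lp.coeFn_sub fxx fx] with q h1 h2
  change hm.toLp _ q = _
  rw [h1, Pi.add_apply, h2, Pi.sub_apply]

/-- The closure of `L₀` generates the semigroup `stripOp`. -/
theorem generates_opL0 (H : IsStripParams κ θ α β) :
    Generates (opL0 κ θ α β lam) (stripOp H lam) := by
  refine generates_of_invariant_dense (isC0Semigroup_stripOp H) convex_opL0 ?_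
    (fun _ _ h _ ht => opL0_invariant H h ht) (fun _ _ h _ ht => stripOp_sub_eq_integral H h ht)
  exact ((isWeightedDomain_strip α β lam).dense_memSobolev 2).mono fun f hf =>
    exists_of_memSobolev_strip hf

end StripGenerator

/-! ### Slices and the explicit kernel -/

section Slices

variable {κ θ α β lam : ℝ} {t : ℝ}

theorem ae_memLp_slice (h : L2Strip α β lam) : ∀ᵐ σ ∂((volume : Measure ℝ).restrict (Ioo α β)),
    MemLp (fun x => h (σ, x)) 2 (weightMeasure lam) := by
  have hk := Lp.stronglyMeasurable h
  have h1 : ∫⁻ q, ‖h q‖ₑ ^ 2 ∂(((volume : Measure ℝ).restrict (Ioo α β)).prod (weightMeasure lam))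
      < ⊤ :=
    (memLp_two_iff hk.aestronglyMeasurable).1 (Lp.memLp h)
  rw [lintegral_prod _ (hk.measurable.enorm.pow_const 2).aemeasurable] at h1
  filter_upwards [ae_lt_top (hk.measurable.enorm.pow_const 2).lintegral_prod_right' h1.ne] with σ hσ
  exact (memLp_two_iff (hk.comp_measurable measurable_prodMk_left).aestronglyMeasurable).2 hσ

/-- The flow is nonsingular: it pulls null sets back to null sets. -/
theorem ae_deltaFlow (H : IsStripParams κ θ α β) (ht : 0 ≤ t) {P : ℝ → Prop}
    (hP : ∀ᵐ σ ∂((volume : Measure ℝ).restrict (Ioo α β)), P σ) :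
    ∀ᵐ σ ∂((volume : Measure ℝ).restrict (Ioo α β)), P (deltaFlow κ θ t σ) := by
  rw [ae_restrict_iff' measurableSet_Ioo] at hP ⊢
  have hq : Measure.QuasiMeasurePreserving (fun σ => deltaFlow κ θ t σ) volume volume :=
    ⟨Continuous.measurable (by fun_prop), by
      rw [map_deltaFlow]; exact Measure.smul_absolutelyContinuous⟩
  filter_upwards [hq.ae hP] with σ h hσ
  exact h (H.deltaFlow_mem ht hσ)

/-- The weighted measure and Lebesgue measure have the same null sets. -/
theorem ae_ae_weightMeasure_iff {P : ℝ → Prop} :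
    (∀ᵐ x ∂(weightMeasure lam), P x) ↔ ∀ᵐ x, P x := by
  have hμ := isWeightedDomain_line lam
  have h1 := hμ.ac
  have h2 := hμ.ac'
  rw [Measure.restrict_univ] at h1 h2
  exact ⟨fun h => h2.ae_le h, fun h => h1.ae_le h⟩

/-- On almost every slice the semigroup acts by Gaussian averages. -/
theorem ae_ae_stripOp (H : IsStripParams κ θ α β) (ht : 0 ≤ t) (h : L2Strip α β lam) :
    ∀ᵐ σ ∂((volume : Measure ℝ).restrict (Ioo α β)), ∀ᵐ x ∂(weightMeasure lam),
      stripOp H lam t h (σ, x) = superpose (lineSubst (frakD κ θ t σ)) (fun _ _ => 1)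
        (fun y => h (deltaFlow κ θ t σ, y)) x :=
  Measure.ae_ae_of_ae_prod (coeFn_stripOp H ht h)

theorem slice_stripOp (H : IsStripParams κ θ α β) (ht : 0 ≤ t) (h : L2Strip α β lam) :
    ∀ᵐ σ ∂((volume : Measure ℝ).restrict (Ioo α β)), slice lam (stripOp H lam t h) σ
      = heat lam (frakD κ θ t σ) (slice lam h (deltaFlow κ θ t σ)) := by
  filter_upwards [ae_memLp_slice (stripOp H lam t h), ae_deltaFlow H ht (ae_memLp_slice h),
    ae_ae_stripOp H ht h] with σ h1 h2 h3
  have hD := frakD_nonneg H.κ_pos H.θ_pos ht σ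
  rw [slice, slice, dif_pos h1, dif_pos h2]
  refine Lp.ext (h1.coeFn_toLp.trans (EventuallyEq.trans h3 ?_))
  refine EventuallyEq.trans ?_ (coeFn_heat hD _).symm
  exact (isSuperposition_lineSubst lam hD le_rfl).superpose_congr h2.coeFn_toLp.symm

/-- Gaussians decay faster than any exponential. -/
theorem exp_neg_sq_div_le {D : ℝ} (hD : 0 < D) (a u : ℝ) :
    Real.exp (-u ^ 2 / (4 * D)) ≤ Real.exp (a ^ 2 * D) * Real.exp (-a * |u|) := by
  rw [← Real.exp_add]
  refine Real.exp_le_exp.2 ?_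
  rw [div_le_iff₀ (by positivity), ← sq_abs u]
  nlinarith [sq_nonneg (|u| - 2 * D * a)]

/-- The transition density of the heat semigroup with drift at time `τ`. -/
noncomputable def heatKernel (τ w : ℝ) : ℝ :=
  (√(4 * Real.pi * τ))⁻¹ * Real.exp (-(w - τ) ^ 2 / (4 * τ))

/-- The Gaussian average as a convolution with the kernel. -/
theorem superpose_lineSubst_eq {D : ℝ} (hD : 0 < D) (g : ℝ → ℂ) (x : ℝ) :
    superpose (lineSubst D) (fun _ _ => 1) g x = ∫ y, heatKernel D (x - y) • g y := by
  set w := √(2 * D) with hw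
  have hw0 : 0 < w := Real.sqrt_pos.2 (by positivity)
  have hw2 : w ^ 2 = 2 * D := Real.sq_sqrt (by positivity)
  simp only [superpose, one_smul, stdGauss]
  have h1 := Measure.integral_comp_mul_left
    (fun u => heatKernel D (x - (x - D - u)) • g (x - D - u)) w
  have hpi : √(4 * Real.pi * D) = √(2 * Real.pi) * w := by
    rw [hw, ← Real.sqrt_mul (by positivity)]; congr 1; ring
  rw [ProbabilityTheory.integral_gaussianReal_eq_integral_smul one_ne_zero,
    ← integral_sub_left_eq_self (fun y => heatKernel D (x - y) • g y) volume (x - D),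
    ← one_smul ℝ (∫ u, heatKernel D (x - (x - D - u)) • g (x - D - u)), ← mul_inv_cancel₀ hw0.ne',
    mul_smul, ← abs_of_pos (inv_pos.2 hw0), ← h1, ← integral_smul]
  congr 1; ext ζ
  rw [smul_smul, lineSubst, sub_sub x D]
  congr 1
  rw [heatKernel, ProbabilityTheory.gaussianPDFReal, hpi]
  have e : -(x - (x - (D + w * ζ)) - D) ^ 2 / (4 * D) = -(ζ - 0) ^ 2 / (2 * ((1 : ℝ≥0) : ℝ)) := by
    rw [show -(x - (x - (D + w * ζ)) - D) ^ 2 = -(w ^ 2 * ζ ^ 2) by ring, hw2, NNReal.coe_one]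
    field_simp
    ring
  rw [e, NNReal.coe_one, mul_one]
  field_simp

theorem integrable_kernelIntegrand {D : ℝ} (hD : 0 < D) {g : ℝ → ℂ}
    (hg : MemLp g 2 (weightMeasure lam)) (x : ℝ) : Integrable (kernelIntegrand D g x) := by
  have h1 := (integrable_exp_mul_of_memLp lam hg).norm.const_mul
    (Real.exp ((|lam| + 1) ^ 2 * D) * Real.exp ((|lam| + 1) * |x - D|))
  have hgm : AEStronglyMeasurable g volume := by
    have h2 := (isWeightedDomain_line lam).ac'
    rw [Measure.restrict_univ] at h2
    exact hg.1.mono_ac h2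
  refine h1.mono' ?_ (Eventually.of_forall fun y => ?_)
  · exact ((by fun_prop : Continuous fun y : ℝ =>
      (Real.exp (-(x - y - D) ^ 2 / (4 * D)) : ℂ)).aestronglyMeasurable).mul hgm
  · rw [kernelIntegrand, norm_mul, norm_smul, Complex.norm_real, Real.norm_of_nonneg
        (Real.exp_nonneg _),
      Real.norm_of_nonneg (Real.exp_nonneg _), ← mul_assoc]
    refine mul_le_mul_of_nonneg_right ?_ (norm_nonneg _)
    refine (exp_neg_sq_div_le hD (|lam| + 1) _).trans ?_
    rw [mul_assoc, ← Real.exp_add ((|lam| + 1) * |x - D|)]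
    refine mul_le_mul_of_nonneg_left (Real.exp_le_exp.2 ?_) (Real.exp_nonneg _)
    have h2 : |y| ≤ |x - D| + |x - y - D| := by
      have := abs_sub (x - D) (x - y - D)
      rwa [show x - D - (x - y - D) = y by ring] at this
    nlinarith [abs_nonneg lam]

theorem integral_heatKernel_eq (D : ℝ) (g : ℝ → ℂ) (x : ℝ) :
    ∫ y, heatKernel D (x - y) • g y
      = ((1 / √(4 * Real.pi * D) : ℝ) : ℂ) * ∫ y, kernelIntegrand D g x y := by
  rw [← integral_const_mul]
  congr 1; ext y
  rw [heatKernel, kernelIntegrand, Complex.real_smul, one_div]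
  push_cast
  ring

end Slices

/-! ### Parametric integrals with a uniform exponential tail -/

section Tail

theorem enorm_le_exp_mul (y : ℝ) (z : ℂ) : ‖z‖ₑ ≤ ENNReal.ofReal (Real.exp |y|) * ‖z‖ₑ :=
  le_mul_of_one_le_left' (ENNReal.one_le_ofReal.2 (Real.one_le_exp (abs_nonneg y)))

theorem integrable_of_tail {μ : Measure ℝ} {k : ℝ → ℂ} (hk : AEStronglyMeasurable k μ) {C : ℝ≥0∞}
    (hC : C ≠ ⊤) (hb : ∫⁻ y, ENNReal.ofReal (Real.exp |y|) * ‖k y‖ₑ ∂μ ≤ C) : Integrable k μ :=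
  ⟨hk, (lintegral_mono fun y => enorm_le_exp_mul y (k y)).trans_lt (hb.trans_lt hC.lt_top)⟩

/-- An integral over the line depends continuously on a parameter if the integrand is continuous
and `∫ e^{|y|} |k(x, y)| dy` is bounded uniformly in the parameter. -/
theorem continuous_integral_of_tail {X : Type*} [TopologicalSpace X] [FirstCountableTopology X]
    [LocallyCompactSpace X] {μ : Measure ℝ} [IsLocallyFiniteMeasure μ] {k : X → ℝ → ℂ}
    (hk : Continuous (Function.uncurry k)) {C : ℝ≥0∞} (hC : C ≠ ⊤)
    (hb : ∀ x, ∫⁻ y, ENNReal.ofReal (Real.exp |y|) * ‖k x y‖ₑ ∂μ ≤ C) :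
    Continuous fun x => ∫ y, k x y ∂μ := by
  have hkx : ∀ x, Continuous (k x) := fun x => hk.comp (by fun_prop : Continuous fun y : ℝ => (x,
      y))
  have hi : ∀ x, Integrable (k x) μ := fun x =>
    integrable_of_tail (hkx x).aestronglyMeasurable hC (hb x)
  -- the integrals over `[-n, n]` converge uniformly in the parameter
  have hu : TendstoUniformly (fun (n : ℕ) x => ∫ y in Icc (-(n : ℝ)) n, k x y ∂μ)
      (fun x => ∫ y, k x y ∂μ) atTop := by
    rw [Metric.tendstoUniformly_iff]
    intro ε hε
    have h1 : Tendsto (fun n : ℕ => Real.exp (-(n : ℝ)) * C.toReal) atTop (𝓝 0) := by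
      have := (Real.tendsto_exp_neg_atTop_nhds_zero.comp tendsto_natCast_atTop_atTop).mul_const
          C.toReal
      simpa using this
    filter_upwards [h1.eventually_lt_const hε] with n hn x
    refine lt_of_le_of_lt ?_ hn
    have e : ∫ y, k x y ∂μ - ∫ y in Icc (-(n : ℝ)) n, k x y ∂μ
        = ∫ y in (Icc (-(n : ℝ)) n)ᶜ, k x y ∂μ := by
      rw [← integral_add_compl (measurableSet_Icc (a := -(n : ℝ)) (b := n)) (hi x)]
      abel
    rw [dist_eq_norm, e]
    refine (norm_integral_le_lintegral_norm _).trans ?_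
    have h2 : ∫⁻ y in (Icc (-(n : ℝ)) n)ᶜ, ENNReal.ofReal ‖k x y‖ ∂μ
        ≤ ENNReal.ofReal (Real.exp (-(n : ℝ))) * C := by
      calc ∫⁻ y in (Icc (-(n : ℝ)) n)ᶜ, ENNReal.ofReal ‖k x y‖ ∂μ
          ≤ ∫⁻ y in (Icc (-(n : ℝ)) n)ᶜ, ENNReal.ofReal (Real.exp (-(n : ℝ))) *
            (ENNReal.ofReal (Real.exp |y|) * ‖k x y‖ₑ) ∂μ := by
            refine setLIntegral_mono' measurableSet_Icc.compl fun y hy => ?_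
            have hy' : (n : ℝ) ≤ |y| := by
              by_contra h
              exact hy (abs_le.1 (not_le.1 h).le)
            rw [ofReal_norm, ← mul_assoc, ← ENNReal.ofReal_mul (Real.exp_nonneg _), ← Real.exp_add]
            exact le_mul_of_one_le_left' (ENNReal.one_le_ofReal.2 (Real.one_le_exp (by linarith)))
        _ ≤ ∫⁻ y, ENNReal.ofReal (Real.exp (-(n : ℝ))) *
            (ENNReal.ofReal (Real.exp |y|) * ‖k x y‖ₑ) ∂μ := setLIntegral_le_lintegral _ _
        _ ≤ _ := by
            rw [lintegral_const_mul' _ _ ENNReal.ofReal_ne_top]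
            gcongr
            exact hb x
    refine (ENNReal.toReal_mono (ENNReal.mul_ne_top ENNReal.ofReal_ne_top hC) h2).trans_eq ?_
    rw [ENNReal.toReal_mul, ENNReal.toReal_ofReal (Real.exp_nonneg _)]
  refine hu.continuous (Eventually.of_forall fun n => ?_).frequently
  exact continuous_parametric_integral_of_continuous hk isCompact_Icc

theorem continuousOn_integral_of_tail {X : Type*} [TopologicalSpace X] [FirstCountableTopology X]
    [LocallyCompactSpace X] {μ : Measure ℝ} [IsLocallyFiniteMeasure μ] {k : X → ℝ → ℂ} {W : Set X}
    (hW : IsOpen W) (hk : ContinuousOn (Function.uncurry k) (W ×ˢ univ)) {C : ℝ≥0∞} (hC : C ≠ ⊤)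
    (hb : ∀ x ∈ W, ∫⁻ y, ENNReal.ofReal (Real.exp |y|) * ‖k x y‖ₑ ∂μ ≤ C) :
    ContinuousOn (fun x => ∫ y, k x y ∂μ) W := by
  rw [continuousOn_iff_continuous_domRestrict]
  have : LocallyCompactSpace W := hW.locallyCompactSpace
  refine continuous_integral_of_tail (k := fun (x : W) y => k x y) ?_ hC fun x => hb x x.2
  refine hk.comp_continuous (f := fun p : W × ℝ => ((p.1 : X), p.2)) (by fun_prop) fun p => ?_
  exact ⟨p.1.2, mem_univ _⟩

/-- Differentiation under the integral sign. No pointwise majorant of the derivative `k'` is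
needed, only a uniform bound on `∫ e^{|y|} |k'(r, y)| dy`. -/
theorem hasDerivAt_integral_of_tail {k k' : ℝ → ℝ → ℂ} {W : Set ℝ} (hW : IsOpen W) {r₀ : ℝ}
    (hr₀ : r₀ ∈ W) (hd : ∀ r ∈ W, ∀ y, HasDerivAt (fun r => k r y) (k' r y) r)
    (hk : ∀ r ∈ W, Integrable (k r)) (hk' : ContinuousOn (Function.uncurry k') (W ×ˢ univ))
    {C : ℝ≥0∞} (hC : C ≠ ⊤) (hb : ∀ r ∈ W, ∫⁻ y, ENNReal.ofReal (Real.exp |y|) * ‖k' r y‖ₑ ≤ C) :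
    HasDerivAt (fun r => ∫ y, k r y) (∫ y, k' r₀ y) r₀ := by
  have hG := continuousOn_integral_of_tail hW hk' hC hb
  obtain ⟨ε, hε, hball⟩ := Metric.isOpen_iff.1 hW r₀ hr₀
  have hsub : ∀ r ∈ Metric.ball r₀ ε, uIcc r₀ r ⊆ W := fun r hr =>
    ((convex_ball r₀ ε).ordConnected.uIcc_subset (Metric.mem_ball_self hε) hr).trans hball
  -- by Fubini's theorem the integral is a primitive of the integral of the derivative
  have key : ∀ r ∈ Metric.ball r₀ ε, ∫ y, k r y
      = (∫ y, k r₀ y) + ∫ s in r₀..r, ∫ y, k' s y := fun r hr => by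
    have hs := hsub r hr
    have hi : Integrable (Function.uncurry k') ((volume.restrict (uIoc r₀ r)).prod volume) := by
      have hm : AEStronglyMeasurable (Function.uncurry k')
          ((volume.restrict (uIoc r₀ r)).prod volume) := by
        have e : (volume.restrict (uIoc r₀ r)).prod (volume : Measure ℝ)
            = ((volume : Measure ℝ).prod volume).restrict (uIoc r₀ r ×ˢ univ) := by
          rw [← Measure.prod_restrict, Measure.restrict_univ]
        rw [e]
        exact (hk'.mono (prod_mono (uIoc_subset_uIcc.trans hs) Subset.rfl)).aestronglyMeasurable
          (measurableSet_uIoc.prod MeasurableSet.univ)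
      refine ⟨hm, ?_⟩
      rw [hasFiniteIntegral_iff_enorm, lintegral_prod _ hm.enorm]
      calc ∫⁻ s in uIoc r₀ r, ∫⁻ y, ‖Function.uncurry k' (s, y)‖ₑ
          ≤ ∫⁻ _ in uIoc r₀ r, C := by
            refine setLIntegral_mono' measurableSet_uIoc fun s hs' => ?_
            exact (lintegral_mono fun y => enorm_le_exp_mul y _).trans
              (hb s (hs (uIoc_subset_uIcc hs')))
        _ < ⊤ := by
            rw [setLIntegral_const]
            refine ENNReal.mul_lt_top hC.lt_top ?_
            rw [uIoc]; simp
    have e1 : ∀ y, ∫ s in r₀..r, k' s y = k r y - k r₀ y := fun y =>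
      intervalIntegral.integral_eq_sub_of_hasDerivAt (fun s hs' => hd s (hs hs') y)
        (ContinuousOn.intervalIntegrable (hk'.comp (by fun_prop : ContinuousOn
          (fun s : ℝ => (s, y)) _) fun s hs' => ⟨hs hs', mem_univ _⟩))
    rw [intervalIntegral_integral_swap hi]
    simp only [e1]
    rw [integral_sub (hk r (hs right_mem_uIcc)) (hk r₀ hr₀)]
    abel
  have hint : IntervalIntegrable (fun s => ∫ y, k' s y) volume r₀ r₀ := by simp
  have h1 : HasDerivAt (fun r => ∫ s in r₀..r, ∫ y, k' s y) (∫ y, k' r₀ y) r₀ :=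
    intervalIntegral.integral_hasDerivAt_right hint
      (hG.stronglyMeasurableAtFilter hW r₀ hr₀) (hG.continuousAt (hW.mem_nhds hr₀))
  refine (h1.const_add (∫ y, k r₀ y)).congr_of_eventuallyEq ?_
  filter_upwards [Metric.ball_mem_nhds r₀ hε] with r hr using key r hr

end Tail

/-! ### The heat kernel and its derivatives -/

section Kernel

/-- `∂_w` of the heat kernel. -/
noncomputable def heatKernelX (τ w : ℝ) : ℝ := -(w - τ) / (2 * τ) * heatKernel τ w

/-- `∂_w²` of the heat kernel. -/
noncomputable def heatKernelXX (τ w : ℝ) : ℝ :=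
  ((w - τ) ^ 2 / (4 * τ ^ 2) - 1 / (2 * τ)) * heatKernel τ w

theorem hasDerivAt_heatKernel {τ : ℝ} (hτ : 0 < τ) (w : ℝ) :
    HasDerivAt (heatKernel τ) (heatKernelX τ w) w := by
  have h1 : HasDerivAt (fun w : ℝ => -(w - τ) ^ 2 / (4 * τ)) (-(w - τ) / (2 * τ)) w := by
    refine (((((hasDerivAt_id w).sub_const τ).pow 2).neg).div_const (4 * τ)).congr_deriv ?_
    simp only [id]; field_simp; norm_num; ring
  refine (h1.exp.const_mul _).congr_deriv ?_
  rw [heatKernelX, heatKernel]; ring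

theorem hasDerivAt_heatKernelX {τ : ℝ} (hτ : 0 < τ) (w : ℝ) :
    HasDerivAt (heatKernelX τ) (heatKernelXX τ w) w := by
  have h1 : HasDerivAt (fun w : ℝ => -(w - τ) / (2 * τ)) (-1 / (2 * τ)) w :=
    (((hasDerivAt_id w).sub_const τ).neg).div_const (2 * τ)
  refine (h1.mul (hasDerivAt_heatKernel hτ w)).congr_deriv ?_
  rw [heatKernelXX, heatKernelX]; field_simp; ring

/-- The kernel solves the heat equation with drift. -/
theorem hasDerivAt_heatKernel_time {τ : ℝ} (hτ : 0 < τ) (w : ℝ) :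
    HasDerivAt (fun τ => heatKernel τ w) (heatKernelXX τ w - heatKernelX τ w) τ := by
  have hp : 0 < 4 * Real.pi * τ := by positivity
  have h0 : HasDerivAt (fun τ : ℝ => 4 * Real.pi * τ) (4 * Real.pi) τ := by
    simpa using (hasDerivAt_id τ).const_mul (4 * Real.pi)
  have h1 : HasDerivAt (fun τ => (√(4 * Real.pi * τ))⁻¹)
      (-(4 * Real.pi / (2 * √(4 * Real.pi * τ))) / √(4 * Real.pi * τ) ^ 2) τ :=
    (h0.sqrt hp.ne').inv (Real.sqrt_pos.2 hp).ne'
  have h2 : HasDerivAt (fun τ : ℝ => -(w - τ) ^ 2 / (4 * τ))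
      ((2 * (w - τ) * (4 * τ) - -(w - τ) ^ 2 * 4) / (4 * τ) ^ 2) τ := by
    have ha : HasDerivAt (fun τ : ℝ => -(w - τ) ^ 2) (2 * (w - τ)) τ := by
      refine ((((hasDerivAt_id τ).const_sub w).pow 2).neg).congr_deriv ?_
      simp only [id]; norm_num
    have hb : HasDerivAt (fun τ : ℝ => 4 * τ) 4 τ := by simpa using (hasDerivAt_id τ).const_mul 4
    exact ha.div hb (by positivity)
  refine (h1.mul h2.exp).congr_deriv ?_
  rw [heatKernelXX, heatKernelX, heatKernel]
  have hs : √(4 * Real.pi * τ) ^ 2 = 4 * Real.pi * τ := Real.sq_sqrt hp.le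
  have hs0 : √(4 * Real.pi * τ) ≠ 0 := (Real.sqrt_pos.2 hp).ne'
  have hpi := Real.pi_ne_zero
  have e1 : -(4 * Real.pi / (2 * √(4 * Real.pi * τ))) / √(4 * Real.pi * τ) ^ 2
      = -(1 / (2 * τ)) * (√(4 * Real.pi * τ))⁻¹ := by
    rw [hs]; field_simp
  rw [e1]
  field_simp
  ring

/-- Kernels `Φ(τ, w)`, `τ > 0`, that are continuous and decay in `w` faster than any exponential,
locally uniformly in `τ`. -/
structure IsRapidKernel (Φ : ℝ → ℝ → ℝ) : Prop where
  cont : ContinuousOn (Function.uncurry Φ) (Ioi 0 ×ˢ univ)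
  bound : ∀ d₀ d₁ A : ℝ, 0 < d₀ → 0 ≤ A →
    ∃ C, 0 ≤ C ∧ ∀ τ ∈ Icc d₀ d₁, ∀ w, |Φ τ w| ≤ C * Real.exp (-A * |w|)

theorem IsRapidKernel.sub {Φ Ψ : ℝ → ℝ → ℝ} (hΦ : IsRapidKernel Φ) (hΨ : IsRapidKernel Ψ) :
    IsRapidKernel (fun τ w => Φ τ w - Ψ τ w) where
  cont := hΦ.cont.sub hΨ.cont
  bound := fun d₀ d₁ A h0 hA => by
    obtain ⟨C, hC0, hC⟩ := hΦ.bound d₀ d₁ A h0 hA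
    obtain ⟨C', hC0', hC'⟩ := hΨ.bound d₀ d₁ A h0 hA
    refine ⟨C + C', by positivity, fun τ hτ w => (abs_sub _ _).trans ?_⟩
    rw [add_mul]
    exact add_le_add (hC τ hτ w) (hC' τ hτ w)

/-- The heat kernel with a factor of at most quadratic growth decays rapidly. -/
theorem isRapidKernel_mul_heatKernel {P : ℝ → ℝ → ℝ}
    (hP : ContinuousOn (Function.uncurry P) (Ioi 0 ×ˢ univ))
    (hb : ∀ d₀, 0 < d₀ → ∃ C, 0 ≤ C ∧ ∀ τ, d₀ ≤ τ → ∀ w, |P τ w| ≤ C * (1 + |w - τ|) ^ 2) :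
    IsRapidKernel (fun τ w => P τ w * heatKernel τ w) where
  cont := by
    refine hP.mul (ContinuousOn.mul (ContinuousOn.inv₀ (by fun_prop) fun p hp => ?_)
      (ContinuousOn.rexp (ContinuousOn.div (by fun_prop) (by fun_prop) fun p hp => ?_)))
    · have : 0 < p.1 := hp.1
      positivity
    · have : 0 < p.1 := hp.1
      positivity
  bound := fun d₀ d₁ A h0 hA => by
    obtain ⟨C, hC0, hC⟩ := hb d₀ h0
    refine ⟨C * (√(4 * Real.pi * d₀))⁻¹ * Real.exp ((A + 2) ^ 2 * d₁ + A * d₁), by positivity,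
      fun τ hτ w => ?_⟩
    have hτ0 : 0 < τ := h0.trans_le hτ.1
    have e1 : |heatKernel τ w| ≤ (√(4 * Real.pi * d₀))⁻¹ *
        (Real.exp ((A + 2) ^ 2 * τ) * Real.exp (-(A + 2) * |w - τ|)) := by
      rw [heatKernel, abs_mul, abs_of_nonneg (by positivity), abs_of_pos (Real.exp_pos _)]
      refine mul_le_mul ?_ (exp_neg_sq_div_le hτ0 _ _) (Real.exp_nonneg _) (by positivity)
      gcongr
      exact hτ.1
    have e2 : (1 + |w - τ|) ^ 2 ≤ Real.exp (2 * |w - τ|) := by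
      have h1 : 1 + |w - τ| ≤ Real.exp |w - τ| := by linarith [Real.add_one_le_exp |w - τ|]
      have h2 : Real.exp (2 * |w - τ|) = Real.exp |w - τ| ^ 2 := by
        rw [← Real.exp_nat_mul]; norm_num
      rw [h2]; gcongr
    have e3 : |w| ≤ |w - τ| + τ := by
      have := abs_add_le (w - τ) τ
      rwa [sub_add_cancel, abs_of_pos hτ0] at this
    rw [abs_mul]
    calc |P τ w| * |heatKernel τ w| ≤ (C * Real.exp (2 * |w - τ|)) * ((√(4 * Real.pi * d₀))⁻¹ *
        (Real.exp ((A + 2) ^ 2 * τ) * Real.exp (-(A + 2) * |w - τ|))) := by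
          refine mul_le_mul ((hC τ hτ.1 w).trans ?_) e1 (abs_nonneg _) (by positivity)
          gcongr
      _ = C * (√(4 * Real.pi * d₀))⁻¹ * Real.exp (2 * |w - τ| + (A + 2) ^ 2 * τ
          + -(A + 2) * |w - τ|) := by rw [Real.exp_add, Real.exp_add]; ring
      _ ≤ C * (√(4 * Real.pi * d₀))⁻¹ * Real.exp ((A + 2) ^ 2 * d₁ + A * d₁ + -A * |w|) := by
          refine mul_le_mul_of_nonneg_left (Real.exp_le_exp.2 ?_) (by positivity)
          have h3 : (A + 2) ^ 2 * τ ≤ (A + 2) ^ 2 * d₁ := by gcongr; exact hτ.2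
          have h4 : A * |w| ≤ A * (|w - τ| + d₁) := by
            refine mul_le_mul_of_nonneg_left ?_ hA
            linarith [hτ.2]
          nlinarith
      _ = _ := by rw [Real.exp_add]; ring

theorem isRapidKernel_heatKernel : IsRapidKernel heatKernel := by
  have := isRapidKernel_mul_heatKernel (P := fun _ _ => 1) continuousOn_const fun d₀ _ =>
    ⟨1, zero_le_one, fun τ _ w => by
      rw [abs_one, one_mul]
      nlinarith [abs_nonneg (w - τ)]⟩
  simpa using this

theorem isRapidKernel_heatKernelX : IsRapidKernel heatKernelX := by
  refine isRapidKernel_mul_heatKernel (P := fun τ w => -(w - τ) / (2 * τ))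
    (ContinuousOn.div (by fun_prop) (by fun_prop) fun p hp => ?_) fun d₀ h0 =>
    ⟨1 / (2 * d₀), by positivity, fun τ hτ w => ?_⟩
  · have : 0 < p.1 := hp.1
    positivity
  · have hτ0 : 0 < τ := h0.trans_le hτ
    rw [abs_div, abs_neg, abs_of_pos (by positivity : 0 < 2 * τ), div_eq_mul_one_div, mul_comm]
    have := abs_nonneg (w - τ)
    refine mul_le_mul ?_ (by nlinarith) this (by positivity)
    gcongr

theorem isRapidKernel_heatKernelXX : IsRapidKernel heatKernelXX := by
  refine isRapidKernel_mul_heatKernel (P := fun τ w => (w - τ) ^ 2 / (4 * τ ^ 2) - 1 / (2 * τ))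
    (ContinuousOn.sub (ContinuousOn.div (by fun_prop) (by fun_prop) fun p hp => ?_)
      (ContinuousOn.div (by fun_prop) (by fun_prop) fun p hp => ?_)) fun d₀ h0 =>
    ⟨1 / (4 * d₀ ^ 2) + 1 / (2 * d₀), by positivity, fun τ hτ w => ?_⟩
  · have : 0 < p.1 := hp.1
    positivity
  · have : 0 < p.1 := hp.1
    positivity
  · have hτ0 : 0 < τ := h0.trans_le hτ
    have hu := abs_nonneg (w - τ)
    have h1 : (w - τ) ^ 2 / (4 * τ ^ 2) ≤ 1 / (4 * d₀ ^ 2) * (1 + |w - τ|) ^ 2 := by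
      rw [div_eq_mul_one_div, mul_comm, ← sq_abs (w - τ)]
      refine mul_le_mul ?_ (by nlinarith) (by positivity) (by positivity)
      gcongr
    have h2 : 1 / (2 * τ) ≤ 1 / (2 * d₀) * (1 + |w - τ|) ^ 2 := by
      refine le_trans ?_ (le_mul_of_one_le_right (by positivity) (by nlinarith))
      gcongr
    refine (abs_sub _ _).trans ?_
    rw [abs_of_nonneg (by positivity), abs_of_nonneg (by positivity), add_mul]
    exact add_le_add h1 h2

end Kernel

/-! ### Convolutions along the flow -/

section Conv

variable {κ θ α β A : ℝ}

/-- Functions on the strip, continuous, whose slices have exponentially weighted first moments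
that are bounded locally uniformly. -/
structure HasLocalMoments (α β A : ℝ) (g : ℝ × ℝ → ℂ) : Prop where
  cont : ContinuousOn g (strip α β)
  bound : ∀ a b, α < a → b < β → ∃ C : ℝ≥0∞, C ≠ ⊤ ∧ ∀ s ∈ Icc a b,
    ∫⁻ y, ENNReal.ofReal (Real.exp (-A * |y|)) * ‖g (s, y)‖ₑ ≤ C

/-- Positive times and points of the strip. -/
def timeStrip (α β : ℝ) : Set (ℝ × (ℝ × ℝ)) := Ioi 0 ×ˢ strip α β

theorem isOpen_timeStrip (α β : ℝ) : IsOpen (timeStrip α β) := isOpen_Ioi.prod (isOpen_strip α β)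

/-- The integrand `Φ(𝔇(t, σ), x - y) g(δ_t(σ), y)` at `q = (t, σ, x)`. -/
noncomputable def flowIntegrand (κ θ : ℝ) (Φ : ℝ → ℝ → ℝ) (g : ℝ × ℝ → ℂ) (q : ℝ × (ℝ × ℝ))
    (y : ℝ) : ℂ :=
  Φ (frakD κ θ q.1 q.2.1) (q.2.2 - y) • g (deltaFlow κ θ q.1 q.2.1, y)

/-- The function `(t, σ, x) ↦ ∫ Φ(𝔇(t, σ), x - y) g(δ_t(σ), y) dy`. -/
noncomputable def flowConv (κ θ : ℝ) (Φ : ℝ → ℝ → ℝ) (g : ℝ × ℝ → ℂ) (q : ℝ × (ℝ × ℝ)) : ℂ :=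
  ∫ y, flowIntegrand κ θ Φ g q y

variable {Φ Φ' : ℝ → ℝ → ℝ} {g : ℝ × ℝ → ℂ}

/-- The tail bound for `flowConv`, locally uniform in all variables: the kernel decays faster than
`e^{-(A+1)|x-y|}`, which absorbs both `e^{A|y|}` and the additional factor `e^{|y|}`. -/
theorem flowConv_bound (H : IsStripParams κ θ α β) (hΦ : IsRapidKernel Φ)
    (hg : HasLocalMoments α β A g) (hA : 0 ≤ A) {q₀ : ℝ × (ℝ × ℝ)} (hq₀ : q₀ ∈ timeStrip α β) :
    ∃ W : Set (ℝ × (ℝ × ℝ)), IsOpen W ∧ q₀ ∈ W ∧ W ⊆ timeStrip α β ∧ ∃ C : ℝ≥0∞, C ≠ ⊤ ∧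
      ∀ q ∈ W, ∫⁻ y, ENNReal.ofReal (Real.exp |y|) * ‖flowIntegrand κ θ Φ g q y‖ₑ ≤ C := by
  have hD0 : 0 < frakD κ θ q₀.1 q₀.2.1 := frakD_pos H.κ_pos H.θ_pos hq₀.1 _
  have hδ0 := H.deltaFlow_mem (le_of_lt hq₀.1) hq₀.2.1
  obtain ⟨a, ha, ha'⟩ := exists_between hδ0.1
  obtain ⟨b, hb, hb'⟩ := exists_between hδ0.2
  set D₀ := frakD κ θ q₀.1 q₀.2.1 with hD₀
  set X := |q₀.2.2| + 1 with hX
  have hcD : Continuous fun q : ℝ × (ℝ × ℝ) => frakD κ θ q.1 q.2.1 := by fun_prop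
  have hcδ : Continuous fun q : ℝ × (ℝ × ℝ) => deltaFlow κ θ q.1 q.2.1 := by fun_prop
  obtain ⟨C, hC0, hC⟩ := hΦ.bound (D₀ / 2) (2 * D₀) (A + 1) (by positivity) (by positivity)
  obtain ⟨C', hC', hCg⟩ := hg.bound a b ha hb'
  refine ⟨timeStrip α β ∩ ((fun q => frakD κ θ q.1 q.2.1) ⁻¹' Ioo (D₀ / 2) (2 * D₀) ∩
    ((fun q => deltaFlow κ θ q.1 q.2.1) ⁻¹' Ioo a b ∩ (fun q => |q.2.2|) ⁻¹' Iio X)),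
    (isOpen_timeStrip α β).inter ((isOpen_Ioo.preimage hcD).inter ((isOpen_Ioo.preimage hcδ).inter
      (isOpen_Iio.preimage (by fun_prop)))), ⟨hq₀, ⟨by change D₀ / 2 < D₀; linarith,
        by change D₀ < 2 * D₀; linarith⟩, ⟨ha', hb⟩, by change |q₀.2.2| < X; linarith⟩,
    inter_subset_left, ENNReal.ofReal (C * Real.exp ((A + 1) * X)) * C',
    ENNReal.mul_ne_top ENNReal.ofReal_ne_top hC', fun q hq => ?_⟩
  obtain ⟨-, h1, h2, h3⟩ := hq
  have h3 : |q.2.2| < X := h3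
  calc _ ≤ ∫⁻ y, ENNReal.ofReal (C * Real.exp ((A + 1) * X)) *
        (ENNReal.ofReal (Real.exp (-A * |y|)) * ‖g (deltaFlow κ θ q.1 q.2.1, y)‖ₑ) := by
        refine lintegral_mono fun y => ?_
        rw [flowIntegrand, enorm_smul, ← mul_assoc, ← mul_assoc, ← ofReal_norm (Φ _ _),
          ← ENNReal.ofReal_mul (Real.exp_nonneg _), ← ENNReal.ofReal_mul (by positivity)]
        refine mul_le_mul_left (ENNReal.ofReal_le_ofReal ?_) _
        have e1 : ‖Φ (frakD κ θ q.1 q.2.1) (q.2.2 - y)‖ ≤ C * Real.exp (-(A + 1) * |q.2.2 - y|) :=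
          hC _ (Ioo_subset_Icc_self h1) _
        have e2 : |y| ≤ |q.2.2 - y| + X := by
          have := abs_sub q.2.2 (q.2.2 - y)
          rw [sub_sub_cancel] at this
          linarith
        calc _ ≤ Real.exp |y| * (C * Real.exp (-(A + 1) * |q.2.2 - y|)) := by gcongr
          _ = C * Real.exp (|y| + -(A + 1) * |q.2.2 - y|) := by rw [Real.exp_add]; ring
          _ ≤ C * Real.exp ((A + 1) * X + -A * |y|) := by
              refine mul_le_mul_of_nonneg_left (Real.exp_le_exp.2 ?_) hC0
              nlinarith
          _ = _ := by rw [Real.exp_add]; ring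
    _ = ENNReal.ofReal (C * Real.exp ((A + 1) * X)) * ∫⁻ y, ENNReal.ofReal (Real.exp (-A * |y|)) *
          ‖g (deltaFlow κ θ q.1 q.2.1, y)‖ₑ := lintegral_const_mul' _ _ ENNReal.ofReal_ne_top
    _ ≤ _ := by gcongr; exact hCg _ (Ioo_subset_Icc_self h2)

theorem continuousOn_flowConv_integrand (H : IsStripParams κ θ α β) (hΦ : IsRapidKernel Φ)
    (hg : HasLocalMoments α β A g) :
    ContinuousOn (Function.uncurry (flowIntegrand κ θ Φ g)) (timeStrip α β ×ˢ univ) := by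
  refine ContinuousOn.smul (hΦ.cont.comp (f := fun p : (ℝ × (ℝ × ℝ)) × ℝ =>
      (frakD κ θ p.1.1 p.1.2.1, p.1.2.2 - p.2)) (Continuous.continuousOn (by fun_prop)) ?_)
    (hg.cont.comp (f := fun p : (ℝ × (ℝ × ℝ)) × ℝ => (deltaFlow κ θ p.1.1 p.1.2.1, p.2))
      (Continuous.continuousOn (by fun_prop)) ?_)
  · exact fun p hp => ⟨frakD_pos H.κ_pos H.θ_pos hp.1.1 _, mem_univ _⟩
  · exact fun p hp => ⟨H.deltaFlow_mem (le_of_lt hp.1.1) hp.1.2.1, mem_univ _⟩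

theorem continuousOn_flowConv (H : IsStripParams κ θ α β) (hΦ : IsRapidKernel Φ)
    (hg : HasLocalMoments α β A g) (hA : 0 ≤ A) :
    ContinuousOn (flowConv κ θ Φ g) (timeStrip α β) := by
  intro q₀ hq₀
  obtain ⟨W, hW, hqW, hWs, C, hC, hb⟩ := flowConv_bound H hΦ hg hA hq₀
  have h1 : ContinuousOn (flowConv κ θ Φ g) W := continuousOn_integral_of_tail hW
    ((continuousOn_flowConv_integrand H hΦ hg).mono (prod_mono hWs Subset.rfl)) hC hb
  have h2 : ContinuousAt (flowConv κ θ Φ g) q₀ := h1.continuousAt (hW.mem_nhds hqW)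
  exact h2.continuousWithinAt

theorem continuous_flowIntegrand (H : IsStripParams κ θ α β) (hΦ : IsRapidKernel Φ)
    (hg : HasLocalMoments α β A g) {q : ℝ × (ℝ × ℝ)} (hq : q ∈ timeStrip α β) :
    Continuous (flowIntegrand κ θ Φ g q) := by
  have h : Continuous (Function.uncurry (flowIntegrand κ θ Φ g) ∘ fun y : ℝ => (q, y)) :=
    (continuousOn_flowConv_integrand H hΦ hg).comp_continuous (by fun_prop)
      fun y => mem_prod.2 ⟨hq, mem_univ _⟩
  exact h

theorem continuousOn_flowIntegrand_comp {W : Set ℝ} {e : ℝ → ℝ × (ℝ × ℝ)} (he : Continuous e)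
    (hW : ∀ r ∈ W, e r ∈ timeStrip α β) (H : IsStripParams κ θ α β) (hΦ : IsRapidKernel Φ)
    (hg : HasLocalMoments α β A g) :
    ContinuousOn (Function.uncurry fun r y => flowIntegrand κ θ Φ g (e r) y) (W ×ˢ univ) := by
  have h : ContinuousOn (Function.uncurry (flowIntegrand κ θ Φ g) ∘ fun p : ℝ × ℝ => (e p.1, p.2))
      (W ×ˢ univ) := (continuousOn_flowConv_integrand H hΦ hg).comp
    (Continuous.continuousOn (by fun_prop)) fun p hp => mem_prod.2 ⟨hW _ hp.1, mem_univ _⟩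
  exact h

theorem integrable_flowConv (H : IsStripParams κ θ α β) (hΦ : IsRapidKernel Φ)
    (hg : HasLocalMoments α β A g) (hA : 0 ≤ A) {q : ℝ × (ℝ × ℝ)} (hq : q ∈ timeStrip α β) :
    Integrable (flowIntegrand κ θ Φ g q) := by
  have hc := continuous_flowIntegrand H hΦ hg hq
  obtain ⟨W, hW, hqW, hWs, C, hC, hb⟩ := flowConv_bound H hΦ hg hA hq
  have h := hb q hqW
  exact integrable_of_tail hc.aestronglyMeasurable hC h

theorem hasDerivAt_flowConv_space (H : IsStripParams κ θ α β) (hΦ : IsRapidKernel Φ)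
    (hΦ' : IsRapidKernel Φ') (hd : ∀ τ, 0 < τ → ∀ w, HasDerivAt (Φ τ) (Φ' τ w) w)
    (hg : HasLocalMoments α β A g) (hA : 0 ≤ A) {t σ x : ℝ} (hq : (t, (σ, x)) ∈ timeStrip α β) :
    HasDerivAt (fun x => flowConv κ θ Φ g (t, (σ, x))) (flowConv κ θ Φ' g (t, (σ, x))) x := by
  obtain ⟨W, hW, hqW, hWs, C, hC, hb⟩ := flowConv_bound H hΦ' hg hA hq
  set e : ℝ → ℝ × (ℝ × ℝ) := fun x => (t, (σ, x)) with he
  have hc : Continuous e := by fun_prop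
  have h1 : ∀ r ∈ e ⁻¹' W, ∀ y, HasDerivAt (fun r => flowIntegrand κ θ Φ g (e r) y)
      (flowIntegrand κ θ Φ' g (e r) y) r := fun r hr y => by
    have hD : 0 < frakD κ θ t σ := frakD_pos H.κ_pos H.θ_pos (hWs hr).1 _
    have h1 : HasDerivAt (fun r => Φ (frakD κ θ t σ) (r - y)) _ r :=
      (hd _ hD (r - y)).comp_sub_const r y
    exact h1.smul_const (g (deltaFlow κ θ t σ, y))
  have h2 : ∀ r ∈ e ⁻¹' W, Integrable (flowIntegrand κ θ Φ g (e r)) := fun r hr =>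
    integrable_flowConv H hΦ hg hA (hWs hr)
  have h3 : ∀ r ∈ e ⁻¹' W,
      ∫⁻ y, ENNReal.ofReal (Real.exp |y|) * ‖flowIntegrand κ θ Φ' g (e r) y‖ₑ ≤ C :=
    fun r hr => hb (e r) hr
  have h4 := continuousOn_flowIntegrand_comp hc (fun r (hr : r ∈ e ⁻¹' W) => hWs hr) H hΦ' hg
  have hx : x ∈ e ⁻¹' W := hqW
  exact hasDerivAt_integral_of_tail (hW.preimage hc) hx h1 h2 h4 hC h3

/-- The chain rule for `flowConv` along a curve in the `(t, σ)` plane. -/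
theorem hasDerivAt_flowConv_curve (H : IsStripParams κ θ α β) (hΦ : IsRapidKernel Φ)
    (hΦ' : IsRapidKernel Φ') (hd : ∀ τ, 0 < τ → ∀ w, HasDerivAt (fun τ => Φ τ w) (Φ' τ w) τ)
    {gs : ℝ × ℝ → ℂ} (hg : HasLocalMoments α β A g) (hgs : HasLocalMoments α β A gs) (hA : 0 ≤ A)
    (hgd : ∀ p ∈ strip α β, HasDerivAt (fun s => g (s, p.2)) (gs p) p.1)
    {c : ℝ → ℝ × ℝ} {D' s' : ℝ → ℝ} (hc : Continuous c) (hD'c : Continuous D') (hs'c : Continuous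
        s')
    (hD : ∀ r, HasDerivAt (fun r => frakD κ θ (c r).1 (c r).2) (D' r) r)
    (hs : ∀ r, HasDerivAt (fun r => deltaFlow κ θ (c r).1 (c r).2) (s' r) r) {r₀ x : ℝ}
    (hq : ((c r₀).1, ((c r₀).2, x)) ∈ timeStrip α β) :
    HasDerivAt (fun r => flowConv κ θ Φ g ((c r).1, ((c r).2, x)))
      (D' r₀ • flowConv κ θ Φ' g ((c r₀).1, ((c r₀).2, x))
        + s' r₀ • flowConv κ θ Φ gs ((c r₀).1, ((c r₀).2, x))) r₀ := by
  obtain ⟨W₁, hW₁, hqW₁, hWs₁, C₁, hC₁, hb₁⟩ := flowConv_bound H hΦ' hg hA hq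
  obtain ⟨W₂, hW₂, hqW₂, hWs₂, C₂, hC₂, hb₂⟩ := flowConv_bound H hΦ hgs hA hq
  set e : ℝ → ℝ × (ℝ × ℝ) := fun r => ((c r).1, ((c r).2, x)) with he
  have hce : Continuous e := by fun_prop
  set W : Set ℝ := e ⁻¹' (W₁ ∩ W₂) ∩ ({r | |D' r| < |D' r₀| + 1} ∩ {r | |s' r| < |s' r₀| + 1})
      with hWd
  have hW : IsOpen W := ((hW₁.inter hW₂).preimage hce).inter
    ((isOpen_lt (by fun_prop) (by fun_prop)).inter (isOpen_lt (by fun_prop) (by fun_prop)))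
  have hr₀ : r₀ ∈ W := ⟨⟨hqW₁, hqW₂⟩, lt_add_one |D' r₀|, lt_add_one |s' r₀|⟩
  have hmem : ∀ r ∈ W, e r ∈ timeStrip α β := fun r hr => hWs₁ hr.1.1
  set k₁ : ℝ → ℝ → ℂ := fun r y => flowIntegrand κ θ Φ' g (e r) y with hk₁
  set k₂ : ℝ → ℝ → ℂ := fun r y => flowIntegrand κ θ Φ gs (e r) y with hk₂
  have cont₁ : ContinuousOn (Function.uncurry k₁) (W ×ˢ univ) :=
    continuousOn_flowIntegrand_comp hce hmem H hΦ' hg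
  have cont₂ : ContinuousOn (Function.uncurry k₂) (W ×ˢ univ) :=
    continuousOn_flowIntegrand_comp hce hmem H hΦ hgs
  have main := hasDerivAt_integral_of_tail (k := fun r y => flowIntegrand κ θ Φ g (e r) y) (k' :=
      fun r y => D' r • k₁ r y + s' r • k₂ r y)
    (C := ENNReal.ofReal (|D' r₀| + 1) * C₁ + ENNReal.ofReal (|s' r₀| + 1) * C₂) hW hr₀
    (fun r hr y => ?_) (fun r hr => integrable_flowConv H hΦ hg hA (hmem r hr)) ?_ ?_
    (fun r hr => ?_)
  · refine main.congr_deriv ?_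
    have i₁ : Integrable (k₁ r₀) := integrable_flowConv H hΦ' hg hA (hmem r₀ hr₀)
    have i₂ : Integrable (k₂ r₀) := integrable_flowConv H hΦ hgs hA (hmem r₀ hr₀)
    have j₁ : Integrable fun y => D' r₀ • k₁ r₀ y := i₁.smul (D' r₀)
    have j₂ : Integrable fun y => s' r₀ • k₂ r₀ y := i₂.smul (s' r₀)
    rw [integral_add j₁ j₂, integral_smul, integral_smul]
    rfl
  · have hm := hmem r hr
    have h1 := (hd _ (frakD_pos H.κ_pos H.θ_pos hm.1 (c r).2) (x - y)).comp r (hD r)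
    have h2 := (hgd (deltaFlow κ θ (c r).1 (c r).2, y)
      ⟨H.deltaFlow_mem (le_of_lt hm.1) hm.2.1, mem_univ _⟩).scomp r (hs r)
    refine (h1.smul h2).congr_deriv ?_
    simp only [hk₁, hk₂, he, flowIntegrand, Function.comp_apply, smul_smul]
    rw [add_comm, mul_comm (D' r), mul_comm (s' r)]
  · exact ((hD'c.comp continuous_fst).continuousOn.smul cont₁).add
      ((hs'c.comp continuous_fst).continuousOn.smul cont₂)
  · exact ENNReal.add_ne_top.2 ⟨ENNReal.mul_ne_top ENNReal.ofReal_ne_top hC₁,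
      ENNReal.mul_ne_top ENNReal.ofReal_ne_top hC₂⟩
  · have hk₁m : Continuous (k₁ r) := continuous_flowIntegrand H hΦ' hg (hmem r hr)
    have e₁ : ‖D' r‖ₑ ≤ ENNReal.ofReal (|D' r₀| + 1) := by
      rw [← ofReal_norm]; exact ENNReal.ofReal_le_ofReal hr.2.1.le
    have e₂ : ‖s' r‖ₑ ≤ ENNReal.ofReal (|s' r₀| + 1) := by
      rw [← ofReal_norm]; exact ENNReal.ofReal_le_ofReal hr.2.2.le
    calc _ ≤ ∫⁻ y, (‖D' r‖ₑ * (ENNReal.ofReal (Real.exp |y|) * ‖k₁ r y‖ₑ)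
          + ‖s' r‖ₑ * (ENNReal.ofReal (Real.exp |y|) * ‖k₂ r y‖ₑ)) := by
          refine lintegral_mono fun y => ?_
          refine (mul_le_mul_right (enorm_add_le _ _) _).trans_eq ?_
          rw [enorm_smul, enorm_smul]; ring
      _ = ‖D' r‖ₑ * (∫⁻ y, ENNReal.ofReal (Real.exp |y|) * ‖k₁ r y‖ₑ)
          + ‖s' r‖ₑ * ∫⁻ y, ENNReal.ofReal (Real.exp |y|) * ‖k₂ r y‖ₑ := by
          rw [lintegral_add_left (by fun_prop), lintegral_const_mul' _ _ enorm_ne_top,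
            lintegral_const_mul' _ _ enorm_ne_top]
      _ ≤ _ := by
          gcongr
          · exact hb₁ _ hr.1.1
          · exact hb₂ _ hr.1.2

end Conv

/-! ### Continuity up to the initial time -/

section Initial

variable {κ θ α β A : ℝ}

/-- Away from the centre, the Gaussian density of variance `w²` is dominated by `e^{-A|u|}`,
`u = wζ`, uniformly for `w ≤ M`. -/
theorem exp_abs_mul_gaussianPDF_le {w M A ζ : ℝ} (hw : 0 ≤ w) (hwM : w ≤ M) (hA : 0 ≤ A)
    (hζ : 1 ≤ |w * ζ|) : Real.exp |ζ| * ProbabilityTheory.gaussianPDFReal 0 1 ζ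
      ≤ w * (Real.exp ((2 + A * M) ^ 2 / 2) * Real.exp (-A * |w * ζ|)) := by
  rw [abs_mul, abs_of_nonneg hw] at hζ ⊢
  have h1 : ProbabilityTheory.gaussianPDFReal 0 1 ζ ≤ Real.exp (-|ζ| ^ 2 / 2) := by
    rw [ProbabilityTheory.gaussianPDFReal, NNReal.coe_one, mul_one, mul_one, sub_zero, sq_abs]
    refine mul_le_of_le_one_left (Real.exp_nonneg _) (inv_le_one_of_one_le₀ ?_)
    rw [Real.one_le_sqrt]
    linarith [Real.pi_gt_three]
  set v := |ζ| with hv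
  have hv0 : 0 ≤ v := abs_nonneg ζ
  have h2 : 1 ≤ w * Real.exp v := hζ.trans (by
    gcongr
    linarith [Real.add_one_le_exp v])
  calc _ ≤ Real.exp v * Real.exp (-v ^ 2 / 2) := by gcongr
    _ ≤ (w * Real.exp v) * (Real.exp v * Real.exp (-v ^ 2 / 2)) :=
        le_mul_of_one_le_left (by positivity) h2
    _ = w * Real.exp (v + v + -v ^ 2 / 2) := by rw [Real.exp_add, Real.exp_add]; ring
    _ ≤ w * Real.exp ((2 + A * M) ^ 2 / 2 + -A * (w * v)) := by
        refine mul_le_mul_of_nonneg_left (Real.exp_le_exp.2 ?_) hw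
        have h3 : A * (w * v) ≤ A * (M * v) := by gcongr
        nlinarith [sq_nonneg (v - (2 + A * M))]
    _ = _ := by rw [Real.exp_add]

/-- The change of variables `u = wζ`; only an inequality, because `w = 0` is allowed. -/
theorem lintegral_comp_mul_le {w : ℝ} (hw : 0 ≤ w) {F : ℝ → ℝ≥0∞} (hF : Measurable F) :
    ENNReal.ofReal w * ∫⁻ ζ, F (w * ζ) ≤ ∫⁻ u, F u := by
  rcases hw.eq_or_lt with rfl | hw
  · simp
  · have h := lintegral_map (μ := (volume : Measure ℝ)) hF (measurable_const_mul w)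
    rw [← h, Real.map_volume_mul_left hw.ne', lintegral_smul_measure, smul_eq_mul, ← mul_assoc,
      ← ENNReal.ofReal_mul hw.le, abs_of_pos (inv_pos.2 hw), mul_inv_cancel₀ hw.ne',
      ENNReal.ofReal_one, one_mul]

/-- A bound for Gaussian averages that stays uniform as the variance `w²` tends to zero: near the
centre `g` is bounded, and away from it the Gaussian density is dominated by `e^{-A|u|}`. -/
theorem lintegral_exp_gauss_le {w M B z : ℝ} (hw : 0 ≤ w) (hwM : w ≤ M) (hA : 0 ≤ A) {g : ℝ → ℂ}
    (hg : Measurable g) (hB : ∀ u, |u| ≤ 1 → ‖g (z - u)‖ ≤ B) :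
    ∫⁻ ζ, ENNReal.ofReal (Real.exp |ζ|) * ‖g (z - w * ζ)‖ₑ ∂stdGauss
      ≤ ENNReal.ofReal B * ENNReal.ofReal (gaussMoment 1)
        + ENNReal.ofReal (Real.exp ((2 + A * M) ^ 2 / 2) * Real.exp (A * |z|)) *
          ∫⁻ y, ENNReal.ofReal (Real.exp (-A * |y|)) * ‖g y‖ₑ := by
  set ρ : ℝ → ℝ≥0∞ := ProbabilityTheory.gaussianPDF 0 1 with hρ
  have hρm : Measurable ρ := ProbabilityTheory.measurable_gaussianPDF 0 1
  set K := Real.exp ((2 + A * M) ^ 2 / 2) with hK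
  set F : ℝ → ℝ≥0∞ := fun u => ENNReal.ofReal (K * Real.exp (-A * |u|)) * ‖g (z - u)‖ₑ with hF
  have hFm : Measurable F := by fun_prop
  have hγ : stdGauss = volume.withDensity ρ := by
    rw [stdGauss, ProbabilityTheory.gaussianReal_of_var_ne_zero _ one_ne_zero]
  have hmom := lintegral_exp_abs_stdGauss 1
  rw [hγ, lintegral_withDensity_eq_lintegral_mul _ hρm (by fun_prop)] at hmom
  rw [hγ, lintegral_withDensity_eq_lintegral_mul _ hρm (by fun_prop)]
  calc ∫⁻ ζ, (ρ * fun ζ => ENNReal.ofReal (Real.exp |ζ|) * ‖g (z - w * ζ)‖ₑ) ζ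
      ≤ ∫⁻ ζ, (ENNReal.ofReal B * (ρ * fun ζ => ENNReal.ofReal (Real.exp (1 * |ζ|))) ζ
          + ENNReal.ofReal w * F (w * ζ)) := by
        refine lintegral_mono fun ζ => ?_
        simp only [Pi.mul_apply, one_mul]
        rcases le_total |w * ζ| 1 with h | h
        · refine le_add_right ?_
          have h1 : ‖g (z - w * ζ)‖ₑ ≤ ENNReal.ofReal B := by
            rw [← ofReal_norm]; exact ENNReal.ofReal_le_ofReal (hB _ h)
          calc ρ ζ * (ENNReal.ofReal (Real.exp |ζ|) * ‖g (z - w * ζ)‖ₑ)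
              ≤ ρ ζ * (ENNReal.ofReal (Real.exp |ζ|) * ENNReal.ofReal B) := by gcongr
            _ = _ := by ring
        · refine le_add_left ?_
          have h1 := exp_abs_mul_gaussianPDF_le hw hwM hA h
          rw [hF, ← mul_assoc, ← mul_assoc]
          refine mul_le_mul_left ?_ _
          rw [hρ, ProbabilityTheory.gaussianPDF, ← ENNReal.ofReal_mul
            (ProbabilityTheory.gaussianPDFReal_nonneg _ _ _), ← ENNReal.ofReal_mul hw]
          refine ENNReal.ofReal_le_ofReal ?_
          rw [mul_comm]
          exact h1
    _ = ENNReal.ofReal B * ENNReal.ofReal (gaussMoment 1)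
          + ENNReal.ofReal w * ∫⁻ ζ, F (w * ζ) := by
        have hm : Measurable (ρ * fun ζ => ENNReal.ofReal (Real.exp (1 * |ζ|))) :=
          hρm.mul (by fun_prop)
        rw [lintegral_add_left (hm.const_mul _), lintegral_const_mul _ hm, hmom,
          lintegral_const_mul' _ _ ENNReal.ofReal_ne_top]
    _ ≤ ENNReal.ofReal B * ENNReal.ofReal (gaussMoment 1) + ∫⁻ u, F u := by
        gcongr
        exact lintegral_comp_mul_le hw hFm
    _ ≤ _ := by
        refine add_le_add le_rfl ?_
        rw [← lintegral_sub_left_eq_self F z, ← lintegral_const_mul' _ _ ENNReal.ofReal_ne_top]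
        refine lintegral_mono fun y => ?_
        simp only [hF, sub_sub_cancel]
        rw [← mul_assoc, ← ENNReal.ofReal_mul (by positivity)]
        refine mul_le_mul_left (ENNReal.ofReal_le_ofReal ?_) _
        rw [mul_assoc, ← Real.exp_add (A * |z|)]
        refine mul_le_mul_of_nonneg_left (Real.exp_le_exp.2 ?_) (Real.exp_nonneg _)
        have h1 : |y| ≤ |z - y| + |z| := by
          have := abs_sub z (z - y)
          rw [sub_sub_cancel] at this
          linarith
        nlinarith

/-- The pointwise Gaussian average of `f` along the flow; it is the classical solution with initial
value `f`. -/
noncomputable def flowAverage (κ θ : ℝ) (f : ℝ × ℝ → ℂ) (t : ℝ) (p : ℝ × ℝ) : ℂ :=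
  superpose (stripSubst κ θ t) (fun _ _ => 1) f p

theorem flowAverage_zero (f : ℝ × ℝ → ℂ) (p : ℝ × ℝ) : flowAverage κ θ f 0 p = f p := by
  simp [flowAverage, superpose, stripSubst, frakD_zero, deltaFlow_zero]

/-- For positive times the average is a convolution with the heat kernel along the flow. -/
theorem flowAverage_eq (H : IsStripParams κ θ α β) (f : ℝ × ℝ → ℂ) {t : ℝ} (ht : 0 < t)
    (p : ℝ × ℝ) : flowAverage κ θ f t p = flowConv κ θ heatKernel f (t, p) :=
  superpose_lineSubst_eq (frakD_pos H.κ_pos H.θ_pos ht p.1) (fun y => f (deltaFlow κ θ t p.1, y))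
      p.2

/-- Continuity up to `t = 0`, where the kernel degenerates but the Gaussian average does not. -/
theorem continuousOn_flowAverage (H : IsStripParams κ θ α β) {f : ℝ × ℝ → ℂ}
    (hf : HasLocalMoments α β A f) (hA : 0 ≤ A) :
    ContinuousOn (fun q : ℝ × (ℝ × ℝ) => flowAverage κ θ f q.1 q.2) (Ici 0 ×ˢ strip α β) := by
  rintro q₀ ⟨ht₀, hp₀⟩
  have ht₀ : 0 ≤ q₀.1 := ht₀
  -- replacing `t` by `max t 0` makes the average meaningful in a full neighbourhood
  set D : ℝ × (ℝ × ℝ) → ℝ := fun q => frakD κ θ (max q.1 0) q.2.1 with hD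
  set δ : ℝ × (ℝ × ℝ) → ℝ := fun q => deltaFlow κ θ (max q.1 0) q.2.1 with hδ
  have hcD : Continuous D := by fun_prop
  have hcδ : Continuous δ := by fun_prop
  have hδ0 : δ q₀ ∈ Ioo α β := H.deltaFlow_mem (le_max_right _ _) hp₀.1
  obtain ⟨a, ha, ha'⟩ := exists_between hδ0.1
  obtain ⟨b, hb, hb'⟩ := exists_between hδ0.2
  set T := q₀.1 + 1 with hT
  set X := |q₀.2.2| + 1 with hX
  set Dm := β ^ 2 / 2 * T with hDm
  set W : Set (ℝ × (ℝ × ℝ)) := ((fun q => q.1) ⁻¹' Iio T ∩ (fun q => q.2) ⁻¹' strip α β) ∩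
    (δ ⁻¹' Ioo a b ∩ (fun q => |q.2.2|) ⁻¹' Iio X) with hWd
  have hW : IsOpen W := ((isOpen_Iio.preimage continuous_fst).inter
    ((isOpen_strip α β).preimage continuous_snd)).inter ((isOpen_Ioo.preimage hcδ).inter
      (isOpen_Iio.preimage (by fun_prop)))
  have hqW : q₀ ∈ W := ⟨⟨lt_add_one q₀.1, hp₀⟩, ⟨ha', hb⟩, lt_add_one |q₀.2.2|⟩
  obtain ⟨C, hC, hCf⟩ := hf.bound a b ha hb'
  have hT0 : 0 < T := by positivity
  have hDm0 : 0 ≤ Dm := by positivity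
  have hcpt : IsCompact (Icc a b ×ˢ Icc (-(X + Dm + 1)) (X + Dm + 1)) :=
    isCompact_Icc.prod isCompact_Icc
  obtain ⟨B, hB⟩ := hcpt.exists_bound_of_continuousOn (hf.cont.mono fun p hp =>
    mem_prod.2 ⟨⟨ha.trans_le hp.1.1, hp.1.2.trans_lt hb'⟩, mem_univ _⟩)
  set k : ℝ × (ℝ × ℝ) → ℝ → ℂ := fun q ζ => f (δ q, q.2.2 - D q - √(2 * D q) * ζ) with hk
  have hkc : ContinuousOn (Function.uncurry k) (W ×ˢ univ) := by
    have h : ContinuousOn (f ∘ fun r : (ℝ × (ℝ × ℝ)) × ℝ =>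
        (δ r.1, r.1.2.2 - D r.1 - √(2 * D r.1) * r.2)) (W ×ˢ univ) :=
      hf.cont.comp (Continuous.continuousOn (by fun_prop)) fun r hr =>
        mem_prod.2 ⟨H.deltaFlow_mem (le_max_right _ _) hr.1.1.2.1, mem_univ _⟩
    exact h
  have hbd : ∀ q ∈ W, ∫⁻ ζ, ENNReal.ofReal (Real.exp |ζ|) * ‖k q ζ‖ₑ ∂stdGauss
      ≤ ENNReal.ofReal B * ENNReal.ofReal (gaussMoment 1)
        + ENNReal.ofReal (Real.exp ((2 + A * √(2 * Dm)) ^ 2 / 2) * Real.exp (A * (X + Dm))) * C :=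
            by
    rintro q ⟨⟨h1, h2⟩, h3, h4⟩
    have h1 : q.1 < T := h1
    have h4 : |q.2.2| < X := h4
    have hD0 : 0 ≤ D q := frakD_nonneg H.κ_pos H.θ_pos (le_max_right _ _) _
    have hD1 : D q ≤ Dm := H.frakD_le (le_max_right _ _) (max_le h1.le hT0.le) h2.1
    have hz : |q.2.2 - D q| ≤ X + Dm := by
      refine (abs_sub _ _).trans ?_
      rw [abs_of_nonneg hD0]; linarith
    have hfm : Measurable fun y => f (δ q, y) := by
      have h : Continuous (f ∘ fun y : ℝ => (δ q, y)) := hf.cont.comp_continuous (by fun_prop)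
        fun y => mem_prod.2 ⟨H.deltaFlow_mem (le_max_right _ _) h2.1, mem_univ _⟩
      exact h.measurable
    refine (lintegral_exp_gauss_le (A := A) (B := B) (z := q.2.2 - D q) (Real.sqrt_nonneg (2 * D q))
      (Real.sqrt_le_sqrt (by linarith : 2 * D q ≤ 2 * Dm)) hA hfm fun u hu => ?_).trans ?_
    · refine hB _ (mem_prod.2 ⟨Ioo_subset_Icc_self h3, abs_le.1 ?_⟩)
      refine (abs_sub _ _).trans ?_
      linarith
    · gcongr
      exact hCf _ (Ioo_subset_Icc_self h3)
  have hcont := continuousOn_integral_of_tail hW hkc (ENNReal.add_ne_top.2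
    ⟨ENNReal.mul_ne_top ENNReal.ofReal_ne_top ENNReal.ofReal_ne_top,
      ENNReal.mul_ne_top ENNReal.ofReal_ne_top hC⟩) hbd
  have hat : ContinuousAt (fun q => ∫ ζ, k q ζ ∂stdGauss) q₀ := hcont.continuousAt (hW.mem_nhds hqW)
  have he : ∀ q ∈ Ici (0 : ℝ) ×ˢ strip α β,
      flowAverage κ θ f q.1 q.2 = ∫ ζ, k q ζ ∂stdGauss := fun q hq => by
    have hq0 : max q.1 0 = q.1 := max_eq_left hq.1
    simp only [flowAverage, superpose, stripSubst, one_smul, hk, hδ, hD, hq0, sub_sub]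
  exact hat.continuousWithinAt.congr he (he q₀ ⟨ht₀, hp₀⟩)

end Initial

/-! ### Classical solutions -/

section Classical

variable {κ θ α β A lam : ℝ} {f : ℝ × ℝ → ℂ}

/-- The hypothesis of local boundedness in `L²_m` yields the local moment bounds. -/
theorem hasLocalMoments_of_eLpNorm_le {g : ℝ × ℝ → ℂ} (hc : ContinuousOn g (strip α β)) (m : ℝ)
    (hb : ∀ a b : ℝ, α < a → b < β → ∃ C : ℝ≥0, ∀ σ ∈ Icc a b,
      eLpNorm (fun x => g (σ, x)) 2 (weightMeasure m) ≤ C) : HasLocalMoments α β (|m| + 1) g where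
  cont := hc
  bound := fun a b ha hb' => by
    obtain ⟨C, hC⟩ := hb a b ha hb'
    refine ⟨(C : ℝ≥0∞) ^ 2 + ∫⁻ x, ENNReal.ofReal
      (Real.exp (-2 * (|m| + 1) * |x|) * Real.exp (2 * |m| * √(1 + x ^ 2))),
      (ENNReal.add_lt_top.2 ⟨ENNReal.pow_lt_top ENNReal.coe_lt_top,
        (integrable_exp_mul_weight m).lintegral_lt_top⟩).ne, fun s hs => ?_⟩
    have hcs : Continuous fun y : ℝ => g (s, y) := by
      have h : Continuous (g ∘ fun y : ℝ => (s, y)) := hc.comp_continuous (by fun_prop)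
        fun y => mem_prod.2 ⟨⟨ha.trans_le hs.1, hs.2.trans_lt hb'⟩, mem_univ _⟩
      exact h
    refine (lintegral_exp_mul_le m hcs.aestronglyMeasurable).trans ?_
    gcongr
    exact hC s hs

theorem flowConv_sub (H : IsStripParams κ θ α β) (hf : HasLocalMoments α β A f) (hA : 0 ≤ A)
    {q : ℝ × (ℝ × ℝ)} (hq : q ∈ timeStrip α β) :
    flowConv κ θ (fun τ w => heatKernelXX τ w - heatKernelX τ w) f q
      = flowConv κ θ heatKernelXX f q - flowConv κ θ heatKernelX f q := by
  have h1 := integrable_flowConv H isRapidKernel_heatKernelXX hf hA hq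
  have h2 := integrable_flowConv H isRapidKernel_heatKernelX hf hA hq
  rw [flowConv, flowConv, flowConv, ← integral_sub h1 h2]
  congr 1; ext y
  simp only [flowIntegrand, sub_smul]

theorem hasDerivAt_flowAverage_space (H : IsStripParams κ θ α β) (hf : HasLocalMoments α β A f)
    (hA : 0 ≤ A) {t σ x : ℝ} (hq : (t, (σ, x)) ∈ timeStrip α β) :
    HasDerivAt (fun y => flowAverage κ θ f t (σ, y))
      (flowConv κ θ heatKernelX f (t, (σ, x))) x := by
  have e : (fun y => flowAverage κ θ f t (σ, y)) = fun y => flowConv κ θ heatKernel f (t, (σ, y)) :=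
    funext fun y => flowAverage_eq H f hq.1 (σ, y)
  rw [e]
  exact hasDerivAt_flowConv_space H isRapidKernel_heatKernel isRapidKernel_heatKernelX
    (fun τ hτ w => hasDerivAt_heatKernel hτ w) hf hA hq

theorem dX_flowAverage (H : IsStripParams κ θ α β) (hf : HasLocalMoments α β A f)
    (hA : 0 ≤ A) {t : ℝ} {p : ℝ × ℝ} (hq : (t, p) ∈ timeStrip α β) :
    dX (flowAverage κ θ f t) p = flowConv κ θ heatKernelX f (t, p) :=
  (hasDerivAt_flowAverage_space H hf hA hq).deriv

theorem hasDerivAt_dX_flowAverage (H : IsStripParams κ θ α β) (hf : HasLocalMoments α β A f)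
    (hA : 0 ≤ A) {t σ x : ℝ} (hq : (t, (σ, x)) ∈ timeStrip α β) :
    HasDerivAt (fun y => dX (flowAverage κ θ f t) (σ, y))
      (flowConv κ θ heatKernelXX f (t, (σ, x))) x := by
  have e : (fun y => dX (flowAverage κ θ f t) (σ, y))
      = fun y => flowConv κ θ heatKernelX f (t, (σ, y)) := funext fun y =>
    dX_flowAverage H hf hA (mem_prod.2 ⟨hq.1, mem_prod.2 ⟨hq.2.1, mem_univ _⟩⟩)
  rw [e]
  exact hasDerivAt_flowConv_space H isRapidKernel_heatKernelX isRapidKernel_heatKernelXX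
    (fun τ hτ w => hasDerivAt_heatKernelX hτ w) hf hA hq

/-- The derivative in `σ`: the parameter `𝔇` moves with speed `∂_σ 𝔇`, the point `δ_t(σ)` with
speed `e^{-κt}`. -/
theorem hasDerivAt_flowAverage_vol (H : IsStripParams κ θ α β) (hf : HasLocalMoments α β A f)
    (hfs : HasLocalMoments α β A (dS f)) (hA : 0 ≤ A) (h12 : HasC12Derivs (strip α β) f)
    {t σ x : ℝ} (hq : (t, (σ, x)) ∈ timeStrip α β) :
    HasDerivAt (fun s => flowAverage κ θ f t (s, x))
      (frakDs κ θ t σ • flowConv κ θ (fun τ w => heatKernelXX τ w - heatKernelX τ w) f (t, (σ, x))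
        + Real.exp (-κ * t) • flowConv κ θ heatKernel (dS f) (t, (σ, x))) σ := by
  have e : (fun s => flowAverage κ θ f t (s, x)) = fun s => flowConv κ θ heatKernel f (t, (s, x)) :=
    funext fun s => flowAverage_eq H f hq.1 (s, x)
  rw [e]
  exact hasDerivAt_flowConv_curve (c := fun s => (t, s)) (D' := frakDs κ θ t)
    (s' := fun _ => Real.exp (-κ * t)) H isRapidKernel_heatKernel
    (isRapidKernel_heatKernelXX.sub isRapidKernel_heatKernelX)
    (fun τ hτ w => hasDerivAt_heatKernel_time hτ w) hf hfs hA
    (fun p hp => (h12 p hp).1.hasDerivAt) (by fun_prop) (contDiff_frakDs t).continuous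
    continuous_const (fun r => hasDerivAt_frakD_space H.κ_pos.ne' t r)
    (fun r => hasDerivAt_deltaFlow_space t r) hq

/-- The derivative in `t`: the parameter `𝔇` moves with speed `δ_t(σ)²/2`, the point `δ_t(σ)` with
speed `κ(θ - δ_t(σ))`. -/
theorem hasDerivAt_flowAverage_time (H : IsStripParams κ θ α β) (hf : HasLocalMoments α β A f)
    (hfs : HasLocalMoments α β A (dS f)) (hA : 0 ≤ A) (h12 : HasC12Derivs (strip α β) f)
    {t σ x : ℝ} (hq : (t, (σ, x)) ∈ timeStrip α β) :
    HasDerivAt (fun r => flowAverage κ θ f r (σ, x))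
      ((deltaFlow κ θ t σ ^ 2 / 2) •
          flowConv κ θ (fun τ w => heatKernelXX τ w - heatKernelX τ w) f (t, (σ, x))
        + (κ * (θ - deltaFlow κ θ t σ)) • flowConv κ θ heatKernel (dS f) (t, (σ, x))) t := by
  have e : (fun r => flowAverage κ θ f r (σ, x))
      =ᶠ[𝓝 t] fun r => flowConv κ θ heatKernel f (r, (σ, x)) :=
    (eventually_gt_nhds (show 0 < t from hq.1)).mono fun r hr => flowAverage_eq H f hr (σ, x)
  have h := hasDerivAt_flowConv_curve (x := x) (c := fun r => (r, σ))
    (D' := fun r => deltaFlow κ θ r σ ^ 2 / 2)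
    (s' := fun r => κ * (θ - deltaFlow κ θ r σ)) H isRapidKernel_heatKernel
    (isRapidKernel_heatKernelXX.sub isRapidKernel_heatKernelX)
    (fun τ hτ w => hasDerivAt_heatKernel_time hτ w) hf hfs hA
    (fun p hp => (h12 p hp).1.hasDerivAt) (by fun_prop) (by fun_prop)
    (by fun_prop) (fun r => hasDerivAt_frakD_time H.κ_pos.ne' r σ)
    (fun r => hasDerivAt_deltaFlow_time r σ) (r₀ := t) hq
  exact h.congr_of_eventuallyEq e

/-- The derivatives combine to the equation by the transport equation for `𝔇` and
`κ(θ - δ_t(σ)) = κ(θ - σ) e^{-κt}`. -/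
theorem isClassicalSolution_flowAverage (H : IsStripParams κ θ α β)
    (hf : HasLocalMoments α β A f) (hfs : HasLocalMoments α β A (dS f)) (hA : 0 ≤ A)
    (h12 : HasC12Derivs (strip α β) f) {T : ℝ} (hT : 0 < T) :
    IsClassicalSolution κ θ (strip α β) T 0 f (flowAverage κ θ f) := by
  have hmem : ∀ q ∈ Ioc 0 T ×ˢ strip α β, q ∈ timeStrip α β := fun q hq =>
    mem_prod.2 ⟨(mem_prod.1 hq).1.1, (mem_prod.1 hq).2⟩
  have hKt := isRapidKernel_heatKernelXX.sub isRapidKernel_heatKernelX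
  have cS := (continuousOn_flowConv H isRapidKernel_heatKernel hfs hA).mono hmem
  have cX := (continuousOn_flowConv H isRapidKernel_heatKernelX hf hA).mono hmem
  have cXX := (continuousOn_flowConv H isRapidKernel_heatKernelXX hf hA).mono hmem
  have cT := (continuousOn_flowConv H hKt hf hA).mono hmem
  have dt : ∀ q ∈ Ioc 0 T ×ˢ strip α β, derivWithin (fun s => flowAverage κ θ f s q.2) (Icc 0 T) q.1
      = (deltaFlow κ θ q.1 q.2.1 ^ 2 / 2) •
          flowConv κ θ (fun τ w => heatKernelXX τ w - heatKernelX τ w) f q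
        + (κ * (θ - deltaFlow κ θ q.1 q.2.1)) • flowConv κ θ heatKernel (dS f) q := fun q hq => by
    have h := (hasDerivAt_flowAverage_time H hf hfs hA h12 (hmem q hq)).hasDerivWithinAt (s := Icc
        0 T)
    exact h.derivWithin (uniqueDiffOn_Icc hT _ (Ioc_subset_Icc_self (mem_prod.1 hq).1))
  have ds : ∀ q ∈ Ioc 0 T ×ˢ strip α β, dS (flowAverage κ θ f q.1) q.2
      = frakDs κ θ q.1 q.2.1 • flowConv κ θ (fun τ w => heatKernelXX τ w - heatKernelX τ w) f q
        + Real.exp (-κ * q.1) • flowConv κ θ heatKernel (dS f) q := fun q hq =>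
    (hasDerivAt_flowAverage_vol H hf hfs hA h12 (hmem q hq)).deriv
  have dx : ∀ q ∈ Ioc 0 T ×ˢ strip α β, dX (flowAverage κ θ f q.1) q.2
      = flowConv κ θ heatKernelX f q := fun q hq => dX_flowAverage H hf hA (hmem q hq)
  have dxx : ∀ q ∈ Ioc 0 T ×ˢ strip α β, dX (dX (flowAverage κ θ f q.1)) q.2
      = flowConv κ θ heatKernelXX f q := fun q hq =>
    (hasDerivAt_dX_flowAverage H hf hA (hmem q hq)).deriv
  refine ⟨(continuousOn_flowAverage H hf hA).mono (prod_mono Icc_subset_Ici_self le_rfl),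
    fun p _ => flowAverage_zero f p, fun t ht => ⟨fun p hp => ?_, fun p hp => ?_⟩, ?_, ?_, ?_, ?_,
        ?_⟩
  · have hq : (t, p) ∈ timeStrip α β := mem_prod.2 ⟨ht.1, hp⟩
    exact ⟨(hasDerivAt_flowAverage_vol H hf hfs hA h12 hq).differentiableAt,
      (hasDerivAt_flowAverage_space H hf hA hq).differentiableAt,
      (hasDerivAt_dX_flowAverage H hf hA hq).differentiableAt⟩
  · have hq : (t, p) ∈ timeStrip α β := mem_prod.2 ⟨ht.1, hp⟩
    exact (hasDerivAt_flowAverage_time H hf hfs hA h12 hq).differentiableAt.differentiableWithinAt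
  · have c1 : Continuous fun q : ℝ × (ℝ × ℝ) => deltaFlow κ θ q.1 q.2.1 ^ 2 / 2 := by fun_prop
    have c2 : Continuous fun q : ℝ × (ℝ × ℝ) => κ * (θ - deltaFlow κ θ q.1 q.2.1) := by fun_prop
    exact ((c1.continuousOn.smul cT).add (c2.continuousOn.smul cS)).congr dt
  · have c1 : Continuous fun q : ℝ × (ℝ × ℝ) => frakDs κ θ q.1 q.2.1 := by
      fun_prop
    have c2 : Continuous fun q : ℝ × (ℝ × ℝ) => Real.exp (-κ * q.1) := by fun_prop
    exact ((c1.continuousOn.smul cT).add (c2.continuousOn.smul cS)).congr ds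
  · exact cX.congr dx
  · exact cXX.congr dxx
  · intro t ht p hp
    have hq : (t, p) ∈ Ioc 0 T ×ˢ strip α β := mem_prod.2 ⟨ht, hp⟩
    have e1 := dt _ hq
    have e2 := ds _ hq
    have e3 := dx _ hq
    have e4 := dxx _ hq
    simp only at e1 e2 e3 e4
    rw [e1, e2, e3, e4, flowConv_sub H hf hA (hmem _ hq), frakD_transport H.κ_pos.ne', deltaFlow_eq]
    simp only [Complex.real_smul, Pi.zero_apply]
    push_cast
    ring

/-- The operators of the semigroup act by the pointwise formula. -/
theorem stripOp_ae_eq_flowAverage (H : IsStripParams κ θ α β) {h : L2Strip α β lam}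
    (hf : h =ᵐ[stripMeasure α β lam] f) {t : ℝ} (ht : 0 ≤ t) :
    stripOp H lam t h =ᵐ[stripMeasure α β lam] flowAverage κ θ f t :=
  (coeFn_stripOp H ht h).trans
    ((isSuperposition_stripSubst H lam (isExpWeight_one α β) ht le_rfl).superpose_congr hf)

theorem exists_isClassicalSolution (H : IsStripParams κ θ α β) {h : L2Strip α β lam}
    (hf : h =ᵐ[stripMeasure α β lam] f) (h12 : IsC12On (strip α β) f)
    (hb : HasLocallyBoundedSlices α β f) :
    ∃ U : ℝ → ℝ × ℝ → ℂ,
      (∀ t : ℝ, 0 ≤ t → stripOp H lam t h =ᵐ[stripMeasure α β lam] U t) ∧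
      ∀ T : ℝ, 0 < T → IsClassicalSolution κ θ (strip α β) T 0 f U := by
  obtain ⟨m, hm⟩ := hb
  have h1 := hasLocalMoments_of_eLpNorm_le h12.2.1 m fun a b ha hb => by
    obtain ⟨C, hC⟩ := hm a b ha hb
    exact ⟨C, fun σ hσ => (hC σ hσ).1⟩
  have h2 := hasLocalMoments_of_eLpNorm_le h12.2.2.1 m fun a b ha hb => by
    obtain ⟨C, hC⟩ := hm a b ha hb
    exact ⟨C, fun σ hσ => (hC σ hσ).2⟩
  exact ⟨flowAverage κ θ f, fun t ht => stripOp_ae_eq_flowAverage H hf ht, fun T hT =>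
    isClassicalSolution_flowAverage H h1 h2 (by positivity) h12.1 hT⟩

/-- The kernel formula; the slices of `h` are square integrable at `δ_t(σ)` for almost every `σ`. -/
theorem stripOp_kernel (H : IsStripParams κ θ α β) (h : L2Strip α β lam) {t : ℝ} (ht : 0 < t) :
    ∀ᵐ σ ∂((volume : Measure ℝ).restrict (Ioo α β)),
      0 < frakD κ θ t σ ∧
      (∀ x : ℝ, Integrable
        (kernelIntegrand (frakD κ θ t σ) (fun y => h (deltaFlow κ θ t σ, y)) x)) ∧
      ∀ᵐ x : ℝ, stripOp H lam t h (σ, x) =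
        ((1 / Real.sqrt (4 * Real.pi * frakD κ θ t σ) : ℝ) : ℂ) *
          ∫ y : ℝ, kernelIntegrand (frakD κ θ t σ) (fun y => h (deltaFlow κ θ t σ, y)) x y := by
  filter_upwards [ae_deltaFlow H ht.le (ae_memLp_slice h), ae_ae_stripOp H ht.le h] with σ h1 h2
  have hD : 0 < frakD κ θ t σ := frakD_pos H.κ_pos H.θ_pos ht σ
  refine ⟨hD, fun x => integrable_kernelIntegrand hD h1 x, ?_⟩
  filter_upwards [ae_ae_weightMeasure_iff.1 h2] with x hx
  rw [hx, superpose_lineSubst_eq hD, integral_heatKernel_eq]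

end Classical

theorem corollary4p10 (κ θ α β lam : ℝ) (hκ : 0 < κ) (hα : 0 < α) (hαθ : α < θ) (hθβ : θ < β) :
    -- `B` generates a semigroup, so that `e^{𝔇(t,σ) B}` below is meaningful
    (∃ E : ℝ → L2Line lam →L[ℂ] L2Line lam, Generates (opB lam) E) ∧
    ∃ S : ℝ → L2Strip α β lam →L[ℂ] L2Strip α β lam,
      -- `S(t) = e^{𝔇(t) B} e^{tA}`, where `(e^{tA} h)(σ) = h(δ_t(σ))`
      (∀ t : ℝ, 0 ≤ t → ∀ h : L2Strip α β lam,
        ∀ᵐ σ ∂((volume : Measure ℝ).restrict (Ioo α β)),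
          slice lam (S t h) σ =
            expSemigroup (opB lam) (frakD κ θ t σ) (slice lam h (deltaFlow κ θ t σ))) ∧
      -- `S(t) = e^{t L₀}`
      Generates (opL0 κ θ α β lam) S ∧
      ∀ h : L2Strip α β lam,
        -- the explicit kernel
        (∀ t : ℝ, 0 < t → ∀ᵐ σ ∂((volume : Measure ℝ).restrict (Ioo α β)),
          0 < frakD κ θ t σ ∧
          (∀ x : ℝ, Integrable
            (kernelIntegrand (frakD κ θ t σ) (fun y => h (deltaFlow κ θ t σ, y)) x)) ∧
          ∀ᵐ x : ℝ, S t h (σ, x) =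
            ((1 / Real.sqrt (4 * Real.pi * frakD κ θ t σ) : ℝ) : ℂ) *
              ∫ y : ℝ,
                kernelIntegrand (frakD κ θ t σ) (fun y => h (deltaFlow κ θ t σ, y)) x y) ∧
        -- mild solution
        (∀ T : ℝ, 0 < T → IsMildSolution (opL0 κ θ α β lam) T 0 h (fun t => S t h)) ∧
        -- strong solution for initial data in `H²_lam(I × ℝ)`
        (MemSobolev (strip α β) (stripMeasure α β lam) 2 h →
          ∀ T : ℝ, 0 < T → IsStrongSolution (opL0 κ θ α β lam) T 0 h (fun t => S t h)) ∧
        -- classical solution for initial data in `C^{1,2}(I × ℝ)`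
        (∀ f : ℝ × ℝ → ℂ, h =ᵐ[stripMeasure α β lam] f → IsC12On (strip α β) f →
          HasLocallyBoundedSlices α β f →
          ∃ U : ℝ → ℝ × ℝ → ℂ,
            (∀ t : ℝ, 0 ≤ t → S t h =ᵐ[stripMeasure α β lam] U t) ∧
            ∀ T : ℝ, 0 < T → IsClassicalSolution κ θ (strip α β) T 0 f U) := by
  have H : IsStripParams κ θ α β := ⟨hκ, hα, hαθ, hθβ⟩
  have hE : Generates (opB lam) (heat lam) := generates_opB
  have hS : Generates (opL0 κ θ α β lam) (stripOp H lam) := generates_opL0 H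
  refine ⟨⟨heat lam, hE⟩, stripOp H lam, fun t ht h => ?_, hS, fun h => ⟨fun t ht => ?_,
    fun T _ => hS.isMildSolution T h, fun hh T _ => ?_,
    fun f hf h12 hb => exists_isClassicalSolution H hf h12 hb⟩⟩
  · filter_upwards [slice_stripOp H ht h] with σ hσ
    rw [hσ, hE.expSemigroup_eq (frakD_nonneg hκ H.θ_pos ht σ)]
  · exact stripOp_kernel H h ht
  · obtain ⟨η, hη⟩ := exists_of_memSobolev_strip (κ := κ) (θ := θ) hh
    exact hS.isStrongSolution (fun ξ η hξ t ht => opL0_invariant H hξ ht)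
      (fun ξ η hξ t ht => stripOp_sub_eq_integral H hξ ht) T hη
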